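/- Let $n\ge 3$ be an integer, and let $[x,y]=x_{n+1}y_{n+1}-x_1y_1-\dots-x_ny_n$ on $\mathbb R^{n+1}$. Let $\mathbb H^n=\{x\in\mathbb R^{n+1}:[x,x]=1,\ x_{n+1}>0\}$ be hyperbolic space with geodesic distance $\cosh \operatorname{dist}(x,y)=[x,y]$ and origin $e_{n+1}=(0,\dots,0,1)$. Points of $\mathbb H^n$ are written $x=(x',x_{n+1})=(x',\sqrt{1+|x'|^2})$ with $x'\in\mathbb R^n$. Let $R>0$, $B=\{x\in\mathbb H^n:\operatorname{dist}(x,e_{n+1})<R\}$, and $\partial B=\{\xi\in\mathbb H^n:\operatorname{dist}(\xi,e_{n+1})=R\}$, with surface measure $d\xi$. For $x\in\mathbb H^n$ and $t>1$ let $$(Mf)(x,t)=\frac{(t^2-1)^{(1-n)/2}}{\sigma_{n-1}}\int_{[x,y]=t}f(y)\,d\sigma(y),\qquad \sigma_{n-1}=\frac{2\pi^{n/2}}{\Gamma(n/2)},$$ be the mean value of $f$ over the geodesic sphere $\{y\in\mathbb H^n:[x,y]=t\}$, where $d\sigma$ is its surface measure in $\mathbb H^n$. Let $f$ be a real- or complex-valued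 $C^\infty$ function on $\mathbb H^n$ whose (closed) support is contained in $B$. Then for every $\xi\in\partial B$ the function $t\mapsto (Mf)(\xi,t)(t^2-1)^{n/2-1}$ is $C^\infty$ on $(1,\infty)$, and $f$ is reconstructed from the values $(Mf)(\xi,t)$, $\xi\in\partial B$, $t>1$, as follows. For $x\in B$ put $$f_0(x)=-\int_{\partial B}\Big(\frac{d}{dt}\Big)^{n-3}\Big[(Mf)(\xi,t)(t^2-1)^{n/2-1}\Big]\Big|_{t=[\xi,x]}\,d\xi\qquad\text{if } n \text{ is odd},$$ $$f_0(x)=\frac1\pi\int_{\partial B}d\xi\int_1^{\cosh 2R}\Big(\frac{d}{dt}\Big)^{n-2}\Big[(Mf)(\xi,t)(t^2-1)^{n/2-1}\Big]\log|t-[\xi,x]|\,dt\qquad\text{if } n \text{ is even}.$$ These integrals converge absolutely (for even $n$, as iterated integrals), the function $x'\mapsto f_0(x',\sqrt{1+|x'|^2})$ is $C^2$ on $\{x'\in\mathbb R^n:|x'|<\sinh R\}$, and for every $x\in B$ $$f(x)=\frac{d_n\,x_{n+1}}{\sinh R}\,\Delta_{x'}\Big[f_0\big(x',\sqrt{1+|x'|^2}\big)\Big],\qquad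 d_n=\frac{(-1)^{[n/2-1]}}{2^{n-1}\pi^{n/2-1}\Gamma(n/2)},$$ where $\Delta_{x'}=\partial_1^2+\dots+\partial_n^2$ and $[n/2-1]$ is the integer part of $n/2-1$. -/

import Mathlib

open MeasureTheory Set
open scoped ContDiff

noncomputable section

/-- The pseudo-Euclidean space `E^{n,1}` of real `(n+1)`-vectors, written as pairs
`x = (x', x_{n+1})` with `x' ∈ ℝⁿ`. Only its vector space structure, its topology and its Borel
sets are used. -/
abbrev Lorentz (n : ℕ) : Type := EuclideanSpace ℝ (Fin n) × ℝ

/-- The form `[x, y] = -x₁y₁ - ... - xₙyₙ + x_{n+1}y_{n+1}`. -/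
def lorentzForm {n : ℕ} (x y : Lorentz n) : ℝ := x.2 * y.2 - inner ℝ x.1 y.1

/-- Hyperbolic space `ℍⁿ`: the sheet `x_{n+1} > 0` of the hyperboloid `[x, x] = 1`. -/
abbrev Hyp (n : ℕ) : Type := {x : Lorentz n // lorentzForm x x = 1 ∧ 0 < x.2}

namespace Hyp

/-- The form `[x, y]` restricted to `ℍⁿ`. -/
def form {n : ℕ} (x y : Hyp n) : ℝ := lorentzForm x.1 y.1

theorem norm_sq {n : ℕ} (x : Hyp n) : ‖x.1.1‖ ^ 2 = x.1.2 ^ 2 - 1 := by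
  have h := x.2.1
  simp only [lorentzForm, real_inner_self_eq_norm_sq] at h
  linarith

/-- The global graph chart of `ℍⁿ`, read backwards: `x' ↦ (x', √(1 + |x'|²))`. -/
def lift {n : ℕ} (v : EuclideanSpace ℝ (Fin n)) : Hyp n :=
  ⟨(v, √(1 + ‖v‖ ^ 2)), by
    have h : (0 : ℝ) < 1 + ‖v‖ ^ 2 := by positivity
    refine ⟨?_, Real.sqrt_pos.2 h⟩
    simp only [lorentzForm, real_inner_self_eq_norm_sq, Real.mul_self_sqrt h.le]
    ring⟩

theorem lift_fst {n : ℕ} (x : Hyp n) : lift x.1.1 = x := by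
  apply Subtype.ext
  refine Prod.ext rfl ?_
  change √(1 + ‖x.1.1‖ ^ 2) = x.1.2
  rw [norm_sq, show 1 + (x.1.2 ^ 2 - 1) = x.1.2 ^ 2 by ring, Real.sqrt_sq x.2.2.le]

/-- The origin `e_{n+1} = (0, ..., 0, 1)` of `ℍⁿ`. -/
def origin (n : ℕ) : Hyp n := ⟨(0, 1), by simp [lorentzForm]⟩

/-- The geodesic distance: `cosh (dist x y) = [x, y]`. -/
def gdist {n : ℕ} (x y : Hyp n) : ℝ := Real.arcosh (form x y)

/-- The open geodesic ball of radius `R` about the origin. -/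
def gball (n : ℕ) (R : ℝ) : Set (Hyp n) := {x | gdist x (origin n) < R}

/-- The boundary of the geodesic ball of radius `R` about the origin. -/
def gsphere (n : ℕ) (R : ℝ) : Set (Hyp n) := {x | gdist x (origin n) = R}

/-- Infinite differentiability on `ℍⁿ`, in the global graph chart. -/
def Smooth {n : ℕ} {F : Type*} [NormedAddCommGroup F] [NormedSpace ℝ F] (f : Hyp n → F) : Prop :=
  ContDiff ℝ ∞ fun v : EuclideanSpace ℝ (Fin n) => f (lift v)

/-- The hyperbolic motion (Lorentz boost) that carries the origin to `x`. -/
def boost {n : ℕ} (x y : Hyp n) : Hyp n :=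
  ⟨(y.1.1 + (inner ℝ x.1.1 y.1.1 / (1 + x.1.2) + y.1.2) • x.1.1,
      inner ℝ x.1.1 y.1.1 + x.1.2 * y.1.2), by
    have hx := norm_sq x
    have hy := norm_sq y
    have ha := x.2.2
    have hb := y.2.2
    have hp := abs_le.1 (abs_real_inner_le_norm x.1.1 y.1.1)
    constructor
    · simp only [lorentzForm, real_inner_self_eq_norm_sq]
      rw [norm_add_sq_real, norm_smul, mul_pow, Real.norm_eq_abs, sq_abs, inner_smul_right,
        real_inner_comm, hx, hy]
      generalize inner ℝ x.1.1 y.1.1 = p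
      have h1 : (1 + x.1.2 : ℝ) ≠ 0 := by positivity
      field_simp
      ring
    · have h1 : ‖x.1.1‖ < x.1.2 := lt_of_pow_lt_pow_left₀ 2 ha.le (by linarith)
      have h2 : ‖y.1.1‖ < y.1.2 := lt_of_pow_lt_pow_left₀ 2 hb.le (by linarith)
      have h3 : ‖x.1.1‖ * ‖y.1.1‖ < x.1.2 * y.1.2 :=
        mul_lt_mul'' h1 h2 (norm_nonneg _) (norm_nonneg _)
      change 0 < inner ℝ x.1.1 y.1.1 + x.1.2 * y.1.2
      linarith [hp.1]⟩

theorem boost_origin {n : ℕ} (x : Hyp n) : boost x (origin n) = x := by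
  apply Subtype.ext
  refine Prod.ext ?_ ?_ <;> simp [boost, origin]

theorem origin_boost {n : ℕ} (x : Hyp n) : boost (origin n) x = x := by
  apply Subtype.ext
  refine Prod.ext ?_ ?_ <;> simp [boost, origin]

/-- The map `boost x` preserves the form, so it is indeed a hyperbolic motion. -/
theorem form_boost {n : ℕ} (x y z : Hyp n) : form (boost x y) (boost x z) = form y z := by
  have hx := norm_sq x
  have h1 : (1 + x.1.2 : ℝ) ≠ 0 := by have := x.2.2; positivity
  simp only [form, lorentzForm, boost, inner_add_left, inner_add_right, real_inner_smul_left,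
    real_inner_smul_right, real_inner_self_eq_norm_sq, hx]
  rw [real_inner_comm x.1.1 y.1.1]
  generalize inner ℝ x.1.1 y.1.1 = p
  generalize inner ℝ x.1.1 z.1.1 = q
  field_simp
  ring

/-- The point `y = boost x (u √(t² - 1), t)` of the geodesic sphere `[x, y] = t`, `1 ≤ t`, in the
direction `u ∈ S^{n-1}`. -/
def spherePoint {n : ℕ} (x : Hyp n) (t : ℝ)
    (u : Metric.sphere (0 : EuclideanSpace ℝ (Fin n)) 1) : Hyp n :=
  boost x (lift (√(t ^ 2 - 1) • (u : EuclideanSpace ℝ (Fin n))))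

theorem form_spherePoint {n : ℕ} (x : Hyp n) {t : ℝ} (ht : 1 ≤ t)
    (u : Metric.sphere (0 : EuclideanSpace ℝ (Fin n)) 1) : form x (spherePoint x t u) = t := by
  have h0 : (0 : ℝ) ≤ t ^ 2 - 1 := by nlinarith
  have hu : ‖(u : EuclideanSpace ℝ (Fin n))‖ = 1 := by simp
  have h : form (boost x (origin n)) (spherePoint x t u) = t := by
    rw [spherePoint, form_boost]
    simp only [form, lorentzForm, origin, lift, inner_zero_left, norm_smul, hu, mul_one, one_mul,
      sub_zero, Real.norm_eq_abs, sq_abs, Real.sq_sqrt h0]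
    rw [show 1 + (t ^ 2 - 1) = t ^ 2 by ring, Real.sqrt_sq (by linarith)]
  rwa [boost_origin] at h

theorem continuous_spherePoint {n : ℕ} (x : Hyp n) (t : ℝ) : Continuous (spherePoint x t) := by
  unfold spherePoint boost lift
  apply Continuous.subtype_mk
  fun_prop

/-- The surface measure of the geodesic sphere `{y ∈ ℍⁿ : [x, y] = t}`, `t > 1`. This sphere is
the image under a hyperbolic motion of `{(u √(t² - 1), t) : u ∈ S^{n-1}}`, whose induced metric is
`t² - 1` times that of the unit sphere `S^{n-1}`; `volume.toSphere` is the usual surface measure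
of `S^{n-1}`. -/
def surface {n : ℕ} (x : Hyp n) (t : ℝ) : Measure (Hyp n) :=
  ENNReal.ofReal ((t ^ 2 - 1) ^ (((n : ℝ) - 1) / 2)) •
    ((volume : Measure (EuclideanSpace ℝ (Fin n))).toSphere).map (spherePoint x t)

/-- `σ_{n-1} = 2 π^{n/2} / Γ(n/2)`, the area of the unit sphere of `ℝⁿ`. -/
def unitSphereArea (n : ℕ) : ℝ := 2 * Real.pi ^ ((n : ℝ) / 2) / Real.Gamma ((n : ℝ) / 2)

variable {𝕜 : Type*} [RCLike 𝕜]

/-- The spherical mean `(Mf)(x, t)`, the mean value of `f` over `{y ∈ ℍⁿ : [x, y] = t}`. -/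
def sphericalMean {n : ℕ} (f : Hyp n → 𝕜) (x : Hyp n) (t : ℝ) : 𝕜 :=
  ((t ^ 2 - 1) ^ ((1 - (n : ℝ)) / 2) / unitSphereArea n) • ∫ y, f y ∂(surface x t)

/-- `F(ξ, t) (t² - 1)^{n/2 - 1}`, for data `F` such as `F = Mf`. -/
def weighted {n : ℕ} (F : Hyp n → ℝ → 𝕜) (ξ : Hyp n) (t : ℝ) : 𝕜 :=
  ((t ^ 2 - 1) ^ ((n : ℝ) / 2 - 1)) • F ξ t

/-- The value at `(ξ, x)` that is integrated over `∂B` for odd `n`: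
`(d/dt)^{n-3} [F(ξ, t) (t² - 1)^{n/2 - 1}]` at `t = [ξ, x]`. -/
def oddKernel {n : ℕ} (F : Hyp n → ℝ → 𝕜) (x ξ : Hyp n) : 𝕜 :=
  iteratedDeriv (n - 3) (weighted F ξ) (form ξ x)

/-- The integrand, as a function of `t`, of the inner integral for even `n`:
`(d/dt)^{n-2} [F(ξ, t) (t² - 1)^{n/2 - 1}] log |t - [ξ, x]|`. -/
def evenIntegrand {n : ℕ} (F : Hyp n → ℝ → 𝕜) (x ξ : Hyp n) (t : ℝ) : 𝕜 :=
  Real.log |t - form ξ x| • iteratedDeriv (n - 2) (weighted F ξ) t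

/-- The value at `(ξ, x)` that is integrated over `∂B` for even `n`. -/
def evenKernel {n : ℕ} (R : ℝ) (F : Hyp n → ℝ → 𝕜) (x ξ : Hyp n) : 𝕜 :=
  ∫ t in (1 : ℝ)..Real.cosh (2 * R), evenIntegrand F x ξ t

/-- The backprojection `f₀` of the data `F`; `surface (origin n) (cosh R)` is the surface measure
of `∂B`. -/
def backprojection {n : ℕ} (R : ℝ) (F : Hyp n → ℝ → 𝕜) (x : Hyp n) : 𝕜 :=
  if Odd n then
    -∫ ξ, oddKernel F x ξ ∂(surface (origin n) (Real.cosh R))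
  else
    (1 / Real.pi) • ∫ ξ, evenKernel R F x ξ ∂(surface (origin n) (Real.cosh R))

/-- `d_n = (-1)^{[n/2 - 1]} / (2^{n-1} π^{n/2 - 1} Γ(n/2))`. -/
def dConst (n : ℕ) : ℝ :=
  (-1) ^ ⌊(n : ℝ) / 2 - 1⌋₊ /
    (2 ^ (n - 1) * Real.pi ^ ((n : ℝ) / 2 - 1) * Real.Gamma ((n : ℝ) / 2))

end Hyp

end

/-! In the chart x ↦ x', the backprojection f₀ is a constant times the Newton potential of
f(y)/√(1+|y'|²). The Euclidean Laplacian inverts that potential, and the factor x_{n+1} removes the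
weight, which is the density of the hyperbolic measure.

Both parities are boundary values of one kernel. `logKernel n ε s` is Re(iⁿ log(s+iε)). At ε = 0 it
equals ±log|s| for even n and ∓π times the indicator of s < 0 for odd n. Integrating against the
(n-2)-nd t-derivative of the data gives the inner integral of the even formula, or the point value
of the (n-3)-rd derivative in the odd formula, with the same constant (-1)^[n/2]/π in front
(`backprojection_lift`).

For ε > 0, n-2 integrations by parts replace the logarithm by a multiple of Re(iⁿ(s+iε)^{-(n-2)}).
The weighted mean is, up to the area of the unit sphere, the density of the image of f dy under y ↦
[ξ,y] (`integral_smul_weightedMean`), so the t-integral becomes an integral over y. Fubini then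
leaves the kernel `sphereKernel R ε x y`, an integral over directions θ of the power of [ξ,y]-[ξ,x],
where ξ = (θ sinh R, cosh R). That difference is sinh R·|x-y|·(⟨θ,e⟩+β), where e is the unit vector
along x-y. The number β satisfies |β| < 1 because x and y lie strictly inside the ball.

What remains is the boundary value at z = β+i0 of Z(z) = iⁿ∫(⟨θ,e⟩+z)^{-(n-2)}dθ (`zonalPotential`).
Its derivative involves the integral of order n-1. The divergence theorem on the sphere shows that
this integral is exactly a constant times (1-z²)^{-(n-1)/2} (`zonal_eq`). The rotation iⁿ makes Z'
imaginary on (-1,1), so Re Z has the same boundary value for every β in (-1,1)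
(`tendsto_re_zonalPotential`). The direction and β drop out, and as ε → 0 the kernel tends to a
constant times |x-y|^{2-n}. Dominated convergence, `laplacian_newtonPotential` and the Gamma
identity `dConst_mul` finish the proof. -/

open Filter Topology

noncomputable section

/-! ### The Newton potential and the Poisson equation on ℝⁿ. -/

section Newton

variable {n : ℕ} {F : Type*} [NormedAddCommGroup F] [NormedSpace ℝ F]

local notation "E" => EuclideanSpace ℝ (Fin n)

/-- The directional derivative of `h` in direction `v`. -/
def dirDeriv {V : Type*} [NormedAddCommGroup V] [NormedSpace ℝ V] (v : V) (h : V → F) : V → F :=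
  fun x => fderiv ℝ h x v

theorem ContDiff.dirDeriv_smooth {V : Type*} [NormedAddCommGroup V] [NormedSpace ℝ V]
    {h : V → F} (hh : ContDiff ℝ ∞ h) (v : V) : ContDiff ℝ ∞ (dirDeriv v h) :=
  (hh.fderiv_right (m := ∞) le_rfl).clm_apply contDiff_const

theorem HasCompactSupport.dirDeriv_support {V : Type*} [NormedAddCommGroup V] [NormedSpace ℝ V]
    {h : V → F} (hh : HasCompactSupport h) (v : V) : HasCompactSupport (dirDeriv v h) :=
  hh.fderiv_apply (𝕜 := ℝ) v

theorem integral_smul_dirDeriv {k : E → ℝ} {h : E → F} (hk : ContDiff ℝ 1 k)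
    (hh : ContDiff ℝ ∞ h) (hc : HasCompactSupport h) (v : E) :
    ∫ x, k x • dirDeriv v h x = -∫ x, dirDeriv v k x • h x := by
  have hk' : Continuous (fun x => fderiv ℝ k x v) :=
    (hk.continuous_fderiv one_ne_zero).clm_apply continuous_const
  apply integral_smul_fderiv_eq_neg_fderiv_smul_of_integrable (𝕜 := ℝ)
  · exact (hk'.smul hh.continuous).integrable_of_hasCompactSupport hc.smul_left
  · exact (hk.continuous.smul (hh.dirDeriv_smooth v).continuous).integrable_of_hasCompactSupport
      (hc.dirDeriv_support v).smul_left
  · exact (hk.continuous.smul hh.continuous).integrable_of_hasCompactSupport hc.smul_left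
  · exact fun x _ => hk.differentiable one_ne_zero x
  · exact fun x _ => hh.differentiable (by simp) x

theorem laplacian_eq_sum_dirDeriv {h : E → F} (hh : ContDiff ℝ 2 h) (x : E) :
    Laplacian.laplacian h x =
      ∑ i, dirDeriv (EuclideanSpace.basisFun (Fin n) ℝ i)
        (dirDeriv (EuclideanSpace.basisFun (Fin n) ℝ i) h) x := by
  rw [InnerProductSpace.laplacian_eq_iteratedFDeriv_orthonormalBasis h
    (EuclideanSpace.basisFun (Fin n) ℝ)]
  refine Finset.sum_congr rfl fun i _ => ?_
  rw [iteratedFDeriv_two_apply]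
  have hd : DifferentiableAt ℝ (fderiv ℝ h) x :=
    (hh.fderiv_right (m := 1) (by norm_num)).differentiable one_ne_zero x
  unfold dirDeriv
  rw [fderiv_clm_apply hd (differentiableAt_const _)]
  simp

/-- Derivatives are moved onto the smooth factor `h`, because the kernel `k` is only locally
integrable. -/
theorem dirDeriv_convolution {k : E → ℝ} {h : E → F} (hk : LocallyIntegrable k)
    (hh : ContDiff ℝ ∞ h) (hc : HasCompactSupport h) (v : E) :
    dirDeriv v (convolution k h (ContinuousLinearMap.lsmul ℝ ℝ) volume) =
      convolution k (dirDeriv v h) (ContinuousLinearMap.lsmul ℝ ℝ) volume := by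
  ext x
  have h1 : ContDiff ℝ 1 h := hh.of_le (by simp)
  have := hc.hasFDerivAt_convolution_right (ContinuousLinearMap.lsmul ℝ ℝ) hk h1 x
  rw [dirDeriv, this.fderiv]
  exact convolution_precompR_apply (ContinuousLinearMap.lsmul ℝ ℝ) hk (hc.fderiv (𝕜 := ℝ))
    (h1.continuous_fderiv one_ne_zero) x v

theorem laplacian_convolution {k : E → ℝ} {h : E → F} (hk : LocallyIntegrable k)
    (hh : ContDiff ℝ ∞ h) (hc : HasCompactSupport h) (x : E) :
    Laplacian.laplacian (convolution k h (ContinuousLinearMap.lsmul ℝ ℝ) volume) x =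
      ∑ i, ∫ y, k y • dirDeriv (EuclideanSpace.basisFun (Fin n) ℝ i)
        (dirDeriv (EuclideanSpace.basisFun (Fin n) ℝ i) h) (x - y) := by
  have h2 : ContDiff ℝ 2 (convolution k h (ContinuousLinearMap.lsmul ℝ ℝ) volume) :=
    (hc.contDiff_convolution_right (n := ⊤) _ hk hh).of_le (by exact WithTop.coe_le_coe.2 le_top)
  rw [laplacian_eq_sum_dirDeriv h2]
  refine Finset.sum_congr rfl fun i _ => ?_
  rw [dirDeriv_convolution hk hh hc,
    dirDeriv_convolution hk (hh.dirDeriv_smooth _) (hc.dirDeriv_support _)]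
  rfl

/-- The regularized Newton kernel `(|x|² + a)^p`. -/
def regKernel (n : ℕ) (a p : ℝ) (x : EuclideanSpace ℝ (Fin n)) : ℝ := (‖x‖ ^ 2 + a) ^ p

theorem contDiff_regKernel {a : ℝ} (ha : 0 < a) (p : ℝ) : ContDiff ℝ ∞ (regKernel n a p) := by
  unfold regKernel
  exact ((contDiff_norm_sq ℝ).add contDiff_const).rpow_const_of_ne fun x => by positivity

theorem hasFDerivAt_regKernel {a : ℝ} (ha : 0 < a) (p : ℝ) (x : E) :
    HasFDerivAt (regKernel n a p) ((2 * p * (‖x‖ ^ 2 + a) ^ (p - 1)) • innerSL ℝ x) x := by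
  unfold regKernel
  have h := ((hasStrictFDerivAt_norm_sq x).hasFDerivAt.add_const a).rpow_const (p := p)
    (Or.inl (by positivity))
  refine h.congr_fderiv ?_
  ext y
  simp
  ring

theorem dirDeriv_regKernel {a : ℝ} (ha : 0 < a) (p : ℝ) (v : E) :
    dirDeriv v (regKernel n a p) = fun x => 2 * p * (regKernel n a (p - 1) x * inner ℝ x v) := by
  ext x
  rw [dirDeriv, (hasFDerivAt_regKernel ha p x).fderiv]
  simp [regKernel]
  ring

theorem dirDeriv_regKernel_mul {a : ℝ} (ha : 0 < a) (p : ℝ) (v x : E) :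
    dirDeriv v (fun x => regKernel n a p x * inner ℝ x v) x =
      2 * p * (regKernel n a (p - 1) x * inner ℝ x v ^ 2) + regKernel n a p x * ‖v‖ ^ 2 := by
  have h1 := hasFDerivAt_regKernel ha p x
  have h2 : HasFDerivAt (fun x : E => inner ℝ x v) (innerSL ℝ v) x := by
    have := (innerSL ℝ v).hasFDerivAt (x := x)
    refine this.congr_of_eventuallyEq (.of_forall fun y => ?_)
    simp [real_inner_comm]
  rw [dirDeriv, (h1.fun_mul h2).fderiv]
  simp [regKernel]
  rw [real_inner_comm]
  ring

/-- Two integrations by parts. The gradient of (|x|²+a)^{1-n/2} is -(n-2)(|x|²+a)^{-n/2}x. The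
divergence of (|x|²+a)^{-n/2}x is (|x|²+a)^{-n/2-1}(n(|x|²+a) - n|x|²), in which only na survives in
the bracket. -/
theorem integral_regKernel_sum_dirDeriv {a : ℝ} (ha : 0 < a) {h : E → F} (hh : ContDiff ℝ ∞ h)
    (hc : HasCompactSupport h) :
    ∑ i, ∫ y, regKernel n a (1 - n / 2) y • dirDeriv (EuclideanSpace.basisFun (Fin n) ℝ i)
        (dirDeriv (EuclideanSpace.basisFun (Fin n) ℝ i) h) y =
      -((n - 2) * n : ℝ) • ∫ y, (a * regKernel n a (-(n / 2) - 1) y) • h y := by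
  set e := fun i => EuclideanSpace.basisFun (Fin n) ℝ i
  have step (i : Fin n) : ∫ y, regKernel n a (1 - n / 2) y • dirDeriv (e i) (dirDeriv (e i) h) y =
      -((n - 2) : ℝ) • ∫ y, dirDeriv (e i)
        (fun x => regKernel n a (-(n / 2)) x * inner ℝ x (e i)) y • h y := by
    rw [integral_smul_dirDeriv ((contDiff_regKernel ha _).of_le (by simp))
      (hh.dirDeriv_smooth _) (hc.dirDeriv_support _), dirDeriv_regKernel ha]
    have hq : ContDiff ℝ 1 (fun x : E => regKernel n a (-(n / 2)) x * inner ℝ x (e i)) :=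
      ((contDiff_regKernel ha _).mul (contDiff_id.inner ℝ contDiff_const)).of_le (by simp)
    rw [← neg_neg (∫ y, _ • h y), ← integral_smul_dirDeriv hq hh hc, ← integral_neg,
      ← integral_neg, ← integral_smul]
    refine integral_congr_ae (.of_forall fun x => ?_)
    simp only [smul_neg, smul_smul, neg_inj]
    rw [show (1 : ℝ) - n / 2 - 1 = -(n / 2) by ring]
    congr 1
    ring
  rw [Finset.sum_congr rfl fun i _ => step i, ← Finset.smul_sum, ← integral_finsetSum]
  · rw [neg_smul, neg_smul, mul_smul, ← integral_smul (n : ℝ)]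
    congr 2
    refine integral_congr_ae (.of_forall fun x => ?_)
    simp only [smul_smul]
    rw [← Finset.sum_smul]
    congr 1
    simp_rw [dirDeriv_regKernel_mul ha]
    have hs : ∑ i, inner ℝ x (e i) ^ 2 = ‖x‖ ^ 2 := by
      exact (EuclideanSpace.basisFun (Fin n) ℝ).sum_sq_inner_left x
    have hp : regKernel n a (-(n / 2)) x = regKernel n a (-(n / 2) - 1) x * (‖x‖ ^ 2 + a) := by
      have h0 : (0 : ℝ) < ‖x‖ ^ 2 + a := by positivity
      rw [regKernel, regKernel, Real.rpow_sub_one h0.ne']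
      field_simp
    simp only [Finset.sum_add_distrib, ← Finset.mul_sum, hs, hp]
    simp [e]
    ring
  · intro i _
    have hq : ContDiff ℝ ∞ (fun x : E => regKernel n a (-(n / 2)) x * inner ℝ x (e i)) :=
      (contDiff_regKernel ha _).mul (contDiff_id.inner ℝ contDiff_const)
    exact ((hq.dirDeriv_smooth _).continuous.smul
      hh.continuous).integrable_of_hasCompactSupport hc.smul_left

/-- In polar coordinates the weight r^{n-1} cancels the singularity r^{2-n} and leaves r. -/
theorem locallyIntegrable_newtonKernel (hn : 2 < n) :
    LocallyIntegrable (fun x : E => (‖x‖ ^ (n - 2))⁻¹) := by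
  have : Nontrivial E := by
    have : Nonempty (Fin n) := ⟨⟨0, by omega⟩⟩
    infer_instance
  intro x
  refine ⟨Metric.ball 0 (‖x‖ + 1), Metric.isOpen_ball.mem_nhds (by simp), ?_⟩
  rw [integrableOn_fun_norm_addHaar volume (f := fun r => (r ^ (n - 2))⁻¹)]
  have hc : IntegrableOn (fun y : ℝ => y) (Ioo 0 (‖x‖ + 1)) :=
    (continuous_id.integrableOn_Icc (a := 0) (b := ‖x‖ + 1)).mono_set Ioo_subset_Icc_self
  refine hc.congr_fun (fun y hy => ?_) measurableSet_Ioo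
  have hy0 : y ≠ 0 := hy.1.ne'
  simp only [finrank_euclideanSpace, Fintype.card_fin, smul_eq_mul]
  rw [show n - 1 = n - 2 + 1 by omega, pow_succ]
  field_simp

theorem tendsto_div_sqrt_one_add_sq :
    Tendsto (fun r : ℝ => r / √(1 + r ^ 2)) atTop (𝓝 1) := by
  have h1 : Tendsto (fun r : ℝ => (√((r⁻¹) ^ 2 + 1))⁻¹) atTop (𝓝 1) := by
    have : Tendsto (fun r : ℝ => (r⁻¹) ^ 2 + 1) atTop (𝓝 1) := by
      simpa using (tendsto_inv_atTop_zero (𝕜 := ℝ)).pow 2 |>.add_const 1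
    simpa using this.sqrt.inv₀ (by simp)
  refine h1.congr' ?_
  filter_upwards [eventually_gt_atTop 0] with r hr
  have : (r⁻¹) ^ 2 + 1 = (1 + r ^ 2) / r ^ 2 := by field_simp
  rw [this, Real.sqrt_div (by positivity), Real.sqrt_sq hr.le, inv_div]

/-- The radial integrand r^{n-1}(1+r²)^{-(n+2)/2} has the antiderivative (r/√(1+r²))ⁿ/n, which
increases from 0 to 1/n. -/
theorem integral_approxIdentity (hn : 2 < n) :
    ∫ x : E, (1 + ‖x‖ ^ 2) ^ (-((n : ℝ) + 2) / 2) =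
      volume.real (Metric.ball (0 : E) 1) := by
  have : Nontrivial E := by
    have : Nonempty (Fin n) := ⟨⟨0, by omega⟩⟩
    infer_instance
  have hn0 : (n : ℝ) ≠ 0 := by positivity
  rw [integral_fun_norm_addHaar volume (fun r => (1 + r ^ 2) ^ (-((n : ℝ) + 2) / 2))]
  have key : ∫ y in Ioi (0 : ℝ), y ^ (n - 1) • (1 + y ^ 2) ^ (-((n : ℝ) + 2) / 2) =
      1 / (n : ℝ) := by
    have hsq (x : ℝ) : 0 < 1 + x ^ 2 := by positivity
    rw [integral_Ioi_of_hasDerivAt_of_nonneg' (g := fun r => (r / √(1 + r ^ 2)) ^ n / n)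
      (l := 1 / n) (a := 0)]
    · simp [show n ≠ 0 by omega]
    · intro x _
      have h1 : HasDerivAt (fun r : ℝ => √(1 + r ^ 2)) (2 * x / (2 * √(1 + x ^ 2))) x := by
        have := ((hasDerivAt_pow 2 x).const_add 1).sqrt (hsq x).ne'
        simpa using this
      have h2 := (((hasDerivAt_id x).div h1 (Real.sqrt_pos.2 (hsq x)).ne').pow n).div_const (n : ℝ)
      refine h2.congr_deriv ?_
      have hs := Real.sqrt_pos.2 (hsq x)
      have hs2 := Real.sq_sqrt (hsq x).le
      have e1 : (1 + x ^ 2) ^ (-((n : ℝ) + 2) / 2) = (√(1 + x ^ 2) ^ (n + 2))⁻¹ := by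
        rw [Real.sqrt_eq_rpow, ← Real.rpow_natCast _ (n + 2), ← Real.rpow_mul (hsq x).le,
          ← Real.rpow_neg (hsq x).le]
        congr 1
        push_cast
        ring
      rw [e1]
      obtain ⟨k, rfl⟩ : ∃ k, n = k + 1 := ⟨n - 1, by omega⟩
      simp only [id, smul_eq_mul, Nat.add_sub_cancel, Pi.div_apply, div_pow]
      field_simp
      rw [hs2]
      field_simp
      ring
    · intro x hx
      have : (0 : ℝ) < x := hx
      positivity
    · simpa using (tendsto_div_sqrt_one_add_sq.pow n).div_const (n : ℝ)
  rw [finrank_euclideanSpace, Fintype.card_fin, key]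
  simp
  field_simp

/-- Dominated convergence: the exponent 1-n/2 is negative, so the singular kernel itself majorizes
every regularized one. -/
theorem tendsto_integral_regKernel (hn : 2 < n) {h : E → F} (hh : Continuous h)
    (hc : HasCompactSupport h) :
    Tendsto (fun ε : ℝ => ∫ y, regKernel n (ε ^ 2) (1 - n / 2) y • h y) (𝓝[>] 0)
      (𝓝 (∫ y, (‖y‖ ^ (n - 2))⁻¹ • h y)) := by
  have hkey (y : E) (hy : y ≠ 0) : (‖y‖ ^ (n - 2))⁻¹ = regKernel n (0 ^ 2) (1 - n / 2) y := by
    have : 0 < ‖y‖ := norm_pos_iff.2 hy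
    rw [regKernel, zero_pow two_ne_zero, add_zero, ← Real.rpow_natCast _ (n - 2),
      ← Real.rpow_natCast _ 2, ← Real.rpow_mul this.le, ← Real.rpow_neg this.le,
      Nat.cast_sub (by omega)]
    congr 1
    push_cast
    ring
  have hne : ∀ᵐ y : E, y ≠ 0 := by
    have : Nontrivial E := by
      have : Nonempty (Fin n) := ⟨⟨0, by omega⟩⟩
      infer_instance
    simp [ae_iff]
  have hn2 : (2 : ℝ) < n := by exact_mod_cast hn
  apply tendsto_integral_filter_of_dominated_convergence
    (bound := fun y => ‖(‖y‖ ^ (n - 2))⁻¹ • h y‖)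
  · filter_upwards [self_mem_nhdsWithin] with ε hε
    have hε : (0 : ℝ) < ε := hε
    exact ((contDiff_regKernel (by positivity) _).continuous.smul hh).aestronglyMeasurable
  · filter_upwards [self_mem_nhdsWithin] with ε hε
    filter_upwards [hne] with y hy
    have : 0 < ‖y‖ := norm_pos_iff.2 hy
    rw [hkey y hy, norm_smul, norm_smul]
    gcongr
    rw [regKernel, regKernel, Real.norm_of_nonneg (by positivity),
      Real.norm_of_nonneg (by positivity)]
    apply Real.rpow_le_rpow_of_nonpos (by positivity) _ (by linarith)
    gcongr
    exact (hε : (0 : ℝ) < ε).le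
  · exact ((locallyIntegrable_newtonKernel hn).integrable_smul_right_of_hasCompactSupport hh
      hc).norm
  · filter_upwards [hne] with y hy
    rw [hkey y hy]
    refine Tendsto.smul_const (Tendsto.mono_left ?_ nhdsWithin_le_nhds) _
    have : ContinuousAt (fun ε : ℝ => regKernel n (ε ^ 2) (1 - n / 2) y) 0 := by
      unfold regKernel
      refine ContinuousAt.rpow_const (by fun_prop) (Or.inl ?_)
      have : 0 < ‖y‖ := norm_pos_iff.2 hy
      positivity
    exact this.tendsto

theorem tendsto_integral_approxIdentity (hn : 2 < n) [CompleteSpace F] {h : E → F}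
    (hh : Continuous h) (hc : HasCompactSupport h) :
    Tendsto (fun ε : ℝ => ∫ y, (ε ^ 2 * regKernel n (ε ^ 2) (-(n / 2) - 1) y) • h y) (𝓝[>] 0)
      (𝓝 (volume.real (Metric.ball (0 : E) 1) • h 0)) := by
  obtain ⟨C, hC⟩ := hc.exists_bound_of_continuous hh
  have hlim : Tendsto (fun ε : ℝ => ∫ y : E, (1 + ‖y‖ ^ 2) ^ (-((n : ℝ) + 2) / 2) • h (ε • y))
      (𝓝[>] 0) (𝓝 (∫ y : E, (1 + ‖y‖ ^ 2) ^ (-((n : ℝ) + 2) / 2) • h 0)) := by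
    have hint : Integrable (fun y : E => (1 + ‖y‖ ^ 2) ^ (-((n : ℝ) + 2) / 2)) :=
      integrable_rpow_neg_one_add_norm_sq (by simp)
    apply tendsto_integral_filter_of_dominated_convergence
      (bound := fun y : E => (1 + ‖y‖ ^ 2) ^ (-((n : ℝ) + 2) / 2) * C)
    · refine .of_forall fun ε => ?_
      exact hint.aestronglyMeasurable.smul
        (hh.comp (continuous_const_smul ε)).aestronglyMeasurable
    · refine .of_forall fun ε => .of_forall fun y => ?_
      rw [norm_smul, Real.norm_of_nonneg (by positivity)]
      gcongr
      exact hC _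
    · exact hint.mul_const C
    · refine .of_forall fun y => Tendsto.const_smul (Tendsto.mono_left ?_ nhdsWithin_le_nhds) _
      have : ContinuousAt (fun ε : ℝ => h (ε • y)) 0 := by fun_prop
      simpa [ContinuousAt] using this
  rw [integral_smul_const, integral_approxIdentity hn] at hlim
  refine hlim.congr' ?_
  filter_upwards [self_mem_nhdsWithin] with ε hε
  have hε : (0 : ℝ) < ε := hε
  -- Substituting εy for y, the Jacobian εⁿ and the prefactor ε² cancel the factor ε^{-(n+2)} coming
  -- out of the kernel.
  have := Measure.integral_comp_smul (volume : Measure E)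
    (fun y => (ε ^ 2 * regKernel n (ε ^ 2) (-(n / 2) - 1) y) • h y) ε
  rw [← inv_smul_eq_iff₀ (by positivity)] at this
  rw [← this, ← integral_smul]
  refine integral_congr_ae (.of_forall fun y => ?_)
  simp only [smul_smul]
  congr 1
  rw [finrank_euclideanSpace, Fintype.card_fin, abs_of_pos (by positivity), inv_inv, regKernel,
    norm_smul, Real.norm_of_nonneg hε.le, mul_pow, ← mul_add_one,
    Real.mul_rpow (by positivity) (by positivity), add_comm 1,
    show -((n : ℝ) + 2) / 2 = -(n / 2) - 1 by ring, ← mul_assoc, ← mul_assoc]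
  have e : (ε ^ 2) ^ (-((n : ℝ) / 2) - 1) = (ε ^ (n + 2))⁻¹ := by
    rw [← Real.rpow_natCast _ (n + 2), ← Real.rpow_natCast _ 2, ← Real.rpow_mul hε.le,
      ← Real.rpow_neg hε.le]
    congr 1
    push_cast
    ring
  rw [e, pow_add]
  field_simp

/-- Both sides of the regularized identity are passed to the limit a = ε² → 0; the right-hand side
is an approximate identity. -/
theorem sum_integral_newtonKernel (hn : 2 < n) [CompleteSpace F] {h : E → F}
    (hh : ContDiff ℝ ∞ h) (hc : HasCompactSupport h) :
    ∑ i, ∫ y, (‖y‖ ^ (n - 2))⁻¹ • dirDeriv (EuclideanSpace.basisFun (Fin n) ℝ i)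
        (dirDeriv (EuclideanSpace.basisFun (Fin n) ℝ i) h) y =
      -((n - 2) * n * volume.real (Metric.ball (0 : E) 1)) • h 0 := by
  have h1 := tendsto_finsetSum Finset.univ fun i (_ : i ∈ Finset.univ) =>
    tendsto_integral_regKernel hn
      ((hh.dirDeriv_smooth (EuclideanSpace.basisFun (Fin n) ℝ i)).dirDeriv_smooth
        (EuclideanSpace.basisFun (Fin n) ℝ i)).continuous
      ((hc.dirDeriv_support (EuclideanSpace.basisFun (Fin n) ℝ i)).dirDeriv_support
        (EuclideanSpace.basisFun (Fin n) ℝ i))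
  have h2 := (tendsto_integral_approxIdentity hn hh.continuous hc).const_smul
    (-((n - 2) * n : ℝ))
  rw [smul_smul, ← neg_mul_eq_neg_mul] at h2
  refine tendsto_nhds_unique h1 (h2.congr' ?_)
  filter_upwards [self_mem_nhdsWithin] with ε hε
  have hε : (0 : ℝ) < ε := hε
  exact (integral_regKernel_sum_dirDeriv (by positivity) hh hc).symm

theorem newtonPotential_eq_convolution (h : E → F) :
    (fun x : E => ∫ y, (‖x - y‖ ^ (n - 2))⁻¹ • h y) =
      convolution (fun x : E => (‖x‖ ^ (n - 2))⁻¹) h (ContinuousLinearMap.lsmul ℝ ℝ) volume := by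
  ext x
  rw [convolution_lsmul_swap]

theorem contDiff_newtonPotential (hn : 2 < n) {h : E → F} (hh : ContDiff ℝ ∞ h)
    (hc : HasCompactSupport h) :
    ContDiff ℝ ∞ (fun x : E => ∫ y, (‖x - y‖ ^ (n - 2))⁻¹ • h y) := by
  rw [newtonPotential_eq_convolution]
  exact hc.contDiff_convolution_right (n := ⊤) _ (locallyIntegrable_newtonKernel hn) hh

theorem dirDeriv_comp_const_sub {h : E → F} (v x y : E) :
    dirDeriv v (fun t => h (x - t)) y = -dirDeriv v h (x - y) := by
  unfold dirDeriv
  have h1 : (fun t => h (x - t)) =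
      (fun u => h (x + u)) ∘ ContinuousLinearEquiv.neg ℝ (M := E) := by
    ext t
    simp [sub_eq_add_neg]
  rw [h1, ContinuousLinearEquiv.comp_right_fderiv, fderiv_comp_add_left, sub_eq_add_neg]
  simp

/-- The Newton potential of `h` solves the Poisson equation. -/
theorem laplacian_newtonPotential (hn : 2 < n) [CompleteSpace F] {h : E → F}
    (hh : ContDiff ℝ ∞ h) (hc : HasCompactSupport h) (x : E) :
    Laplacian.laplacian (fun x : E => ∫ y, (‖x - y‖ ^ (n - 2))⁻¹ • h y) x =
      -((n - 2) * n * volume.real (Metric.ball (0 : E) 1)) • h x := by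
  rw [newtonPotential_eq_convolution,
    laplacian_convolution (locallyIntegrable_newtonKernel hn) hh hc]
  -- The identity at 0 is applied to the reflected translate of `h`; two derivatives produce two
  -- signs, which cancel.
  have hH : ContDiff ℝ ∞ fun t => h (x - t) := hh.comp (contDiff_const.sub contDiff_id)
  have hHc : HasCompactSupport fun t => h (x - t) :=
    hc.comp_homeomorph (Homeomorph.subLeft x)
  have := sum_integral_newtonKernel hn hH hHc
  rw [sub_zero] at this
  rw [← this]
  refine Finset.sum_congr rfl fun i _ => integral_congr_ae (.of_forall fun y => ?_)
  dsimp only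
  congr 1
  set e := EuclideanSpace.basisFun (Fin n) ℝ i
  have h1 : dirDeriv e (fun t => h (x - t)) = fun y => (fun t => -dirDeriv e h t) (x - y) := by
    ext y
    exact dirDeriv_comp_const_sub e x y
  rw [h1, dirDeriv_comp_const_sub (h := fun t => -dirDeriv e h t)]
  unfold dirDeriv
  rw [fderiv_fun_neg]
  simp

end Newton

/-! ### Polar coordinates in a finite-dimensional space. -/

section Polar

variable {V : Type*} [NormedAddCommGroup V] [NormedSpace ℝ V] [FiniteDimensional ℝ V]
  [MeasurableSpace V] [BorelSpace V] (μ : Measure V) [μ.IsAddHaarMeasure]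
  {F : Type*} [NormedAddCommGroup F]

theorem integrable_polar {f : V → F} (hf : Integrable f μ) :
    Integrable (fun p : Metric.sphere (0 : V) 1 × Ioi (0 : ℝ) => f (p.2.1 • p.1.1))
      (μ.toSphere.prod (Measure.volumeIoiPow (Module.finrank ℝ V - 1))) := by
  have h := μ.measurePreserving_homeomorphUnitSphereProd.symm
    (homeomorphUnitSphereProd V).toMeasurableEquiv
  have h1 : Integrable (fun x : ({0}ᶜ : Set V) => f x) (μ.comap (↑)) := by
    have := hf.integrableOn (s := {0}ᶜ)
    rwa [integrableOn_iff_comap_subtypeVal (by measurability)] at this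
  have := (h.integrable_comp_emb (homeomorphUnitSphereProd V).symm.measurableEmbedding).2 h1
  exact this

variable [NormedSpace ℝ F]

theorem integral_volumeIoiPow (k : ℕ) (f : ℝ → F) :
    ∫ r : Ioi (0 : ℝ), f r ∂Measure.volumeIoiPow k = ∫ r in Ioi (0 : ℝ), r ^ k • f r := by
  simp only [Measure.volumeIoiPow, ENNReal.ofReal]
  rw [integral_withDensity_eq_integral_smul,
    integral_subtype_comap measurableSet_Ioi fun a => Real.toNNReal (a ^ k) • f a,
    setIntegral_congr_fun measurableSet_Ioi fun x hx => ?_]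
  · rw [NNReal.smul_def, Real.coe_toNNReal _ (pow_nonneg hx.out.le _)]
  · exact (measurable_subtype_coe.pow_const _).real_toNNReal

variable [Nontrivial V]

theorem integral_polar (f : V → F) :
    ∫ x, f x ∂μ = ∫ p : Metric.sphere (0 : V) 1 × Ioi (0 : ℝ), f (p.2.1 • p.1.1)
      ∂(μ.toSphere.prod (Measure.volumeIoiPow (Module.finrank ℝ V - 1))) := by
  have h := μ.measurePreserving_homeomorphUnitSphereProd.symm
    (homeomorphUnitSphereProd V).toMeasurableEquiv
  have := h.integral_comp (homeomorphUnitSphereProd V).symm.measurableEmbedding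
    (fun x : ({0}ᶜ : Set V) => f x)
  rw [integral_subtype_comap (measurableSet_singleton _).compl fun x => f x,
        restrict_compl_singleton] at this
  exact this.symm

theorem integral_eq_integral_radial_sphere {f : V → F} (hf : Integrable f μ) :
    ∫ x, f x ∂μ = ∫ r in Ioi (0 : ℝ), r ^ (Module.finrank ℝ V - 1) •
      ∫ u, f (r • (u : V)) ∂μ.toSphere := by
  rw [integral_polar μ f, integral_prod_symm _ (integrable_polar μ hf)]
  exact integral_volumeIoiPow _ fun r => ∫ u, f (r • (u : V)) ∂μ.toSphere

end Polar

/-! ### The divergence theorem on the sphere for zonal fields. -/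

section Pearson

variable {n : ℕ}

local notation "E" => EuclideanSpace ℝ (Fin n)

/-- The cutoff is evaluated at |x|². Its support keeps away from the origin, where x/|x| is
singular, and `χ 2 = 1` makes its radial integral nonzero. -/
theorem exists_radial_cutoff : ∃ χ : ℝ → ℝ, ContDiff ℝ ∞ χ ∧ (∀ r, 0 ≤ χ r) ∧ χ 2 = 1 ∧
    (∀ r, χ r ≠ 0 → 1 < r ∧ r < 3) := by
  let b : ContDiffBump (2 : ℝ) := ⟨1 / 2, 1, by norm_num, by norm_num⟩
  refine ⟨b, b.contDiff, fun r => b.nonneg, b.one_of_mem_closedBall (by simp [b]), fun r hr => ?_⟩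
  have : r ∈ Function.support b := hr
  rw [b.support_eq, Metric.mem_ball, Real.dist_eq, abs_lt] at this
  simp only [b] at this
  constructor <;> linarith [this.1, this.2]

theorem hasLineDerivAt_inner_div_norm {x : E} (hx : x ≠ 0) (e : E) (he : ‖e‖ = 1) :
    HasLineDerivAt ℝ (fun y : E => inner ℝ y e / ‖y‖)
      (‖x‖⁻¹ * (1 - (inner ℝ x e / ‖x‖) ^ 2)) x e := by
  have hx0 : 0 < ‖x‖ := norm_pos_iff.2 hx
  have h1 : HasFDerivAt (fun y : E => inner ℝ y e) (innerSL ℝ e) x := by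
    have := (innerSL ℝ e).hasFDerivAt (x := x)
    refine this.congr_of_eventuallyEq (.of_forall fun y => ?_)
    simp [real_inner_comm]
  have h2 : HasFDerivAt (fun y : E => ‖y‖) ((1 / (2 * √(‖x‖ ^ 2))) • (2 • innerSL ℝ x)) x := by
    have := (hasStrictFDerivAt_norm_sq x).hasFDerivAt.sqrt (by positivity)
    refine this.congr_of_eventuallyEq (.of_forall fun y => ?_)
    simp [Real.sqrt_sq (norm_nonneg y)]
  have h3 := (h1.mul ((hasDerivAt_inv hx0.ne').comp_hasFDerivAt x h2)).hasLineDerivAt e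
  have e1 : (fun y : E => inner ℝ y e / ‖y‖) = (fun y : E => inner ℝ y e) * fun y => ‖y‖⁻¹ := by
    ext y
    simp [div_eq_mul_inv]
  rw [e1]
  refine HasDerivAt.congr_deriv h3 ?_
  simp [he, Real.sqrt_sq hx0.le]
  field_simp
  ring

/-- Integrating the derivative of r^{n-1}χ(r²), whose boundary values vanish, produces the factor
n-1 of the spherical divergence formula. -/
theorem integral_radial_cutoff_deriv {χ : ℝ → ℝ} (hχ : ContDiff ℝ ∞ χ)
    (hs : ∀ r, χ r ≠ 0 → 1 < r ∧ r < 3) (hn : 2 ≤ n) :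
    ∫ r in Ioi (0 : ℝ), r ^ (n - 1) * (deriv χ (r ^ 2) * (2 * r)) =
      -((n - 1) * ∫ r in Ioi (0 : ℝ), r ^ (n - 2) * χ (r ^ 2)) := by
  have hd (r : ℝ) : HasDerivAt (fun r => r ^ (n - 1) * χ (r ^ 2))
      ((n - 1) * (r ^ (n - 2) * χ (r ^ 2)) + r ^ (n - 1) * (deriv χ (r ^ 2) * (2 * r))) r := by
    have h1 := (hχ.differentiable (by simp) (r ^ 2)).hasDerivAt.comp r (hasDerivAt_pow 2 r)
    refine ((hasDerivAt_pow (n - 1) r).mul h1).congr_deriv ?_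
    rw [Nat.cast_sub (by omega), show n - 1 - 1 = n - 2 by omega]
    simp
    ring
  have hz (r : ℝ) (hr : 2 ≤ |r|) : χ (r ^ 2) = 0 := by
    by_contra h
    have := (hs _ h).2
    rw [← sq_abs] at this
    nlinarith
  have hc1 : HasCompactSupport fun r => χ (r ^ 2) := by
    refine HasCompactSupport.of_support_subset_isCompact (isCompact_Icc (a := -2) (b := 2)) ?_
    intro r hr
    by_contra hr'
    apply hr
    apply hz
    by_contra h
    exact hr' (abs_le.1 (not_le.1 h).le)
  have hc2 : HasCompactSupport fun r => deriv χ (r ^ 2) * (2 * r) := by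
    have : (fun r => deriv χ (r ^ 2) * (2 * r)) = deriv fun r => χ (r ^ 2) := by
      ext r
      have h1 := (hχ.differentiable (by simp) (r ^ 2)).hasDerivAt.comp r (hasDerivAt_pow 2 r)
      rw [show (fun r => χ (r ^ 2)) = χ ∘ fun r => r ^ 2 from rfl, h1.deriv]
      simp
    rw [this]
    exact hc1.deriv
  have hcχ := hχ.continuous
  have hcχ' : Continuous (deriv χ) := hχ.continuous_deriv (by simp)
  have i1 : Integrable fun r => r ^ (n - 2) * χ (r ^ 2) :=
    (by fun_prop : Continuous fun r => r ^ (n - 2) * χ (r ^ 2)).integrable_of_hasCompactSupport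
      hc1.mul_left
  have i2 : Integrable fun r => r ^ (n - 1) * (deriv χ (r ^ 2) * (2 * r)) :=
    (by fun_prop : Continuous fun r => r ^ (n - 1) *
      (deriv χ (r ^ 2) * (2 * r))).integrable_of_hasCompactSupport hc2.mul_left
  have := integral_Ioi_of_hasDerivAt_of_tendsto' (a := 0) (m := 0) (fun r _ => hd r)
    ((i1.const_mul _).add i2).integrableOn
    (hc1.mul_left.is_zero_at_infty.mono_left
      (by rw [← cocompact_eq_atBot_atTop.symm]; exact le_sup_right))
  rw [integral_add (i1.const_mul _).integrableOn i2.integrableOn, integral_const_mul] at this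
  have h0 : χ (0 ^ 2) = 0 := by
    by_contra h
    have := (hs _ h).1
    norm_num at this
  rw [h0] at this
  linarith

/-- The divergence theorem on the sphere for the zonal vector field `ψ(s) ∇ s`, `s = ⟨u, e⟩`. -/
theorem integral_sphere_zonal (hn : 2 ≤ n) (e : E) (he : ‖e‖ = 1) {ψ ψ' : ℝ → ℂ}
    (hψ : ∀ s, HasDerivAt ψ (ψ' s) s) (hψ' : Continuous ψ') :
    ∫ u : Metric.sphere (0 : E) 1, ((1 - inner ℝ (u : E) e ^ 2 : ℝ) • ψ' (inner ℝ (u : E) e))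
      ∂(volume : Measure E).toSphere =
    ∫ u : Metric.sphere (0 : E) 1, (((n - 1) * inner ℝ (u : E) e : ℝ) • ψ (inner ℝ (u : E) e))
      ∂(volume : Measure E).toSphere := by
  obtain ⟨χ, hχ, hχ0, hχ2, hχs⟩ := exists_radial_cutoff
  have hψc : Continuous ψ := continuous_iff_continuousAt.2 fun s => (hψ s).continuousAt
  have hcχ := hχ.continuous
  have hcχ' : Continuous (deriv χ) := hχ.continuous_deriv (by simp)
  set f : E → ℝ := fun x => χ (‖x‖ ^ 2)
  set f' : E → ℝ := fun x => deriv χ (‖x‖ ^ 2) * (2 * inner ℝ x e)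
  set g : E → ℂ := fun x => ψ (inner ℝ x e / ‖x‖)
  set g' : E → ℂ := fun x => (‖x‖⁻¹ * (1 - (inner ℝ x e / ‖x‖) ^ 2)) • ψ' (inner ℝ x e / ‖x‖)
  have hf (x : E) : HasLineDerivAt ℝ f (f' x) x e := by
    have h1 := ((hχ.differentiable (by simp) (‖x‖ ^ 2)).hasDerivAt.comp_hasFDerivAt x
      (hasStrictFDerivAt_norm_sq x).hasFDerivAt).hasLineDerivAt e
    refine HasDerivAt.congr_deriv h1 ?_
    simp [f']
  have hg (x : E) (hx : x ≠ 0) : HasLineDerivAt ℝ g (g' x) x e := by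
    have h1 := hasLineDerivAt_inner_div_norm hx e he
    have h2 : HasDerivAt ψ (ψ' (inner ℝ x e / ‖x‖))
      ((fun t : ℝ => inner ℝ (x + t • e) e / ‖x + t • e‖) 0) := by simpa using hψ _
    exact h2.scomp 0 h1
  have hft : tsupport f ⊆ {x | 1 ≤ ‖x‖ ∧ ‖x‖ ≤ 2} := by
    refine closure_minimal (fun x hx => ?_) ?_
    · have := hχs _ hx
      constructor <;> nlinarith [norm_nonneg x]
    · exact (isClosed_le continuous_const continuous_norm).inter
        (isClosed_le continuous_norm continuous_const)
  have hft0 : ∀ x ∈ tsupport f, x ≠ 0 := by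
    rintro x hx rfl
    have := (hft hx).1
    simp at this
    linarith
  have hf't : tsupport f' ⊆ tsupport f := by
    have : f' = fun x => fderiv ℝ f x e := by
      ext x
      have hd : DifferentiableAt ℝ f x :=
        (hχ.differentiable (by simp) (‖x‖ ^ 2)).comp x
          (hasStrictFDerivAt_norm_sq x).hasFDerivAt.differentiableAt
      rw [← hd.lineDeriv_eq_fderiv, (hf x).lineDeriv]
    rw [this]
    exact tsupport_fderiv_apply_subset ℝ e
  have hfc : HasCompactSupport f := by
    refine HasCompactSupport.of_support_subset_isCompact (isCompact_closedBall (0 : E) 2) ?_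
    intro x hx
    simpa using (hft (subset_tsupport f hx)).2
  have hf'c : HasCompactSupport f' := hfc.mono' ((subset_tsupport _).trans hf't)
  have hg0 (x : E) (hx : x ≠ 0) : ContinuousAt g x := by
    have : ContinuousAt (fun x : E => inner ℝ x e / ‖x‖) x := by
      apply ContinuousAt.div <;> first | fun_prop | simpa using hx
    exact hψc.continuousAt.comp this
  have hg'0 (x : E) (hx : x ≠ 0) : ContinuousAt g' x := by
    have h1 : ContinuousAt (fun x : E => inner ℝ x e / ‖x‖) x := by
      apply ContinuousAt.div <;> first | fun_prop | simpa using hx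
    have h2 : ContinuousAt (fun x : E => ‖x‖⁻¹) x := by
      apply ContinuousAt.inv₀ <;> first | fun_prop | simpa using hx
    exact (h2.mul (continuousAt_const.sub (h1.pow 2))).smul (hψ'.continuousAt.comp h1)
  have hfcont : Continuous f := by fun_prop
  have hf'cont : Continuous f' := by fun_prop
  have hsub {a : E → ℝ} (ha : tsupport a ⊆ tsupport f) (b : E → ℂ) :
      ∀ x ∈ tsupport (fun x => a x • b x), x ≠ 0 := fun x hx =>
    hft0 x (ha (tsupport_smul_subset_left a b hx))
  have i1 : Integrable fun x => f' x • g x :=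
    (continuous_of_tsupport fun x hx => hf'cont.continuousAt.smul
      (hg0 x (hsub hf't g x hx))).integrable_of_hasCompactSupport hf'c.smul_right
  have i2 : Integrable fun x => f x • g' x :=
    (continuous_of_tsupport fun x hx => hfcont.continuousAt.smul
      (hg'0 x (hsub subset_rfl g' x hx))).integrable_of_hasCompactSupport hfc.smul_right
  have i3 : Integrable fun x => f x • g x :=
    (continuous_of_tsupport fun x hx => hfcont.continuousAt.smul
      (hg0 x (hsub subset_rfl g x hx))).integrable_of_hasCompactSupport hfc.smul_right
  -- The spherical identity is extracted from one Euclidean integration by parts in direction `e`,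
  -- for the product of the cutoff with ψ(⟨x,e⟩/|x|), homogeneous of degree 0.
  have key : ∫ x, f x • g' x = -∫ x, f' x • g x :=
    integral_bilinear_hasLineDerivAt_right_eq_neg_left_of_integrable
      (B := ContinuousLinearMap.lsmul ℝ ℝ) i1 i2 i3 (fun x _ => hf x) fun x hx => hg x (hft0 x hx)
  have : Nontrivial E := by
    have : Nonempty (Fin n) := ⟨⟨0, by omega⟩⟩
    infer_instance
  rw [integral_eq_integral_radial_sphere volume i1, integral_eq_integral_radial_sphere volume i2,
    finrank_euclideanSpace, Fintype.card_fin] at key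
  set A := ∫ u : Metric.sphere (0 : E) 1, ((1 - inner ℝ (u : E) e ^ 2 : ℝ) •
    ψ' (inner ℝ (u : E) e)) ∂(volume : Measure E).toSphere
  set B := ∫ u : Metric.sphere (0 : E) 1, (inner ℝ (u : E) e : ℝ) • ψ (inner ℝ (u : E) e)
      ∂(volume : Measure E).toSphere with hB
  have hnorm (u : Metric.sphere (0 : E) 1) {r : ℝ} (hr : 0 < r) : ‖r • (u : E)‖ = r := by
    simp [norm_smul, abs_of_pos hr]
  have hin (u : Metric.sphere (0 : E) 1) {r : ℝ} (hr : 0 < r) :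
      inner ℝ (r • (u : E)) e / r = inner ℝ (u : E) e := by
    rw [real_inner_smul_left]
    field_simp
  have eA : ∫ r in Ioi (0 : ℝ), r ^ (n - 1) • ∫ u : Metric.sphere (0 : E) 1,
      f (r • (u : E)) • g' (r • (u : E)) ∂(volume : Measure E).toSphere =
      (∫ r in Ioi (0 : ℝ), r ^ (n - 2) * χ (r ^ 2)) • A := by
    rw [← integral_smul_const]
    refine setIntegral_congr_fun measurableSet_Ioi fun r hr => ?_
    have hr : 0 < r := hr
    simp only [f, g', hnorm _ hr, hin _ hr, mul_smul]
    rw [integral_smul, integral_smul, smul_smul, smul_smul, smul_smul]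
    congr 1
    rw [show n - 1 = n - 2 + 1 by omega, pow_succ]
    field_simp
  have eB : ∫ r in Ioi (0 : ℝ), r ^ (n - 1) • ∫ u : Metric.sphere (0 : E) 1,
      f' (r • (u : E)) • g (r • (u : E)) ∂(volume : Measure E).toSphere =
      (∫ r in Ioi (0 : ℝ), r ^ (n - 1) * (deriv χ (r ^ 2) * (2 * r))) • B := by
    rw [← integral_smul_const]
    refine setIntegral_congr_fun measurableSet_Ioi fun r hr => ?_
    have hr : 0 < r := hr
    simp only [f', g, hnorm _ hr, hin _ hr]
    rw [mul_smul, hB, ← integral_smul (deriv χ (r ^ 2) * (2 * r))]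
    congr 1
    refine integral_congr_ae (.of_forall fun u => ?_)
    simp only [smul_smul, real_inner_smul_left]
    congr 1
    ring
  rw [eA, eB, integral_radial_cutoff_deriv hχ hχs hn, neg_smul, neg_neg, mul_comm, mul_smul] at key
  -- Both sides carry this radial integral as a common factor; it is positive and is cancelled.
  have hpos : (∫ r in Ioi (0 : ℝ), r ^ (n - 2) * χ (r ^ 2)) ≠ 0 := by
    have hzero (r : ℝ) (hr : r ∉ Icc (-2 : ℝ) 2) : χ (r ^ 2) = 0 := by
      by_contra h
      have := (hχs _ h).2
      exact hr (abs_le.1 (abs_le_of_sq_le_sq (by linarith) (by norm_num)))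
    have hint : Integrable fun r : ℝ => r ^ (n - 2) * χ (r ^ 2) :=
      (by fun_prop : Continuous fun r : ℝ => r ^ (n - 2) *
        χ (r ^ 2)).integrable_of_hasCompactSupport (.intro isCompact_Icc fun r hr => by
          rw [hzero r hr, mul_zero])
    refine ((setIntegral_pos_iff_support_of_nonneg_ae ?_ hint.integrableOn).2 ?_).ne'
    · filter_upwards [ae_restrict_mem measurableSet_Ioi] with r (hr : 0 < r)
      exact mul_nonneg (by positivity) (hχ0 _)
    · refine IsOpen.measure_pos _ (IsOpen.inter ?_ isOpen_Ioi) ⟨√2, ?_, ?_⟩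
      · exact (by fun_prop : Continuous fun r : ℝ => r ^ (n - 2) * χ (r ^ 2)).isOpen_support
      · simp [hχ2]
      · simp
  rw [smul_right_injective ℂ hpos key, hB, ← integral_smul]
  simp only [smul_smul]

end Pearson

/-! ### Zonal integrals on the upper half-plane and their boundary values. -/

section Zonal

variable {n : ℕ}

local notation "E" => EuclideanSpace ℝ (Fin n)

/-- The zonal integral `∫ (⟨u, e⟩ + z)^{-m} du` over the unit sphere. -/
def zonal (e : EuclideanSpace ℝ (Fin n)) (m : ℕ) (z : ℂ) : ℂ :=
  ∫ u : Metric.sphere (0 : E) 1, (((inner ℝ (u : E) e : ℝ) + z : ℂ) ^ m)⁻¹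
    ∂(volume : Measure E).toSphere

theorem im_le_norm_ofReal_add (s : ℝ) (z : ℂ) : z.im ≤ ‖(s : ℂ) + z‖ := by
  have := Complex.abs_im_le_norm ((s : ℂ) + z)
  simp only [Complex.add_im, Complex.ofReal_im, zero_add] at this
  exact (le_abs_self _).trans this

theorem ofReal_add_ne_zero (s : ℝ) {z : ℂ} (hz : 0 < z.im) : (s : ℂ) + z ≠ 0 :=
  norm_pos_iff.1 (hz.trans_le (im_le_norm_ofReal_add s z))

theorem norm_inv_pow_le (s : ℝ) (m : ℕ) {z : ℂ} (hz : 0 < z.im) :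
    ‖(((s : ℂ) + z) ^ m)⁻¹‖ ≤ (z.im ^ m)⁻¹ := by
  rw [norm_inv, norm_pow]
  gcongr
  exact im_le_norm_ofReal_add s z

theorem continuous_inv_pow (e : E) (m : ℕ) {z : ℂ} (hz : 0 < z.im) :
    Continuous fun u : Metric.sphere (0 : E) 1 => (((inner ℝ (u : E) e : ℝ) + z : ℂ) ^ m)⁻¹ := by
  refine Continuous.inv₀ (by fun_prop) fun u => pow_ne_zero _ (ofReal_add_ne_zero _ hz)

theorem integrable_of_continuous_sphere {F : Type*} [NormedAddCommGroup F]
    {f : Metric.sphere (0 : E) 1 → F} (hf : Continuous f) :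
    Integrable f (volume : Measure E).toSphere :=
  hf.integrable_of_hasCompactSupport (HasCompactSupport.of_compactSpace f)

theorem norm_zonal_le (e : E) (m : ℕ) {z : ℂ} (hz : 0 < z.im) :
    ‖zonal e m z‖ ≤ (z.im ^ m)⁻¹ * (volume : Measure E).toSphere.real univ :=
  norm_integral_le_of_norm_le_const (.of_forall fun _ => norm_inv_pow_le _ m hz)

theorem hasDerivAt_inv_pow (s : ℝ) (m : ℕ) {z : ℂ} (hz : 0 < z.im) :
    HasDerivAt (fun z : ℂ => (((s : ℂ) + z) ^ m)⁻¹) (-m * (((s : ℂ) + z) ^ (m + 1))⁻¹) z := by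
  have h0 := ofReal_add_ne_zero s hz
  have := (((hasDerivAt_id z).const_add (s : ℂ)).pow m).inv (pow_ne_zero _ h0)
  refine this.congr_deriv ?_
  rcases m with _ | m
  · simp
  · simp only [id, Nat.add_sub_cancel, Pi.pow_apply]
    field_simp
    ring

theorem hasDerivAt_zonal (e : E) (m : ℕ) {z : ℂ} (hz : 0 < z.im) :
    HasDerivAt (zonal e m) (-m * zonal e (m + 1) z) z := by
  -- On this neighbourhood the denominators stay above a fixed positive bound, which gives a
  -- majorant uniform in w.
  have hs : {w : ℂ | z.im / 2 < w.im} ∈ 𝓝 z :=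
    (isOpen_lt continuous_const Complex.continuous_im).mem_nhds (by simpa using hz)
  have him {w : ℂ} (hw : w ∈ {w : ℂ | z.im / 2 < w.im}) : 0 < w.im := by
    have : z.im / 2 < w.im := hw
    linarith
  have h := (hasDerivAt_integral_of_dominated_loc_of_deriv_le
    (μ := (volume : Measure E).toSphere)
    (F := fun z u => (((inner ℝ (u : E) e : ℝ) + z : ℂ) ^ m)⁻¹)
    (F' := fun z u => -m * (((inner ℝ (u : E) e : ℝ) + z : ℂ) ^ (m + 1))⁻¹)
    (bound := fun _ => m * ((z.im / 2) ^ (m + 1))⁻¹) hs ?_ ?_ ?_ ?_ ?_ ?_).2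
  · rwa [integral_const_mul] at h
  · filter_upwards [hs] with w hw
    exact (continuous_inv_pow e m (him hw)).aestronglyMeasurable
  · exact integrable_of_continuous_sphere (continuous_inv_pow e m hz)
  · exact (continuous_const.mul (continuous_inv_pow e (m + 1) hz)).aestronglyMeasurable
  · refine .of_forall fun u w hw => ?_
    rw [norm_mul, norm_neg, Complex.norm_natCast]
    gcongr
    refine (norm_inv_pow_le _ _ (him hw)).trans ?_
    have hw : z.im / 2 < w.im := hw
    gcongr
  · exact integrable_const _
  · exact .of_forall fun u w hw => hasDerivAt_inv_pow _ m (him hw)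

/-- The divergence identity for ψ(s) = (s+z)^{-(n-1)} says that (1+sz)(s+z)^{-n} integrates to zero,
and 1+sz = (1-z²)+z(s+z). -/
theorem zonal_recurrence (hn : 2 ≤ n) (e : E) (he : ‖e‖ = 1) {z : ℂ} (hz : 0 < z.im) :
    (1 - z ^ 2) * zonal e n z + z * zonal e (n - 1) z = 0 := by
  have hd (s : ℝ) : HasDerivAt (fun s : ℝ => (((s : ℂ) + z) ^ (n - 1))⁻¹)
      (-(n - 1) * (((s : ℂ) + z) ^ n)⁻¹) s := by
    have h1 := (hasDerivAt_inv_pow 0 (n - 1) (z := (s : ℂ) + z) (by simpa using hz)).comp s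
      ((hasDerivAt_id s).ofReal_comp.add_const z)
    simp only [Complex.ofReal_zero, zero_add, Function.comp_def] at h1
    refine h1.congr_deriv ?_
    rw [show n - 1 + 1 = n by omega, Nat.cast_sub (by omega)]
    simp
  have hc : Continuous fun s : ℝ => -((n : ℂ) - 1) * (((s : ℂ) + z) ^ n)⁻¹ :=
    continuous_const.mul (Continuous.inv₀ (by fun_prop)
      fun u => pow_ne_zero _ (ofReal_add_ne_zero _ hz))
  have key := integral_sphere_zonal hn e he hd hc
  have i1 := integrable_of_continuous_sphere (continuous_inv_pow e n hz)
  have i2 := integrable_of_continuous_sphere (continuous_inv_pow e (n - 1) hz)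
  have hn1 : (n : ℂ) - 1 ≠ 0 := by
    rw [sub_ne_zero]
    exact_mod_cast (by omega : n ≠ 1)
  unfold zonal
  rw [← integral_const_mul, ← integral_const_mul, ← integral_add (i1.const_mul _) (i2.const_mul _)]
  rw [← sub_eq_zero, ← integral_sub] at key
  · rw [← mul_right_inj' (neg_ne_zero.2 hn1), mul_zero, ← integral_const_mul, ← key]
    refine integral_congr_ae (.of_forall fun u => ?_)
    have h0 := ofReal_add_ne_zero (inner ℝ (u : E) e) hz
    simp only [Complex.real_smul]
    obtain ⟨k, rfl⟩ : ∃ k, n = k + 1 := ⟨n - 1, by omega⟩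
    simp only [Nat.add_sub_cancel]
    push_cast
    field_simp
    ring
  · exact integrable_of_continuous_sphere
      ((by fun_prop : Continuous fun u : Metric.sphere (0 : E) 1 =>
        (1 - inner ℝ (u : E) e ^ 2 : ℝ)).smul (continuous_const.mul (continuous_inv_pow e n hz)))
  · exact integrable_of_continuous_sphere
      ((by fun_prop : Continuous fun u : Metric.sphere (0 : E) 1 =>
        ((n - 1) * inner ℝ (u : E) e : ℝ)).smul (continuous_inv_pow e (n - 1) hz))

/-- For Im z > 0, 1-z² is real only if z is purely imaginary, and then it exceeds 1. Hence the
principal powers of 1-z² are holomorphic on the whole half-plane. -/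
theorem one_sub_sq_mem_slitPlane {z : ℂ} (hz : 0 < z.im) : 1 - z ^ 2 ∈ Complex.slitPlane := by
  rw [Complex.mem_slitPlane_iff]
  by_cases h : z.re = 0
  · left
    simp [pow_two, h]
    positivity
  · right
    simp only [pow_two, Complex.sub_im, Complex.one_im, Complex.mul_im, zero_sub]
    intro h'
    have : z.re * z.im = 0 := by linarith
    rcases mul_eq_zero.1 this with h1 | h1
    · exact h h1
    · exact hz.ne' h1

/-- The derivative is -(n-1)(1-z²)^{(n-3)/2} times the left-hand side of `zonal_recurrence`. -/
theorem hasDerivAt_zonal_mul_cpow (hn : 2 ≤ n) (e : E) (he : ‖e‖ = 1) {z : ℂ} (hz : 0 < z.im) :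
    HasDerivAt (fun z => zonal e (n - 1) z * (1 - z ^ 2) ^ (((n : ℝ) - 1) / 2 : ℂ)) 0 z := by
  have h1 := hasDerivAt_zonal e (n - 1) hz
  have hs := one_sub_sq_mem_slitPlane hz
  have h2 := ((hasDerivAt_pow 2 z).const_sub 1).cpow_const (c := (((n : ℝ) - 1) / 2 : ℂ)) hs
  refine (h1.mul h2).congr_deriv ?_
  have hr := zonal_recurrence hn e he hz
  have h0 : 1 - z ^ 2 ≠ 0 := Complex.slitPlane_ne_zero hs
  rw [show n - 1 + 1 = n by omega, Nat.cast_sub (by omega),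
    Complex.cpow_sub _ _ h0, Complex.cpow_one]
  field_simp
  push_cast
  linear_combination (-((n : ℂ) - 1) * 2 * (1 - z ^ 2) ^ (((n : ℂ) - 1) / 2)) * hr

theorem one_sub_mul_I_sq_cpow (k : ℕ) (δ : ℝ) :
    (1 - (δ * Complex.I) ^ 2) ^ ((k : ℝ) / 2 : ℂ) = ((√(1 + δ ^ 2) ^ k : ℝ) : ℂ) := by
  have h0 : (0 : ℝ) ≤ 1 + δ ^ 2 := by positivity
  have e1 : 1 - (δ * Complex.I) ^ 2 = ((1 + δ ^ 2 : ℝ) : ℂ) := by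
    rw [mul_pow, Complex.I_sq]
    push_cast
    ring
  rw [e1, show ((k : ℝ) / 2 : ℂ) = (((k : ℝ) / 2 : ℝ) : ℂ) by push_cast; rfl,
    ← Complex.ofReal_cpow h0]
  congr 1
  rw [Real.sqrt_eq_rpow, ← Real.rpow_natCast _ k, ← Real.rpow_mul h0]
  congr 1
  ring

theorem tendsto_sqrt_div (s : ℝ) :
    Tendsto (fun δ : ℝ => (√(1 + δ ^ 2) : ℂ) / (s + δ * Complex.I)) atTop (𝓝 (-Complex.I)) := by
  have h1 : Tendsto (fun δ : ℝ => ((√(δ⁻¹ ^ 2 + 1) : ℝ) : ℂ) / (s * (δ⁻¹ : ℝ) + Complex.I)) atTop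
      (𝓝 ((√(0 ^ 2 + 1) : ℝ) / (s * (0 : ℝ) + Complex.I))) := by
    have h0 := tendsto_inv_atTop_zero (𝕜 := ℝ)
    refine Tendsto.div ?_ ?_ (by simp)
    · exact (Complex.continuous_ofReal.tendsto _).comp ((h0.pow 2).add_const 1).sqrt
    · exact (((Complex.continuous_ofReal.tendsto _).comp h0).const_mul _).add_const _
  have h2 : (((√(0 ^ 2 + 1) : ℝ) : ℂ) / (s * (0 : ℝ) + Complex.I)) = -Complex.I := by simp
  rw [h2] at h1
  refine h1.congr' ?_
  filter_upwards [eventually_gt_atTop 0] with δ hδ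
  have : δ⁻¹ ^ 2 + 1 = (1 + δ ^ 2) / δ ^ 2 := by field_simp
  have hδ' : (δ : ℂ) ≠ 0 := by exact_mod_cast hδ.ne'
  have hne : (s : ℂ) + δ * Complex.I ≠ 0 := ofReal_add_ne_zero s (by simpa using hδ)
  rw [this, Real.sqrt_div (by positivity), Real.sqrt_sq hδ.le]
  have hne2 : (s : ℂ) * (δ⁻¹ : ℝ) + Complex.I ≠ 0 := by
    intro h
    apply hne
    have := congrArg (fun w => w * (δ : ℂ)) h
    simp only [zero_mul, Complex.ofReal_inv] at this
    rw [← this]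
    field_simp
  rw [div_eq_div_iff hne2 hne]
  push_cast
  field_simp

theorem tendsto_zonal_mul_cpow (e : E) (k : ℕ) :
    Tendsto (fun δ : ℝ => zonal e k (δ * Complex.I) *
      (1 - (δ * Complex.I) ^ 2) ^ ((k : ℝ) / 2 : ℂ)) atTop
      (𝓝 ((-Complex.I) ^ k * (volume : Measure E).toSphere.real univ)) := by
  have h : Tendsto (fun δ : ℝ => ∫ u : Metric.sphere (0 : E) 1,
      ((√(1 + δ ^ 2) : ℂ) / ((inner ℝ (u : E) e : ℝ) + δ * Complex.I)) ^ k
      ∂(volume : Measure E).toSphere) atTop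
      (𝓝 (∫ u : Metric.sphere (0 : E) 1, (-Complex.I) ^ k ∂(volume : Measure E).toSphere)) := by
    apply tendsto_integral_filter_of_dominated_convergence (bound := fun _ => 2 ^ k)
    · filter_upwards [eventually_gt_atTop 0] with δ hδ
      refine Continuous.aestronglyMeasurable ?_
      refine (Continuous.div continuous_const (by fun_prop) fun u => ?_).pow k
      exact ofReal_add_ne_zero _ (by simpa using hδ)
    -- For δ ≥ 1 one has √(1+δ²) ≤ 2δ, so each of the k factors has modulus at most 2.
    · filter_upwards [eventually_ge_atTop 1] with δ hδ
      refine .of_forall fun u => ?_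
      rw [norm_pow, norm_div]
      have h1 := im_le_norm_ofReal_add (inner ℝ (u : E) e) (δ * Complex.I)
      simp only [Complex.mul_im, Complex.ofReal_re, Complex.I_im, mul_one, Complex.ofReal_im,
        Complex.I_re, mul_zero, add_zero] at h1
      gcongr
      rw [div_le_iff₀ (by linarith), Complex.norm_real, Real.norm_of_nonneg (by positivity)]
      refine le_trans ?_ (mul_le_mul_of_nonneg_left h1 zero_le_two)
      rw [Real.sqrt_le_left (by linarith)]
      nlinarith
    · exact integrable_const _
    · exact .of_forall fun u => (tendsto_sqrt_div _).pow k
  rw [integral_const] at h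
  convert h using 2 with δ
  · rw [one_sub_mul_I_sq_cpow, zonal, ← integral_mul_const]
    refine integral_congr_ae (.of_forall fun u => ?_)
    simp only [div_pow]
    push_cast
    rw [div_eq_mul_inv, mul_comm]
  · rw [Complex.real_smul, mul_comm]

/-- The product is constant on the connected half-plane, and its value is read off as z = iδ goes to
infinity, where √(1+δ²)/(s+iδ) tends to -i. -/
theorem zonal_mul_cpow (hn : 2 ≤ n) (e : E) (he : ‖e‖ = 1) {z : ℂ} (hz : 0 < z.im) :
    zonal e (n - 1) z * (1 - z ^ 2) ^ (((n : ℝ) - 1) / 2 : ℂ) =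
      (-Complex.I) ^ (n - 1) * (volume : Measure E).toSphere.real univ := by
  have hconv : Convex ℝ {z : ℂ | 0 < z.im} := convex_halfSpace_im_gt 0
  obtain ⟨a, ha⟩ := (isOpen_lt continuous_const
    Complex.continuous_im).exists_is_const_of_deriv_eq_zero hconv.isPreconnected
    (f := fun z => zonal e (n - 1) z * (1 - z ^ 2) ^ (((n : ℝ) - 1) / 2 : ℂ))
    (fun z hz => (hasDerivAt_zonal_mul_cpow hn e he hz).differentiableAt.differentiableWithinAt)
    (fun z hz => (hasDerivAt_zonal_mul_cpow hn e he hz).deriv)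
  rw [ha z hz]
  refine tendsto_nhds_unique ?_ (tendsto_zonal_mul_cpow e (n - 1))
  refine tendsto_const_nhds.congr' ?_
  filter_upwards [eventually_gt_atTop 0] with δ hδ
  rw [Nat.cast_sub (by omega), ← ha (δ * Complex.I) (by simpa using hδ)]
  simp

theorem zonal_eq (hn : 2 ≤ n) (e : E) (he : ‖e‖ = 1) {z : ℂ} (hz : 0 < z.im) :
    zonal e (n - 1) z = (-Complex.I) ^ (n - 1) * (volume : Measure E).toSphere.real univ *
      (1 - z ^ 2) ^ ((-((n : ℝ) - 1) / 2 : ℝ) : ℂ) := by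
  rw [← zonal_mul_cpow hn e he hz, mul_assoc,
    ← Complex.cpow_add _ _ (Complex.slitPlane_ne_zero (one_sub_sq_mem_slitPlane hz))]
  push_cast
  rw [show ((n : ℂ) - 1) / 2 + -((n : ℂ) - 1) / 2 = 0 by ring]
  simp

/-- The rotated zonal integral of order `n - 2`. -/
def zonalPotential (e : EuclideanSpace ℝ (Fin n)) (z : ℂ) : ℂ := Complex.I ^ n * zonal e (n - 2) z

/-- Since iⁿ(-i)^{n-1} = i in every dimension, the derivative is i times a real multiple of
(1-z²)^{-(n-1)/2}. It is therefore imaginary where 1-z² is positive, which is the purpose of the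
rotation by iⁿ. -/
theorem hasDerivAt_zonalPotential (hn : 2 < n) (e : E) (he : ‖e‖ = 1) {z : ℂ} (hz : 0 < z.im) :
    HasDerivAt (zonalPotential e) (-((n - 2) * (volume : Measure E).toSphere.real univ : ℝ) *
      Complex.I * (1 - z ^ 2) ^ ((-((n : ℝ) - 1) / 2 : ℝ) : ℂ)) z := by
  refine ((hasDerivAt_zonal e (n - 2) hz).const_mul (Complex.I ^ n)).congr_deriv ?_
  rw [show n - 2 + 1 = n - 1 by omega, zonal_eq hn.le e he hz]
  have hI : Complex.I ^ n * (-Complex.I) ^ (n - 1) = Complex.I := by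
    conv_lhs => rw [show n = n - 1 + 1 by omega, pow_succ]
    rw [Nat.add_sub_cancel, mul_right_comm, ← mul_pow]
    simp
  rw [Nat.cast_sub hn.le]
  generalize (1 - z ^ 2) ^ ((-((n : ℝ) - 1) / 2 : ℝ) : ℂ) = w
  push_cast
  linear_combination (-((n : ℂ) - 2) * (volume : Measure E).toSphere.real univ * w) * hI

/-- The integral `∫_0^∞ (1 + τ²)^{-k/2} dτ`. -/
def betaIntegral (k : ℕ) : ℝ := ∫ τ in Ioi (0 : ℝ), (1 + τ ^ 2) ^ (-(k : ℝ) / 2)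

theorem integrable_betaIntegrand {k : ℕ} (hk : 2 ≤ k) :
    Integrable fun τ : ℝ => (1 + τ ^ 2) ^ (-(k : ℝ) / 2) := by
  have : Integrable fun τ : ℝ => (1 + ‖τ‖ ^ 2) ^ (-(k : ℝ) / 2) :=
    integrable_rpow_neg_one_add_norm_sq (by
      rw [Module.finrank_self]
      exact_mod_cast (by omega : 1 < k))
  simpa using this

theorem one_sub_mul_I_sq_cpow_real (δ p : ℝ) :
    (1 - (δ * Complex.I) ^ 2) ^ (p : ℂ) = (((1 + δ ^ 2) ^ p : ℝ) : ℂ) := by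
  have e1 : 1 - (δ * Complex.I) ^ 2 = ((1 + δ ^ 2 : ℝ) : ℂ) := by
    rw [mul_pow, Complex.I_sq]
    push_cast
    ring
  rw [e1, Complex.ofReal_cpow (by positivity)]

/-- Along the imaginary axis dz contributes a second factor i, so the derivative is real; the
potential itself vanishes at i∞. -/
theorem re_zonalPotential_vertical (hn : 2 < n) (e : E) (he : ‖e‖ = 1) {δ : ℝ} (hδ : 0 < δ) :
    (zonalPotential e (δ * Complex.I)).re = -((n - 2) * (volume : Measure E).toSphere.real univ *
      ∫ τ in Ioi δ, (1 + τ ^ 2) ^ (-((n : ℝ) - 1) / 2)) := by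
  have hint : Integrable fun τ : ℝ => (1 + τ ^ 2) ^ (-((n : ℝ) - 1) / 2) := by
    have := integrable_betaIntegrand (k := n - 1) (by omega)
    simpa [Nat.cast_sub (by omega : 1 ≤ n)] using this
  have hd (τ : ℝ) (hτ : τ ∈ Ici δ) : HasDerivAt (fun τ : ℝ => (zonalPotential e (τ * Complex.I)).re)
      ((n - 2) * (volume : Measure E).toSphere.real univ *
        (1 + τ ^ 2) ^ (-((n : ℝ) - 1) / 2)) τ := by
    have hτ : 0 < τ := hδ.trans_le hτ
    have h1 := hasDerivAt_zonalPotential hn e he (z := τ * Complex.I) (by simpa using hτ)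
    have h2 : HasDerivAt (fun τ : ℝ => (τ : ℂ) * Complex.I) Complex.I τ := by
      simpa using ((hasDerivAt_id τ).ofReal_comp).mul_const Complex.I
    have h3 := Complex.reCLM.hasFDerivAt.comp_hasDerivAt τ (h1.comp τ h2)
    refine h3.congr_deriv ?_
    rw [one_sub_mul_I_sq_cpow_real, mul_right_comm, mul_assoc _ Complex.I Complex.I,
      Complex.I_mul_I,
      Complex.reCLM_apply, mul_neg_one, neg_mul, neg_mul, neg_neg, ← Complex.ofReal_mul,
      Complex.ofReal_re]
  have hlim : Tendsto (fun τ : ℝ => (zonalPotential e (τ * Complex.I)).re) atTop (𝓝 0) := by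
    have h0 : Tendsto (fun τ : ℝ => (τ ^ (n - 2))⁻¹ * (volume : Measure E).toSphere.real univ)
        atTop (𝓝 0) := by
      simpa using ((tendsto_pow_atTop (by omega : n - 2 ≠ 0)).inv_tendsto_atTop).mul_const
        ((volume : Measure E).toSphere.real univ)
    refine squeeze_zero_norm' ?_ h0
    filter_upwards [eventually_gt_atTop 0] with τ hτ
    refine (Complex.abs_re_le_norm _).trans ?_
    have := norm_zonal_le e (n - 2) (z := τ * Complex.I) (by simpa using hτ)
    rw [zonalPotential, norm_mul, norm_pow, Complex.norm_I, one_pow, one_mul]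
    simpa using this
  have := integral_Ioi_of_hasDerivAt_of_tendsto' hd (hint.const_mul _).integrableOn hlim
  rw [integral_const_mul] at this
  linarith

theorem integral_Ioi_le_betaIntegral (hn : 2 < n) {δ : ℝ} (hδ : 0 < δ) :
    ∫ τ in Ioi δ, (1 + τ ^ 2) ^ (-((n : ℝ) - 1) / 2) ≤ betaIntegral (n - 1) := by
  have hint := integrable_betaIntegrand (k := n - 1) (by omega)
  rw [betaIntegral]
  rw [Nat.cast_sub (by omega : 1 ≤ n), Nat.cast_one] at *
  exact setIntegral_mono_set hint.integrableOn (.of_forall fun τ => by positivity)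
    (Ioi_subset_Ioi hδ.le).eventuallyLE

theorem tendsto_re_zonalPotential_vertical (hn : 2 < n) (e : E) (he : ‖e‖ = 1) :
    Tendsto (fun δ : ℝ => (zonalPotential e (δ * Complex.I)).re) (𝓝[>] 0)
      (𝓝 (-((n - 2) * (volume : Measure E).toSphere.real univ * betaIntegral (n - 1)))) := by
  have hint := integrable_betaIntegrand (k := n - 1) (by omega)
  have h1 : Tendsto (fun δ : ℝ => betaIntegral (n - 1) -
      ∫ τ in (0 : ℝ)..δ, (1 + τ ^ 2) ^ (-((n - 1 : ℕ) : ℝ) / 2)) (𝓝[>] 0)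
      (𝓝 (betaIntegral (n - 1) - 0)) := by
    refine tendsto_const_nhds.sub (Tendsto.mono_left ?_ nhdsWithin_le_nhds)
    have := (intervalIntegral.continuous_primitive (fun a b => hint.intervalIntegrable) 0).tendsto 0
    simpa using this
  rw [sub_zero] at h1
  refine ((h1.const_mul ((n - 2) * (volume : Measure E).toSphere.real univ)).neg).congr' ?_
  filter_upwards [self_mem_nhdsWithin] with δ hδ
  have hδ : 0 < δ := hδ
  rw [re_zonalPotential_vertical hn e he hδ, betaIntegral,
    ← intervalIntegral.integral_Ioi_sub_Ioi hint.integrableOn hδ.le, sub_sub_cancel,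
    Nat.cast_sub (by omega : 1 ≤ n)]
  simp

theorem im_add_mul_I {x δ : ℝ} : ((x : ℂ) + δ * Complex.I).im = δ := by simp

/-- Both |1-z| and |1+z| are at least 1-q, and the exponent is negative. -/
theorem norm_one_sub_sq_cpow_le (hn : 2 < n) {q : ℝ} (hq : q < 1) {z : ℂ} (hz : |z.re| ≤ q) :
    ‖(1 - z ^ 2) ^ ((-((n : ℝ) - 1) / 2 : ℝ) : ℂ)‖ ≤ ((1 - q) ^ 2) ^ (-((n : ℝ) - 1) / 2) := by
  rw [Complex.norm_cpow_real]
  have hn2 : (2 : ℝ) < n := by exact_mod_cast hn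
  have h0 : 0 < 1 - q := by linarith
  apply Real.rpow_le_rpow_of_nonpos (by positivity) _ (by linarith)
  rw [show 1 - z ^ 2 = (1 - z) * (1 + z) by ring, norm_mul, pow_two]
  obtain ⟨h1, h2⟩ := abs_le.1 hz
  have e1 := (le_abs_self _).trans (Complex.abs_re_le_norm (1 - z))
  have e2 := (le_abs_self _).trans (Complex.abs_re_le_norm (1 + z))
  simp only [Complex.sub_re, Complex.add_re, Complex.one_re] at e1 e2
  gcongr <;> linarith

theorem continuousAt_one_sub_sq_cpow (p : ℝ) {z : ℂ} (hz : 1 - z ^ 2 ∈ Complex.slitPlane) :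
    ContinuousAt (fun z : ℂ => (1 - z ^ 2) ^ (p : ℂ)) z :=
  ContinuousAt.cpow (by fun_prop) continuousAt_const hz

theorem re_zonalPotential_horizontal (hn : 2 < n) (e : E) (he : ‖e‖ = 1) (β : ℝ) {δ : ℝ}
    (hδ : 0 < δ) :
    (zonalPotential e (β + δ * Complex.I)).re = (zonalPotential e (δ * Complex.I)).re +
      ∫ x in (0 : ℝ)..β, (n - 2) * (volume : Measure E).toSphere.real univ *
        ((1 - (x + δ * Complex.I) ^ 2) ^ ((-((n : ℝ) - 1) / 2 : ℝ) : ℂ)).im := by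
  have hpos (x : ℝ) : 0 < ((x : ℂ) + δ * Complex.I).im := by rwa [im_add_mul_I]
  have hd (x : ℝ) : HasDerivAt (fun x : ℝ => (zonalPotential e (x + δ * Complex.I)).re)
      ((n - 2) * (volume : Measure E).toSphere.real univ *
        ((1 - (x + δ * Complex.I) ^ 2) ^ ((-((n : ℝ) - 1) / 2 : ℝ) : ℂ)).im) x := by
    have h1 := hasDerivAt_zonalPotential hn e he (hpos x)
    have h2 : HasDerivAt (fun x : ℝ => (x : ℂ) + δ * Complex.I) 1 x :=
      ((hasDerivAt_id x).ofReal_comp).add_const _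
    have h3 := Complex.reCLM.hasFDerivAt.comp_hasDerivAt x (h1.comp x h2)
    refine h3.congr_deriv ?_
    generalize (1 - ((x : ℂ) + δ * Complex.I) ^ 2) ^ ((-((n : ℝ) - 1) / 2 : ℝ) : ℂ) = w
    rw [Complex.reCLM_apply, mul_one, mul_assoc, ← Complex.ofReal_neg, Complex.re_ofReal_mul]
    simp
  have hc : Continuous fun x : ℝ => (n - 2) * (volume : Measure E).toSphere.real univ *
        ((1 - (x + δ * Complex.I) ^ 2) ^ ((-((n : ℝ) - 1) / 2 : ℝ) : ℂ)).im := by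
    refine continuous_const.mul (Complex.continuous_im.comp ?_)
    refine continuous_iff_continuousAt.2 fun x => ?_
    exact (continuousAt_one_sub_sq_cpow _ (one_sub_sq_mem_slitPlane (hpos x))).comp
      (f := fun x : ℝ => (x : ℂ) + δ * Complex.I) (by fun_prop)
  have := intervalIntegral.integral_eq_sub_of_hasDerivAt (fun x _ => hd x)
    (hc.intervalIntegrable 0 β)
  rw [this]
  simp

/-- The bound for `re_zonalPotential` near the cut. -/
theorem abs_re_zonalPotential_le (hn : 2 < n) {q : ℝ} (hq : q < 1) (e : E) (he : ‖e‖ = 1) {β δ : ℝ}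
    (hβ : |β| ≤ q) (hδ : 0 < δ) :
    |(zonalPotential e (β + δ * Complex.I)).re| ≤
      (n - 2) * (volume : Measure E).toSphere.real univ *
        (betaIntegral (n - 1) + ((1 - q) ^ 2) ^ (-((n : ℝ) - 1) / 2)) := by
  have hn2 : (2 : ℝ) < n := by exact_mod_cast hn
  have hc : 0 ≤ (n - 2) * (volume : Measure E).toSphere.real univ :=
    mul_nonneg (by linarith) measureReal_nonneg
  rw [re_zonalPotential_horizontal hn e he β hδ, mul_add]
  refine (abs_add_le _ _).trans (add_le_add ?_ ?_)
  · rw [re_zonalPotential_vertical hn e he hδ, abs_neg, abs_of_nonneg]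
    · gcongr
      exact integral_Ioi_le_betaIntegral hn hδ
    · exact mul_nonneg hc (integral_nonneg fun τ => by positivity)
  · have := intervalIntegral.norm_integral_le_of_norm_le_const (a := 0) (b := β)
      (f := fun x : ℝ => (n - 2) * (volume : Measure E).toSphere.real univ *
        ((1 - (x + δ * Complex.I) ^ 2) ^ ((-((n : ℝ) - 1) / 2 : ℝ) : ℂ)).im)
      (C := (n - 2) * (volume : Measure E).toSphere.real univ *
        ((1 - q) ^ 2) ^ (-((n : ℝ) - 1) / 2)) fun x hx => ?_
    · refine this.trans ?_
      rw [sub_zero]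
      refine mul_le_of_le_one_right ?_ (hβ.trans hq.le)
      exact mul_nonneg hc (by positivity)
    · rw [norm_mul, Real.norm_of_nonneg hc]
      gcongr
      refine (Complex.abs_im_le_norm _).trans (norm_one_sub_sq_cpow_le hn hq ?_)
      have hx1 : |x| ≤ |β| := by
        have := abs_sub_left_of_mem_uIcc (uIoc_subset_uIcc hx)
        simpa using this
      simpa using hx1.trans hβ

/-- The limit is independent of `β`: the path from iδ to β+iδ contributes the imaginary part of
(1-z²)^{-(n-1)/2}, which tends to zero as the path descends to the real segment. This is why the
backprojection kernel ends up depending on |x-y| alone. -/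
theorem tendsto_re_zonalPotential (hn : 2 < n) (e : E) (he : ‖e‖ = 1) {β : ℝ} (hβ : |β| < 1) :
    Tendsto (fun δ : ℝ => (zonalPotential e (β + δ * Complex.I)).re) (𝓝[>] 0)
      (𝓝 (-((n - 2) * (volume : Measure E).toSphere.real univ * betaIntegral (n - 1)))) := by
  have hx1 {x : ℝ} (hx : x ∈ uIoc 0 β) : |x| ≤ |β| := by
    have := abs_sub_left_of_mem_uIcc (uIoc_subset_uIcc hx)
    simpa using this
  have h : Tendsto (fun δ : ℝ => ∫ x in (0 : ℝ)..β,
      (n - 2) * (volume : Measure E).toSphere.real univ *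
        ((1 - (x + δ * Complex.I) ^ 2) ^ ((-((n : ℝ) - 1) / 2 : ℝ) : ℂ)).im) (𝓝[>] 0)
      (𝓝 (∫ x in (0 : ℝ)..β, 0)) := by
    apply intervalIntegral.tendsto_integral_filter_of_dominated_convergence
      (bound := fun _ => ‖(n - 2) * (volume : Measure E).toSphere.real univ‖ *
        ((1 - |β|) ^ 2) ^ (-((n : ℝ) - 1) / 2))
    · filter_upwards [self_mem_nhdsWithin] with δ hδ
      have hpos (x : ℝ) : 0 < ((x : ℂ) + δ * Complex.I).im := by
        rw [im_add_mul_I]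
        exact hδ
      refine Continuous.aestronglyMeasurable ?_
      refine continuous_const.mul (Complex.continuous_im.comp ?_)
      refine continuous_iff_continuousAt.2 fun x => ?_
      exact (continuousAt_one_sub_sq_cpow _ (one_sub_sq_mem_slitPlane (hpos x))).comp
        (f := fun x : ℝ => (x : ℂ) + δ * Complex.I) (by fun_prop)
    · filter_upwards [self_mem_nhdsWithin] with δ hδ
      refine .of_forall fun x hx => ?_
      rw [norm_mul]
      gcongr
      refine (Complex.abs_im_le_norm _).trans (norm_one_sub_sq_cpow_le hn hβ ?_)
      simpa using hx1 hx
    · exact intervalIntegrable_const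
    · refine .of_forall fun x hx => Tendsto.mono_left ?_ nhdsWithin_le_nhds
      have hx2 : x ^ 2 < 1 := by
        have := (hx1 hx).trans_lt hβ
        rw [← sq_abs]
        nlinarith [abs_nonneg x]
      -- For |x| < 1 the base 1-x² is a positive real, so the power is continuous there and its
      -- value is real.
      have hmem : 1 - ((x : ℂ) + (0 : ℝ) * Complex.I) ^ 2 ∈ Complex.slitPlane := by
        rw [Complex.ofReal_zero, zero_mul, add_zero, ← Complex.ofReal_pow, ← Complex.ofReal_one,
          ← Complex.ofReal_sub, Complex.ofReal_mem_slitPlane]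
        linarith
      have hc := (continuousAt_one_sub_sq_cpow (-((n : ℝ) - 1) / 2) hmem).comp
        (f := fun δ : ℝ => (x : ℂ) + δ * Complex.I) (x := 0) (by fun_prop)
      have hc2 := (Complex.continuous_im.continuousAt.comp hc).tendsto.const_mul
        ((n - 2) * (volume : Measure E).toSphere.real univ)
      convert hc2 using 2
      · rfl
      · change (0 : ℝ) = (n - 2) * (volume : Measure E).toSphere.real univ *
          ((1 - ((x : ℂ) + (0 : ℝ) * Complex.I) ^ 2) ^ ((-((n : ℝ) - 1) / 2 : ℝ) : ℂ)).im
        rw [Complex.ofReal_zero, zero_mul, add_zero, ← Complex.ofReal_pow, ← Complex.ofReal_one,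
            ← Complex.ofReal_sub, ← Complex.ofReal_cpow (by linarith), Complex.ofReal_im, mul_zero]
  have h2 := (tendsto_re_zonalPotential_vertical hn e he).add h
  rw [intervalIntegral.integral_zero, add_zero] at h2
  refine h2.congr' ?_
  filter_upwards [self_mem_nhdsWithin] with δ hδ
  exact (re_zonalPotential_horizontal hn e he β hδ).symm

end Zonal

/-! ### The beta integral, the area of the sphere and the constant d_n. -/

section Constants

theorem betaIntegral_two : betaIntegral 2 = Real.pi / 2 := by
  have h : ∀ τ : ℝ, (1 + τ ^ 2) ^ (-((2 : ℕ) : ℝ) / 2) = (1 + τ ^ 2)⁻¹ := fun τ => by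
    rw [show -((2 : ℕ) : ℝ) / 2 = -1 by norm_num, Real.rpow_neg_one]
  simp only [betaIntegral, h]
  rw [integral_Ioi_inv_one_add_sq, Real.arctan_zero, sub_zero]

theorem hasDerivAt_mul_one_add_sq_rpow (p τ : ℝ) :
    HasDerivAt (fun τ : ℝ => τ * (1 + τ ^ 2) ^ p)
      ((1 + 2 * p) * (1 + τ ^ 2) ^ p - 2 * p * (1 + τ ^ 2) ^ (p - 1)) τ := by
  have h0 : 0 < 1 + τ ^ 2 := by positivity
  have h := (hasDerivAt_id τ).mul
    (((hasDerivAt_pow 2 τ).const_add 1).rpow_const (p := p) (Or.inl h0.ne'))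
  refine h.congr_deriv ?_
  have : (1 + τ ^ 2) ^ p = (1 + τ ^ 2) ^ (p - 1) * (1 + τ ^ 2) := by
    rw [Real.rpow_sub_one h0.ne']
    field_simp
  rw [this]
  simp
  ring

theorem betaIntegral_three : betaIntegral 3 = 1 := by
  have hint := (integrable_betaIntegrand (k := 3) (by norm_num)).integrableOn (s := Ioi 0)
  have hs : (fun τ : ℝ => τ * (1 + τ ^ 2) ^ (-(1 / 2 : ℝ))) = fun τ => τ / √(1 + τ ^ 2) := by
    ext τ
    rw [Real.rpow_neg (by positivity), ← Real.sqrt_eq_rpow, div_eq_mul_inv]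
  have := integral_Ioi_of_hasDerivAt_of_tendsto' (a := 0) (m := 1)
    (f := fun τ : ℝ => τ * (1 + τ ^ 2) ^ (-(1 / 2 : ℝ)))
    (f' := fun τ : ℝ => (1 + τ ^ 2) ^ (-((3 : ℕ) : ℝ) / 2)) (fun τ _ => ?_) hint
    (hs ▸ tendsto_div_sqrt_one_add_sq)
  · rw [betaIntegral, this]
    simp
  · refine (hasDerivAt_mul_one_add_sq_rpow _ τ).congr_deriv ?_
    norm_num

/-- Integrate the derivative of τ(1+τ²)^{-k/2}, which vanishes at both ends of (0,∞). -/
theorem betaIntegral_add_two {k : ℕ} (hk : 2 ≤ k) :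
    k * betaIntegral (k + 2) = (k - 1) * betaIntegral k := by
  have i1 := (integrable_betaIntegrand hk).integrableOn (s := Ioi 0)
  have i2 := (integrable_betaIntegrand (k := k + 2) (by omega)).integrableOn (s := Ioi 0)
  have hk' : (2 : ℝ) ≤ k := by exact_mod_cast hk
  have hlim : Tendsto (fun τ : ℝ => τ * (1 + τ ^ 2) ^ (-(k : ℝ) / 2)) atTop (𝓝 0) := by
    have h1 : Tendsto (fun τ : ℝ => (√(1 + τ ^ 2))⁻¹) atTop (𝓝 0) := by
      refine (Filter.tendsto_atTop_mono (fun τ => ?_) tendsto_id).inv_tendsto_atTop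
      exact Real.le_sqrt_of_sq_le (by simp)
    have h2 := tendsto_div_sqrt_one_add_sq.mul h1
    rw [mul_zero] at h2
    refine squeeze_zero_norm' ?_ h2
    filter_upwards [eventually_gt_atTop 0] with τ hτ
    rw [Real.norm_of_nonneg (by positivity), div_eq_mul_inv τ, mul_assoc τ, ← mul_inv,
      Real.mul_self_sqrt (by positivity), ← Real.rpow_neg_one]
    gcongr
    · nlinarith
    · linarith
  have := integral_Ioi_of_hasDerivAt_of_tendsto' (a := 0) (m := 0)
    (f := fun τ : ℝ => τ * (1 + τ ^ 2) ^ (-(k : ℝ) / 2))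
    (f' := fun τ : ℝ => k * (1 + τ ^ 2) ^ (-((k + 2 : ℕ) : ℝ) / 2) -
      (k - 1) * (1 + τ ^ 2) ^ (-(k : ℝ) / 2)) (fun τ _ => ?_)
    (Integrable.sub' (i2.const_mul (k : ℝ)) (i1.const_mul ((k : ℝ) - 1))) hlim
  · rw [integral_sub (i2.const_mul _) (i1.const_mul _), integral_const_mul,
      integral_const_mul] at this
    simp only [zero_mul, sub_zero] at this
    unfold betaIntegral
    linarith
  · refine (hasDerivAt_mul_one_add_sq_rpow _ τ).congr_deriv ?_
    rw [show -((k + 2 : ℕ) : ℝ) / 2 = -(k : ℝ) / 2 - 1 by push_cast; ring]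
    ring

theorem betaIntegral_eq {k : ℕ} (hk : 2 ≤ k) :
    betaIntegral k =
      √Real.pi * Real.Gamma (((k : ℝ) - 1) / 2) / (2 * Real.Gamma ((k : ℝ) / 2)) := by
  induction k using Nat.strong_induction_on with
  | _ k ih =>
    rcases (by omega : k = 2 ∨ k = 3 ∨ 4 ≤ k) with rfl | rfl | h4
    · rw [betaIntegral_two, show (((2 : ℕ) : ℝ) - 1) / 2 = 1 / 2 by norm_num,
        show ((2 : ℕ) : ℝ) / 2 = 1 by norm_num, Real.Gamma_one_half_eq, Real.Gamma_one,
        Real.mul_self_sqrt Real.pi_pos.le, mul_one]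
    · rw [betaIntegral_three, show (((3 : ℕ) : ℝ) - 1) / 2 = 1 by norm_num,
        show ((3 : ℕ) : ℝ) / 2 = 1 / 2 + 1 by norm_num, Real.Gamma_add_one (by norm_num),
        Real.Gamma_one_half_eq, Real.Gamma_one]
      have : √Real.pi ≠ 0 := by positivity
      field_simp
    · obtain ⟨m, rfl⟩ : ∃ m, k = m + 2 := ⟨k - 2, by omega⟩
      have hm : (2 : ℝ) ≤ m := by exact_mod_cast (by omega : 2 ≤ m)
      have h := betaIntegral_add_two (k := m) (by omega)
      rw [ih m (by omega) (by omega)] at h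
      have e1 : Real.Gamma (((m + 2 : ℕ) - 1) / 2 : ℝ) =
          ((m : ℝ) - 1) / 2 * Real.Gamma (((m : ℝ) - 1) / 2) := by
        rw [← Real.Gamma_add_one (by linarith)]
        congr 1
        push_cast
        ring
      have e2 : Real.Gamma ((m + 2 : ℕ) / 2 : ℝ) = (m : ℝ) / 2 * Real.Gamma ((m : ℝ) / 2) := by
        rw [← Real.Gamma_add_one (by linarith)]
        congr 1
        push_cast
        ring
      have hG : Real.Gamma ((m : ℝ) / 2) ≠ 0 := (Real.Gamma_pos_of_pos (by linarith)).ne'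
      have hm0 : (m : ℝ) ≠ 0 := by linarith
      rw [e1, e2, ← mul_right_inj' hm0, h]
      field_simp

theorem unitSphereArea_eq_toSphere {n : ℕ} (hn : 0 < n) :
    Hyp.unitSphereArea n =
      (volume : Measure (EuclideanSpace ℝ (Fin n))).toSphere.real univ := by
  have : Nonempty (Fin n) := ⟨⟨0, hn⟩⟩
  have hn' : (0 : ℝ) < n := by exact_mod_cast hn
  rw [Measure.toSphere_real_apply_univ, Measure.real, EuclideanSpace.volume_ball]
  have hG : Real.Gamma ((n : ℝ) / 2) ≠ 0 := (Real.Gamma_pos_of_pos (by linarith)).ne'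
  have hG1 : 0 < Real.Gamma ((n : ℝ) / 2 + 1) := Real.Gamma_pos_of_pos (by linarith)
  simp only [finrank_euclideanSpace, Fintype.card_fin, ENNReal.ofReal_one, one_pow, one_mul]
  rw [ENNReal.toReal_ofReal (by positivity), Real.Gamma_add_one (by positivity),
    Hyp.unitSphereArea, Real.sqrt_eq_rpow, ← Real.rpow_natCast, ← Real.rpow_mul Real.pi_pos.le,
    show 1 / 2 * (n : ℝ) = n / 2 by ring]
  field_simp

/-- This identity determines d_n: the coefficient of the Newton potential in f₀, apart from sinh R,
times the constant of the Poisson equation is 1/d_n. The exponents [n/2-1] and [n/2] differ by one,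
which absorbs the minus sign of the Laplacian. -/
theorem dConst_mul {n : ℕ} (hn : 2 < n) :
    Hyp.dConst n * ((-1) ^ (n / 2) / Real.pi * ((n - 2).factorial * betaIntegral (n - 1)) *
      -((n - 2) * Hyp.unitSphereArea n)) = 1 := by
  have hn2 : (2 : ℝ) < n := by exact_mod_cast hn
  have hfloor : ⌊(n : ℝ) / 2 - 1⌋₊ = n / 2 - 1 := by
    rw [show (n : ℝ) / 2 - 1 = (n : ℝ) / 2 - ((1 : ℕ) : ℝ) by simp, Nat.floor_sub_natCast]
    congr 1
    exact_mod_cast Nat.floor_div_eq_div (K := ℝ) n 2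
  have hsign : (-1 : ℝ) ^ (n / 2 - 1) * (-1) ^ (n / 2) = -1 := by
    obtain ⟨k, hk⟩ : ∃ k, n / 2 = k + 1 := ⟨n / 2 - 1, by omega⟩
    rw [hk, Nat.add_sub_cancel, pow_succ, ← mul_assoc, ← mul_pow]
    simp
  -- Legendre duplication at (n-1)/2 turns (n-2)! into Γ((n-1)/2)Γ(n/2), whose first factor cancels
  -- the denominator of the beta integral.
  have hdup := Real.Gamma_mul_Gamma_add_half (((n : ℝ) - 1) / 2)
  rw [show ((n : ℝ) - 1) / 2 + 1 / 2 = n / 2 by ring, show 2 * (((n : ℝ) - 1) / 2) = (n - 2 : ℕ) + 1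
    by rw [Nat.cast_sub hn.le]; push_cast; ring, Real.Gamma_nat_eq_factorial] at hdup
  have hpow : (2 : ℝ) ^ (1 - (((n - 2 : ℕ) : ℝ) + 1)) * 2 ^ (n - 2) = 1 := by
    rw [← Real.rpow_natCast, ← Real.rpow_add two_pos]
    simp
  have hG1 : Real.Gamma ((n : ℝ) / 2) ≠ 0 := (Real.Gamma_pos_of_pos (by linarith)).ne'
  have hG2 : Real.Gamma (((n : ℝ) - 1) / 2) ≠ 0 := (Real.Gamma_pos_of_pos (by linarith)).ne'
  have hG3 : Real.Gamma ((n : ℝ) / 2) = ((n : ℝ) - 2) / 2 * Real.Gamma (((n : ℝ) - 2) / 2) := by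
    rw [← Real.Gamma_add_one (by linarith)]
    congr 1
    ring
  have hG4 : Real.Gamma (((n : ℝ) - 2) / 2) ≠ 0 := (Real.Gamma_pos_of_pos (by linarith)).ne'
  have hpi : Real.pi ^ ((n : ℝ) / 2) = Real.pi ^ ((n : ℝ) / 2 - 1) * Real.pi := by
    rw [Real.rpow_sub_one Real.pi_ne_zero]
    field_simp
  have h2 : (2 : ℝ) ^ (n - 1) = 2 ^ (n - 2) * 2 := by
    rw [← pow_succ]
    congr 1
    omega
  have hsq := Real.sq_sqrt Real.pi_pos.le
  rw [betaIntegral_eq (by omega), Hyp.dConst, Hyp.unitSphereArea, hfloor, hpi, h2,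
    Nat.cast_sub (by omega : 1 ≤ n), show ((n : ℝ) - (1 : ℕ) - 1) / 2 = (n - 2) / 2 by
      push_cast; ring,
    Nat.cast_one]
  set a := (2 : ℝ) ^ (1 - (((n - 2 : ℕ) : ℝ) + 1))
  set G1 := Real.Gamma ((n : ℝ) / 2)
  set G2 := Real.Gamma (((n : ℝ) - 1) / 2)
  set G3 := Real.Gamma (((n : ℝ) - 2) / 2)
  have hp : Real.pi ^ ((n : ℝ) / 2 - 1) ≠ 0 := by positivity
  have hpp : (2 : ℝ) ^ (n - 2) ≠ 0 := by positivity
  have ha : a = ((2 : ℝ) ^ (n - 2))⁻¹ := eq_inv_of_mul_eq_one_left hpow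
  rw [ha] at hdup
  have hdup' : G2 * G1 * 2 ^ (n - 2) = (n - 2).factorial * √Real.pi := by
    rw [hdup]
    field_simp
  field_simp
  linear_combination (-((n - 2) * (n - 2).factorial * √Real.pi * G3)) * hsign -
    2 * (n - 2).factorial * √Real.pi * hG3 - 2 * G1 * hdup'

end Constants

universe u

/-! ### Smooth dependence of spherical integrals on parameters. -/

section ParametricIntegral

variable {n : ℕ}

local notation "E" => EuclideanSpace ℝ (Fin n)

theorem hasFDerivAt_integral_sphere {P : Type} [NormedAddCommGroup P] [NormedSpace ℝ P]
    [ProperSpace P] {F : Type u} [NormedAddCommGroup F] [NormedSpace ℝ F] {G : P × E → F}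
    (hG : ContDiff ℝ ∞ G) (p : P) :
    HasFDerivAt (fun p => ∫ u : Metric.sphere (0 : E) 1, G (p, u) ∂(volume : Measure E).toSphere)
      (∫ u : Metric.sphere (0 : E) 1, (fderiv ℝ G (p, u)).comp (ContinuousLinearMap.inl ℝ P E)
        ∂(volume : Measure E).toSphere) p := by
  have hG' : Continuous (fun q => (fderiv ℝ G q).comp (ContinuousLinearMap.inl ℝ P E)) :=
    (hG.continuous_fderiv (by simp)).clm_comp continuous_const
  obtain ⟨C, hC⟩ := ((isCompact_closedBall p 1).prod
    (isCompact_sphere (0 : E) 1)).exists_bound_of_continuousOn hG'.continuousOn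
  refine hasFDerivAt_integral_of_dominated_of_fderiv_le (bound := fun _ => C)
    (F' := fun p (u : Metric.sphere (0 : E) 1) =>
      (fderiv ℝ G (p, (u : E))).comp (ContinuousLinearMap.inl ℝ P E))
    (Metric.closedBall_mem_nhds p one_pos) ?_ ?_ ?_ ?_ ?_ ?_
  · exact .of_forall fun q => (hG.continuous.comp (by fun_prop)).aestronglyMeasurable
  · exact integrable_of_continuous_sphere (hG.continuous.comp (by fun_prop))
  · exact (hG'.comp (by fun_prop)).aestronglyMeasurable
  · exact .of_forall fun u q hq => hC (q, u) ⟨hq, u.2⟩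
  · exact integrable_const _
  · refine .of_forall fun u q _ => ?_
    have h1 : HasFDerivAt (fun q : P => (q, (u : E))) (ContinuousLinearMap.inl ℝ P E) q :=
      (hasFDerivAt_id q).prodMk (hasFDerivAt_const _ _)
    exact ((hG.differentiable (by simp) (q, (u : E))).hasFDerivAt).comp q h1

/-- Induction on the order, with `F` generalized: the derivative is an integral of the same kind
with values in `P →L[ℝ] F`. Taking `P` in `Type` keeps that space in the universe of `F`. -/
theorem contDiff_integral_sphere {P : Type} [NormedAddCommGroup P] [NormedSpace ℝ P]
    [ProperSpace P] {F : Type u} [NormedAddCommGroup F] [NormedSpace ℝ F] {G : P × E → F}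
    (hG : ContDiff ℝ ∞ G) :
    ContDiff ℝ ∞ (fun p => ∫ u : Metric.sphere (0 : E) 1, G (p, u)
      ∂(volume : Measure E).toSphere) := by
  rw [contDiff_infty]
  intro k
  induction k generalizing F with
  | zero =>
    rw [Nat.cast_zero, contDiff_zero]
    exact continuous_iff_continuousAt.2 fun p => (hasFDerivAt_integral_sphere hG p).continuousAt
  | succ k ih =>
    rw [Nat.cast_succ, contDiff_succ_iff_fderiv]
    refine ⟨fun p => (hasFDerivAt_integral_sphere hG p).differentiableAt, by simp, ?_⟩
    have : fderiv ℝ (fun p => ∫ u : Metric.sphere (0 : E) 1, G (p, u)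
        ∂(volume : Measure E).toSphere) = fun p => ∫ u : Metric.sphere (0 : E) 1,
          (fun q => (fderiv ℝ G q).comp (ContinuousLinearMap.inl ℝ P E)) (p, (u : E))
        ∂(volume : Measure E).toSphere := funext fun p => (hasFDerivAt_integral_sphere hG p).fderiv
    rw [this]
    exact ih ((hG.fderiv_right (m := ∞) le_rfl).clm_comp contDiff_const)

/-- Each t-derivative is the Fréchet derivative applied to (0,1), so joint smoothness on an open set
passes from one order to the next. -/
theorem contDiffOn_iteratedDeriv_snd {V : Type*} [NormedAddCommGroup V] [NormedSpace ℝ V]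
    {F : Type*} [NormedAddCommGroup F] [NormedSpace ℝ F] {Φ : V × ℝ → F} {U : Set (V × ℝ)}
    (hU : IsOpen U) (hΦ : ContDiffOn ℝ ∞ Φ U) (k : ℕ) :
    ContDiffOn ℝ ∞ (fun p : V × ℝ => iteratedDeriv k (fun t => Φ (p.1, t)) p.2) U := by
  induction k with
  | zero => simpa using hΦ
  | succ k ih =>
    have h1 : ContDiffOn ℝ ∞ (fun p => fderiv ℝ
        (fun p : V × ℝ => iteratedDeriv k (fun t => Φ (p.1, t)) p.2) p (0, 1)) U :=
      ((contDiffOn_infty_iff_fderiv_of_isOpen hU).1 ih).2.clm_apply contDiffOn_const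
    refine h1.congr fun p hp => ?_
    have hd := ((ih p hp).contDiffAt (hU.mem_nhds hp)).differentiableAt (by simp)
    have h2 : HasDerivAt (fun t : ℝ => (p.1, t)) ((0 : V), (1 : ℝ)) p.2 :=
      (hasDerivAt_const _ _).prodMk (hasDerivAt_id _)
    have h3 := (hd.hasFDerivAt.comp_hasDerivAt p.2 h2).deriv
    rw [← h3, iteratedDeriv_succ]
    rfl

end ParametricIntegral

/-! ### Spherical means in the graph chart. -/

section SphericalMean

variable {n : ℕ} {F : Type*} [NormedAddCommGroup F] [NormedSpace ℝ F]

local notation "E" => EuclideanSpace ℝ (Fin n)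

/-- The hyperbolic motion `Hyp.boost (Hyp.lift v)` in the graph chart. -/
def chartBoost (v w : EuclideanSpace ℝ (Fin n)) : EuclideanSpace ℝ (Fin n) :=
  w + (inner ℝ v w / (1 + √(1 + ‖v‖ ^ 2)) + √(1 + ‖w‖ ^ 2)) • v

theorem boost_lift (v w : E) :
    Hyp.boost (Hyp.lift v) (Hyp.lift w) = Hyp.lift (chartBoost v w) :=
  (Hyp.lift_fst (Hyp.boost (Hyp.lift v) (Hyp.lift w))).symm

theorem contDiff_sqrt_one_add_norm_sq : ContDiff ℝ ∞ fun w : E => √(1 + ‖w‖ ^ 2) :=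
  (contDiff_const.add (contDiff_norm_sq ℝ)).sqrt fun w => by positivity

theorem contDiff_chartBoost : ContDiff ℝ ∞ fun p : E × E => chartBoost p.1 p.2 := by
  have h1 : ContDiff ℝ ∞ fun p : E × E => √(1 + ‖p.1‖ ^ 2) :=
    contDiff_sqrt_one_add_norm_sq.comp contDiff_fst
  have h2 : ContDiff ℝ ∞ fun p : E × E => √(1 + ‖p.2‖ ^ 2) :=
    contDiff_sqrt_one_add_norm_sq.comp contDiff_snd
  unfold chartBoost
  refine contDiff_snd.add (ContDiff.smul (ContDiff.add (ContDiff.div ?_ ?_ ?_) h2) contDiff_fst)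
  · exact contDiff_fst.inner ℝ contDiff_snd
  · exact contDiff_const.add h1
  · intro p
    positivity

/-- The integral of `g` over the hyperbolic sphere with center `v` and parameter `r`, in the graph
chart. -/
def sphereIntegral (g : EuclideanSpace ℝ (Fin n) → F) (v : EuclideanSpace ℝ (Fin n)) (r : ℝ) : F :=
  ∫ u : Metric.sphere (0 : EuclideanSpace ℝ (Fin n)) 1,
    g (chartBoost v (r • (u : EuclideanSpace ℝ (Fin n))))
    ∂(volume : Measure (EuclideanSpace ℝ (Fin n))).toSphere

theorem contDiff_sphereIntegral {g : E → F} (hg : ContDiff ℝ ∞ g) :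
    ContDiff ℝ ∞ fun p : E × ℝ => sphereIntegral g p.1 p.2 := by
  refine contDiff_integral_sphere (P := E × ℝ)
    (G := fun q : (E × ℝ) × E => g (chartBoost q.1.1 (q.1.2 • q.2))) ?_
  exact hg.comp (contDiff_chartBoost.comp
    ((contDiff_fst.comp contDiff_fst).prodMk
      ((contDiff_snd.comp contDiff_fst).smul contDiff_snd)))

/-- The weighted spherical mean in the graph chart. -/
def weightedMean (g : EuclideanSpace ℝ (Fin n) → F) (v : EuclideanSpace ℝ (Fin n)) (t : ℝ) : F :=
  ((t ^ 2 - 1) ^ ((n : ℝ) / 2 - 1) * (Hyp.unitSphereArea n)⁻¹) • sphereIntegral g v (√(t ^ 2 - 1))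

theorem contDiffOn_weightedMean {g : E → F} (hg : ContDiff ℝ ∞ g) :
    ContDiffOn ℝ ∞ (fun p : E × ℝ => weightedMean g p.1 p.2) (univ ×ˢ Ioi 1) := by
  have hpos (p : E × ℝ) (hp : p ∈ (univ : Set E) ×ˢ Ioi (1 : ℝ)) : p.2 ^ 2 - 1 ≠ 0 := by
    have : 1 < p.2 := hp.2
    nlinarith
  have h0 : ContDiffOn ℝ ∞ (fun p : E × ℝ => p.2 ^ 2 - 1) ((univ : Set E) ×ˢ Ioi (1 : ℝ)) := by
    fun_prop
  unfold weightedMean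
  refine ((h0.rpow_const_of_ne hpos).mul contDiffOn_const).smul ?_
  exact (contDiff_sphereIntegral hg).comp_contDiffOn
    (contDiff_fst.contDiffOn.prodMk (h0.sqrt hpos))

theorem weighted_sphericalMean {𝕜 : Type*} [RCLike 𝕜] {f : Hyp n → 𝕜} (hf : Hyp.Smooth f)
    (v : E) {t : ℝ} (ht : 1 < t) :
    Hyp.weighted (Hyp.sphericalMean f) (Hyp.lift v) t =
      weightedMean (fun w => f (Hyp.lift w)) v t := by
  have h0 : 0 < t ^ 2 - 1 := by nlinarith
  -- Smoothness is given only through the chart; `f` is recovered as the chart expression composed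
  -- with the projection x ↦ x'.
  have hfc : Continuous f := by
    have : f = (fun w => f (Hyp.lift w)) ∘ fun x : Hyp n => x.1.1 := by
      ext x
      simp [Hyp.lift_fst]
    rw [this]
    exact (ContDiff.continuous hf).comp (by fun_prop)
  have h1 : ∫ y, f y ∂(Hyp.surface (Hyp.lift v) t) =
      (t ^ 2 - 1) ^ (((n : ℝ) - 1) / 2) •
        sphereIntegral (fun w => f (Hyp.lift w)) v (√(t ^ 2 - 1)) := by
    rw [Hyp.surface, integral_smul_measure, ENNReal.toReal_ofReal (by positivity),
      integral_map (Hyp.continuous_spherePoint _ _).aemeasurable hfc.aestronglyMeasurable]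
    congr 1
    refine integral_congr_ae (.of_forall fun u => ?_)
    simp only [Hyp.spherePoint, boost_lift]
  rw [Hyp.weighted, Hyp.sphericalMean, h1, weightedMean, smul_smul, smul_smul]
  congr 1
  rw [mul_assoc, div_mul_eq_mul_div, ← Real.rpow_add h0,
    show (1 - (n : ℝ)) / 2 + (n - 1) / 2 = 0 by ring, Real.rpow_zero, one_div]

end SphericalMean

/-! ### Invariant measure and the density of y ↦ [v,y]. -/

section Pushforward

variable {n : ℕ} {F : Type*} [NormedAddCommGroup F] [NormedSpace ℝ F]

local notation "E" => EuclideanSpace ℝ (Fin n)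

theorem sqrt_one_add_norm_sq_chartBoost (v w : E) :
    √(1 + ‖chartBoost v w‖ ^ 2) = inner ℝ v w + √(1 + ‖v‖ ^ 2) * √(1 + ‖w‖ ^ 2) :=
  (congrArg (fun x : Hyp n => x.1.2) (boost_lift v w)).symm

theorem form_lift (v w : E) :
    Hyp.form (Hyp.lift v) (Hyp.lift w) = √(1 + ‖v‖ ^ 2) * √(1 + ‖w‖ ^ 2) - inner ℝ v w := rfl

theorem form_lift_chartBoost (v w : E) :
    Hyp.form (Hyp.lift v) (Hyp.lift (chartBoost v w)) = √(1 + ‖w‖ ^ 2) := by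
  have h := Hyp.form_boost (Hyp.lift v) (Hyp.origin n) (Hyp.lift w)
  rw [Hyp.boost_origin, boost_lift] at h
  rw [h]
  simp [Hyp.form, lorentzForm, Hyp.origin, Hyp.lift]

/-- The boost by -v inverts the boost by v; in the chart this gives bijectivity. -/
theorem chartBoost_neg_chartBoost (v w : E) : chartBoost (-v) (chartBoost v w) = w := by
  have hV : √(1 + ‖v‖ ^ 2) ^ 2 = 1 + ‖v‖ ^ 2 := Real.sq_sqrt (by positivity)
  have h0 : 0 < √(1 + ‖v‖ ^ 2) := Real.sqrt_pos.2 (by positivity)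
  have hin : inner ℝ v (chartBoost v w) = inner ℝ v w +
      (inner ℝ v w / (1 + √(1 + ‖v‖ ^ 2)) + √(1 + ‖w‖ ^ 2)) * ‖v‖ ^ 2 := by
    rw [chartBoost, inner_add_right, inner_smul_right, real_inner_self_eq_norm_sq]
  have hc : inner ℝ v w / (1 + √(1 + ‖v‖ ^ 2)) + √(1 + ‖w‖ ^ 2) -
      (-inner ℝ v (chartBoost v w) / (1 + √(1 + ‖v‖ ^ 2)) + √(1 + ‖chartBoost v w‖ ^ 2)) = 0 := by
    rw [sqrt_one_add_norm_sq_chartBoost, hin, show ‖v‖ ^ 2 = √(1 + ‖v‖ ^ 2) ^ 2 - 1 by linarith]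
    rw [show 1 + (√(1 + ‖v‖ ^ 2) ^ 2 - 1) = 1 + ‖v‖ ^ 2 by linarith]
    field_simp
    ring
  conv_lhs => rw [chartBoost]
  rw [norm_neg, inner_neg_left, smul_neg, ← sub_eq_add_neg]
  nth_rw 1 [chartBoost]
  rw [add_sub_assoc, ← sub_smul, hc, zero_smul, add_zero]

theorem bijective_chartBoost (v : E) : Function.Bijective (chartBoost v) :=
  ⟨fun w w' h => by rw [← chartBoost_neg_chartBoost v w, h, chartBoost_neg_chartBoost],
    fun y => ⟨chartBoost (-v) y, by simpa using chartBoost_neg_chartBoost (-v) y⟩⟩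

/-- The derivative of `chartBoost v` at `w`. -/
def chartBoostDeriv (v w : EuclideanSpace ℝ (Fin n)) :
    EuclideanSpace ℝ (Fin n) →L[ℝ] EuclideanSpace ℝ (Fin n) :=
  ContinuousLinearMap.id ℝ _ + ((1 + √(1 + ‖v‖ ^ 2))⁻¹ • innerSL ℝ v +
    (√(1 + ‖w‖ ^ 2))⁻¹ • innerSL ℝ w).smulRight v

theorem hasFDerivAt_chartBoost (v w : E) :
    HasFDerivAt (chartBoost v) (chartBoostDeriv v w) w := by
  have h1 : HasFDerivAt (fun w : E => √(1 + ‖w‖ ^ 2))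
      ((1 / (2 * √(1 + ‖w‖ ^ 2))) • (2 • innerSL ℝ w)) w :=
    ((hasStrictFDerivAt_norm_sq w).hasFDerivAt.const_add 1).sqrt (by positivity)
  have h2 := ((innerSL ℝ v).hasFDerivAt (x := w)).mul_const (1 + √(1 + ‖v‖ ^ 2))⁻¹
  have h3 := (hasFDerivAt_id w).add ((h2.add h1).smul_const v)
  refine (h3.congr_of_eventuallyEq (.of_forall fun y => ?_)).congr_fderiv ?_
  · simp [chartBoost, div_eq_mul_inv]
  · ext1 y
    simp only [chartBoostDeriv, _root_.add_apply, ContinuousLinearMap.smulRight_apply,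
      _root_.smul_apply]
    congr 2
    simp
    field_simp

/-- The derivative is a rank-one perturbation id + ℓ(·)v, of determinant 1+ℓ(v). The resulting
quotient of heights expresses the invariance of the hyperbolic measure dy/√(1+|y|²). -/
theorem det_chartBoostDeriv (v w : E) :
    (chartBoostDeriv v w).det = √(1 + ‖chartBoost v w‖ ^ 2) / √(1 + ‖w‖ ^ 2) := by
  set ℓ : E →L[ℝ] ℝ := (1 + √(1 + ‖v‖ ^ 2))⁻¹ • innerSL ℝ v + (√(1 + ‖w‖ ^ 2))⁻¹ • innerSL ℝ w
    with hℓ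
  have h1 : ((chartBoostDeriv v w : E →L[ℝ] E) : E →ₗ[ℝ] E) =
      LinearMap.transvection (ℓ : E →ₗ[ℝ] ℝ) v := by
    ext1 y
    rfl
  have hV : √(1 + ‖v‖ ^ 2) ^ 2 = 1 + ‖v‖ ^ 2 := Real.sq_sqrt (by positivity)
  have h0 : 0 < √(1 + ‖v‖ ^ 2) := Real.sqrt_pos.2 (by positivity)
  have h0' : 0 < √(1 + ‖w‖ ^ 2) := Real.sqrt_pos.2 (by positivity)
  rw [ContinuousLinearMap.det, h1, LinearMap.transvection.det, sqrt_one_add_norm_sq_chartBoost]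
  simp only [hℓ, ContinuousLinearMap.coe_coe, _root_.add_apply,
    _root_.smul_apply, innerSL_apply_apply, smul_eq_mul, real_inner_self_eq_norm_sq]
  rw [real_inner_comm w v]
  field_simp
  linear_combination (-√(1 + ‖w‖ ^ 2)) * hV

theorem integral_comp_chartBoost (v : E) (H : E → F) :
    ∫ y, H y = ∫ w, (√(1 + ‖chartBoost v w‖ ^ 2) / √(1 + ‖w‖ ^ 2)) • H (chartBoost v w) := by
  have := integral_image_eq_integral_abs_det_fderiv_smul volume MeasurableSet.univ
    (fun w _ => (hasFDerivAt_chartBoost v w).hasFDerivWithinAt)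
    (bijective_chartBoost v).injective.injOn H
  rw [image_univ, (bijective_chartBoost v).surjective.range_eq, Measure.restrict_univ] at this
  rw [this]
  refine integral_congr_ae (.of_forall fun w => ?_)
  dsimp only
  rw [det_chartBoostDeriv, abs_of_nonneg (by positivity)]

theorem integral_Ioi_one_eq (G : ℝ → F) :
    ∫ t in Ioi (1 : ℝ), G t = ∫ r in Ioi (0 : ℝ), (r / √(1 + r ^ 2)) • G (√(1 + r ^ 2)) := by
  have him : (fun r : ℝ => √(1 + r ^ 2)) '' Ioi 0 = Ioi 1 := by
    ext t
    constructor
    · rintro ⟨r, hr, rfl⟩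
      have hr : 0 < r := hr
      exact Real.lt_sqrt_of_sq_lt (by nlinarith)
    · intro ht
      have ht : 1 < t := ht
      refine ⟨√(t ^ 2 - 1), Real.sqrt_pos.2 (by nlinarith), ?_⟩
      dsimp only
      rw [Real.sq_sqrt (by nlinarith), add_sub_cancel, Real.sqrt_sq (by linarith)]
  have hinj : InjOn (fun r : ℝ => √(1 + r ^ 2)) (Ioi 0) := by
    intro r hr s hs h
    have h' := (Real.sqrt_inj (by positivity) (by positivity)).1 h
    exact (sq_eq_sq₀ (le_of_lt hr) (le_of_lt hs)).1 (by linarith)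
  have hd (r : ℝ) : HasDerivAt (fun r : ℝ => √(1 + r ^ 2)) (r / √(1 + r ^ 2)) r := by
    refine (((hasDerivAt_pow 2 r).const_add 1).sqrt (by positivity)).congr_deriv ?_
    simp
    field_simp
  have := integral_image_eq_integral_abs_deriv_smul measurableSet_Ioi
    (fun r _ => (hd r).hasDerivWithinAt) hinj G
  rw [him] at this
  rw [this]
  refine setIntegral_congr_fun measurableSet_Ioi fun r hr => ?_
  have hr : 0 < r := hr
  rw [abs_of_nonneg (by positivity)]

/-- The weighted mean is the density of the pushforward of the hyperbolic measure `g(y) dy` under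
`y ↦ [v, y]`. -/
theorem integral_smul_weightedMean (hn : 2 < n) {g : E → F} (hg : Continuous g)
    (hgc : HasCompactSupport g) (v : E) {φ : ℝ → ℝ} (hφ : Continuous φ) :
    ∫ t in Ioi (1 : ℝ), φ t • weightedMean g v t = (Hyp.unitSphereArea n)⁻¹ •
      ∫ y, (φ (Hyp.form (Hyp.lift v) (Hyp.lift y)) / √(1 + ‖y‖ ^ 2)) • g y := by
  have : Nontrivial E := by
    have : Nonempty (Fin n) := ⟨⟨0, by omega⟩⟩
    infer_instance
  have hcb : Continuous (chartBoost v) :=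
    (contDiff_chartBoost.comp (contDiff_const.prodMk contDiff_id)).continuous
  have hint : Integrable fun w : E => (φ (√(1 + ‖w‖ ^ 2)) / √(1 + ‖w‖ ^ 2)) •
      g (chartBoost v w) := by
    refine Continuous.integrable_of_hasCompactSupport ?_ ?_
    · refine Continuous.smul (Continuous.div ?_ ?_ fun w => ?_) (hg.comp hcb)
      · exact hφ.comp (by fun_prop)
      · fun_prop
      · have : 0 < √(1 + ‖w‖ ^ 2) := Real.sqrt_pos.2 (by positivity)
        exact this.ne'
    · refine HasCompactSupport.smul_left (f' := fun w => g (chartBoost v w)) ?_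
      refine hgc.comp_isClosedEmbedding (g := chartBoost v) ?_
      refine Topology.IsClosedEmbedding.of_continuous_injective_isClosedMap hcb
        (bijective_chartBoost v).injective fun s hs => ?_
      have hinv : Continuous (chartBoost (-v)) :=
        (contDiff_chartBoost.comp (contDiff_const.prodMk contDiff_id)).continuous
      convert hs.preimage hinv using 1
      ext y
      constructor
      · rintro ⟨w, hw, rfl⟩
        simpa [chartBoost_neg_chartBoost] using hw
      · intro hy
        exact ⟨_, hy, by simpa using chartBoost_neg_chartBoost (-v) y⟩
  rw [integral_comp_chartBoost v]
  have e1 : ∀ w : E, (√(1 + ‖chartBoost v w‖ ^ 2) / √(1 + ‖w‖ ^ 2)) •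
      (φ (Hyp.form (Hyp.lift v) (Hyp.lift (chartBoost v w))) / √(1 + ‖chartBoost v w‖ ^ 2)) •
        g (chartBoost v w) = (φ (√(1 + ‖w‖ ^ 2)) / √(1 + ‖w‖ ^ 2)) • g (chartBoost v w) := by
    intro w
    rw [form_lift_chartBoost, smul_smul]
    congr 1
    have : 0 < √(1 + ‖chartBoost v w‖ ^ 2) := Real.sqrt_pos.2 (by positivity)
    field_simp
  simp_rw [e1]
  -- After the boost the level [v,y] is √(1+|w|²), so polar coordinates w = ru with t = √(1+r²)
  -- separate the level from the spherical average.
  rw [integral_eq_integral_radial_sphere volume hint, integral_Ioi_one_eq, ← integral_smul]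
  refine setIntegral_congr_fun measurableSet_Ioi fun r hr => ?_
  have hr : 0 < r := hr
  have hnorm (u : Metric.sphere (0 : E) 1) : ‖r • (u : E)‖ = r := by
    simp [norm_smul, abs_of_pos hr]
  simp only [hnorm, finrank_euclideanSpace, Fintype.card_fin]
  rw [integral_smul, weightedMean, Real.sq_sqrt (by positivity), add_sub_cancel_left,
    Real.sqrt_sq hr.le, sphereIntegral, smul_smul, smul_smul, smul_smul, smul_smul]
  congr 1
  have hpow : (r ^ 2) ^ ((n : ℝ) / 2 - 1) = r ^ (n - 2) := by
    rw [← Real.rpow_natCast _ 2, ← Real.rpow_natCast _ (n - 2), ← Real.rpow_mul hr.le,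
      Nat.cast_sub hn.le]
    congr 1
    push_cast
    ring
  rw [hpow, show n - 1 = n - 2 + 1 by omega, pow_succ]
  ring

end Pushforward

/-! ### Support and regularity of the data for centers on the boundary sphere. -/

section Data

variable {n : ℕ} {F : Type*} [NormedAddCommGroup F] [NormedSpace ℝ F]

local notation "E" => EuclideanSpace ℝ (Fin n)

/-- The form `[(θ sinh R, cosh R), (y, √(1 + |y|²))]`. -/
def levelFun (R : ℝ) (θ y : EuclideanSpace ℝ (Fin n)) : ℝ :=
  Real.cosh R * √(1 + ‖y‖ ^ 2) - Real.sinh R * inner ℝ θ y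

theorem form_lift_smul (R : ℝ) {θ : E} (hθ : ‖θ‖ = 1) (y : E) :
    Hyp.form (Hyp.lift (Real.sinh R • θ)) (Hyp.lift y) = levelFun R θ y := by
  rw [form_lift, levelFun, norm_smul, hθ, mul_one, Real.norm_eq_abs, sq_abs, add_comm 1,
    ← Real.cosh_sq, Real.sqrt_sq (Real.cosh_pos R).le, real_inner_smul_left]

/-- This is the triangle inequality for hyperbolic distance: with |y| = sinh r, Cauchy-Schwarz
places the level between cosh(R-r) and cosh(R+r). -/
theorem levelFun_mem_Icc {R R' : ℝ} (hR : 0 < R) (hRR : R' ≤ R) {θ : E} (hθ : ‖θ‖ = 1) {y : E}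
    (hy : ‖y‖ ≤ Real.sinh R') :
    levelFun R θ y ∈ Icc (Real.cosh (R - R')) (Real.cosh (R + R')) := by
  set r := Real.arsinh ‖y‖ with hr
  have hyr : ‖y‖ = Real.sinh r := (Real.sinh_arsinh _).symm
  have hr0 : 0 ≤ r := Real.arsinh_nonneg_iff.2 (norm_nonneg y)
  have hrR : r ≤ R' := by rwa [hyr, Real.sinh_le_sinh] at hy
  have hs : 0 < Real.sinh R := Real.sinh_pos_iff.2 hR
  have hin : |inner ℝ θ y| ≤ Real.sinh r := by
    have := abs_real_inner_le_norm θ y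
    rwa [hθ, one_mul, hyr] at this
  obtain ⟨h1, h2⟩ := abs_le.1 hin
  have hlev : levelFun R θ y = Real.cosh R * Real.cosh r - Real.sinh R * inner ℝ θ y := by
    rw [levelFun, hyr, add_comm 1, ← Real.cosh_sq, Real.sqrt_sq (Real.cosh_pos r).le]
  have l1 : Real.cosh (R - R') ≤ Real.cosh (R - r) := by
    rw [Real.cosh_le_cosh, abs_of_nonneg (by linarith), abs_of_nonneg (by linarith)]
    linarith
  have l2 : Real.cosh (R + r) ≤ Real.cosh (R + R') := by
    rw [Real.cosh_le_cosh, abs_of_nonneg (by linarith), abs_of_nonneg (by linarith)]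
    linarith
  rw [Real.cosh_sub R r] at l1
  rw [Real.cosh_add R r] at l2
  rw [hlev]
  constructor
  · refine l1.trans ?_
    nlinarith
  · refine le_trans ?_ l2
    nlinarith

theorem levelFun_mem_Ioo {R : ℝ} (hR : 0 < R) {θ : E} (hθ : ‖θ‖ = 1) {y : E}
    (hy : ‖y‖ < Real.sinh R) : levelFun R θ y ∈ Ioo 1 (Real.cosh (2 * R)) := by
  have hr0 : 0 ≤ Real.arsinh ‖y‖ := Real.arsinh_nonneg_iff.2 (norm_nonneg y)
  have hrR : Real.arsinh ‖y‖ < R := by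
    rwa [← Real.sinh_lt_sinh, Real.sinh_arsinh]
  have h := levelFun_mem_Icc hR hrR.le hθ (y := y) (by rw [Real.sinh_arsinh])
  constructor
  · refine lt_of_lt_of_le ?_ h.1
    rw [Real.one_lt_cosh]
    linarith
  · refine lt_of_le_of_lt h.2 ?_
    rw [Real.cosh_lt_cosh, abs_of_nonneg (by linarith), abs_of_nonneg (by linarith)]
    linarith

theorem weightedMean_support {R R' : ℝ} (hR : 0 < R) (hRR : R' < R)
    {g : E → F} (hg : ∀ y, g y ≠ 0 → ‖y‖ ≤ Real.sinh R') {θ : E} (hθ : ‖θ‖ = 1) {t : ℝ}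
    (ht : 1 < t) (h : weightedMean g (Real.sinh R • θ) t ≠ 0) :
    t ∈ Icc (Real.cosh (R - R')) (Real.cosh (R + R')) := by
  have h1 : sphereIntegral g (Real.sinh R • θ) (√(t ^ 2 - 1)) ≠ 0 := fun h0 => h (by
    rw [weightedMean, h0, smul_zero])
  obtain ⟨u, hu⟩ : ∃ u : Metric.sphere (0 : E) 1,
      g (chartBoost (Real.sinh R • θ) (√(t ^ 2 - 1) • (u : E))) ≠ 0 := by
    by_contra! hcon
    apply h1
    simp [sphereIntegral, hcon]
  have h2 := levelFun_mem_Icc hR hRR.le hθ (hg _ hu)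
  rw [← form_lift_smul R hθ, form_lift_chartBoost, norm_smul,
    norm_eq_of_mem_sphere u, mul_one, Real.norm_eq_abs, sq_abs, Real.sq_sqrt (by nlinarith),
    add_sub_cancel, Real.sqrt_sq (by linarith)] at h2
  exact h2

/-- The weighted spherical means with center `(θ sinh R, cosh R)`, extended by zero to `t ≤ 1`. -/
def sphereData (g : EuclideanSpace ℝ (Fin n) → F) (R : ℝ) (θ : EuclideanSpace ℝ (Fin n)) : ℝ → F :=
  (Ioi 1).indicator (weightedMean g (Real.sinh R • θ))

theorem sphereData_eventuallyEq (g : E → F) (R : ℝ) (θ : E) {t : ℝ} (ht : 1 < t) :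
    sphereData g R θ =ᶠ[𝓝 t] weightedMean g (Real.sinh R • θ) := by
  filter_upwards [Ioi_mem_nhds ht] with s hs
  exact indicator_of_mem hs _

theorem sphereData_eq_zero {R R' : ℝ} (hR : 0 < R) (hRR : R' < R)
    {g : E → F} (hg : ∀ y, g y ≠ 0 → ‖y‖ ≤ Real.sinh R') {θ : E} (hθ : ‖θ‖ = 1) {t : ℝ}
    (ht : t ∉ Icc (Real.cosh (R - R')) (Real.cosh (R + R'))) : sphereData g R θ t = 0 := by
  by_cases h1 : 1 < t
  · rw [sphereData, indicator_of_mem (by exact h1)]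
    by_contra h
    exact ht (weightedMean_support hR hRR hg hθ h1 h)
  · exact indicator_of_notMem (by exact h1) _

theorem one_lt_cosh_sub {R R' : ℝ} (hRR : R' < R) : 1 < Real.cosh (R - R') := by
  rw [Real.one_lt_cosh]
  linarith

theorem sphereData_eventuallyEq_zero {R R' : ℝ} (hR : 0 < R) (hRR : R' < R)
    {g : E → F} (hg : ∀ y, g y ≠ 0 → ‖y‖ ≤ Real.sinh R') {θ : E} (hθ : ‖θ‖ = 1) {t : ℝ}
    (ht : t ∉ Icc (Real.cosh (R - R')) (Real.cosh (R + R'))) : sphereData g R θ =ᶠ[𝓝 t] 0 := by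
  filter_upwards [isClosed_Icc.isOpen_compl.mem_nhds ht] with s hs
  exact sphereData_eq_zero hR hRR hg hθ hs

/-- The data live on levels at least cosh(R-R') > 1, away from the singularity of the weight at t =
1; hence the extension by zero is smooth on the whole line. -/
theorem contDiff_sphereData {R R' : ℝ} (hR : 0 < R) (hRR : R' < R)
    {g : E → F} (hgs : ContDiff ℝ ∞ g) (hg : ∀ y, g y ≠ 0 → ‖y‖ ≤ Real.sinh R') {θ : E}
    (hθ : ‖θ‖ = 1) : ContDiff ℝ ∞ (sphereData g R θ) := by
  refine contDiff_iff_contDiffAt.2 fun t => ?_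
  by_cases ht : t ∈ Icc (Real.cosh (R - R')) (Real.cosh (R + R'))
  · have h1 : 1 < t := (one_lt_cosh_sub hRR).trans_le ht.1
    refine ContDiffAt.congr_of_eventuallyEq ?_ (sphereData_eventuallyEq g R θ h1)
    have h2 := (contDiffOn_weightedMean hgs).contDiffAt (x := (Real.sinh R • θ, t))
      ((isOpen_univ.prod isOpen_Ioi).mem_nhds ⟨mem_univ _, h1⟩)
    exact h2.comp t (contDiffAt_const.prodMk contDiffAt_id)
  · exact contDiffAt_const.congr_of_eventuallyEq
      (sphereData_eventuallyEq_zero hR hRR hg hθ ht)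

theorem iteratedDeriv_sphereData_eq_zero {R R' : ℝ} (hR : 0 < R) (hRR : R' < R)
    {g : E → F} (hg : ∀ y, g y ≠ 0 → ‖y‖ ≤ Real.sinh R') {θ : E} (hθ : ‖θ‖ = 1) {t : ℝ}
    (ht : t ∉ Icc (Real.cosh (R - R')) (Real.cosh (R + R'))) (k : ℕ) :
    iteratedDeriv k (sphereData g R θ) t = 0 := by
  rw [(sphereData_eventuallyEq_zero hR hRR hg hθ ht).iteratedDeriv_eq]
  simp [Pi.zero_def]

theorem hasCompactSupport_iteratedDeriv_sphereData {R R' : ℝ} (hR : 0 < R) (hRR : R' < R)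
    {g : E → F} (hg : ∀ y, g y ≠ 0 → ‖y‖ ≤ Real.sinh R') {θ : E} (hθ : ‖θ‖ = 1) (k : ℕ) :
    HasCompactSupport (iteratedDeriv k (sphereData g R θ)) :=
  .intro isCompact_Icc fun _ ht => iteratedDeriv_sphereData_eq_zero hR hRR hg hθ ht k

theorem continuous_iteratedDeriv_sphereData {R R' : ℝ} (hR : 0 < R) (hRR : R' < R)
    {g : E → F} (hgs : ContDiff ℝ ∞ g) (hg : ∀ y, g y ≠ 0 → ‖y‖ ≤ Real.sinh R') (k : ℕ) :
    Continuous fun p : Metric.sphere (0 : E) 1 × ℝ =>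
      iteratedDeriv k (sphereData g R (p.1 : E)) p.2 := by
  refine continuous_iff_continuousAt.2 fun p => ?_
  by_cases ht : p.2 ∈ Icc (Real.cosh (R - R')) (Real.cosh (R + R'))
  · have h1 : 1 < p.2 := (one_lt_cosh_sub hRR).trans_le ht.1
    have h2 := ((contDiffOn_iteratedDeriv_snd (isOpen_univ.prod isOpen_Ioi)
      (contDiffOn_weightedMean hgs) k).contDiffAt (x := (Real.sinh R • (p.1 : E), p.2))
      ((isOpen_univ.prod isOpen_Ioi).mem_nhds ⟨mem_univ _, h1⟩)).continuousAt
    have h3 : ContinuousAt (fun q : Metric.sphere (0 : E) 1 × ℝ =>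
        (Real.sinh R • (q.1 : E), q.2)) p := by fun_prop
    refine (ContinuousAt.comp (f := fun q : Metric.sphere (0 : E) 1 × ℝ =>
        (Real.sinh R • (q.1 : E), q.2)) h2 h3).congr ?_
    filter_upwards [(isOpen_lt continuous_const continuous_snd).mem_nhds h1] with q hq
    exact (sphereData_eventuallyEq g R q.1 hq).iteratedDeriv_eq k |>.symm
  · refine ContinuousAt.congr (f := fun _ => (0 : F)) continuousAt_const ?_
    filter_upwards [(isClosed_Icc.isOpen_compl.preimage continuous_snd).mem_nhds ht] with q hq
    exact (iteratedDeriv_sphereData_eq_zero hR hRR hg (norm_eq_of_mem_sphere q.1) hq k).symm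

theorem exists_bound_iteratedDeriv_sphereData {R R' : ℝ} (hR : 0 < R) (hRR : R' < R)
    {g : E → F} (hgs : ContDiff ℝ ∞ g) (hg : ∀ y, g y ≠ 0 → ‖y‖ ≤ Real.sinh R') (k : ℕ) :
    ∃ M, 0 ≤ M ∧ ∀ (θ : Metric.sphere (0 : E) 1) (t : ℝ),
      ‖iteratedDeriv k (sphereData g R (θ : E)) t‖ ≤ M := by
  obtain ⟨M, hM⟩ := (isCompact_univ.prod (isCompact_Icc (a := Real.cosh (R - R'))
    (b := Real.cosh (R + R')))).exists_bound_of_continuousOn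
    (continuous_iteratedDeriv_sphereData hR hRR hgs hg k).continuousOn
  refine ⟨max M 0, le_max_right _ _, fun θ t => ?_⟩
  by_cases ht : t ∈ Icc (Real.cosh (R - R')) (Real.cosh (R + R'))
  · exact (hM (θ, t) ⟨mem_univ _, ht⟩).trans (le_max_left _ _)
  · rw [iteratedDeriv_sphereData_eq_zero hR hRR hg (norm_eq_of_mem_sphere θ) ht, norm_zero]
    exact le_max_right _ _

theorem iteratedDeriv_weighted_sphericalMean {𝕜 : Type*} [RCLike 𝕜] {f : Hyp n → 𝕜}
    (hf : Hyp.Smooth f) (R : ℝ) (θ : E) {t : ℝ} (ht : 1 < t) (k : ℕ) :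
    iteratedDeriv k (Hyp.weighted (Hyp.sphericalMean f) (Hyp.lift (Real.sinh R • θ))) t =
      iteratedDeriv k (sphereData (fun w => f (Hyp.lift w)) R θ) t := by
  refine Filter.EventuallyEq.iteratedDeriv_eq k ?_
  filter_upwards [Ioi_mem_nhds ht] with s hs
  rw [weighted_sphericalMean hf _ hs]
  exact (indicator_of_mem hs _).symm

end Data

/-! ### The regularized logarithm and its integrations by parts. -/

section LogKernel

/-- The kernel `Re (iⁿ log (s + i ε))`. -/
def logKernel (n : ℕ) (ε s : ℝ) : ℝ := (Complex.I ^ n * Complex.log (s + ε * Complex.I)).re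

/-- The kernel `Re (iⁿ (s + i ε)^{-k})`. -/
def powKernel (n k : ℕ) (ε s : ℝ) : ℝ := (Complex.I ^ n * ((s + ε * Complex.I) ^ k)⁻¹).re

theorem hasDerivAt_logKernel (n : ℕ) {ε : ℝ} (hε : 0 < ε) (s : ℝ) :
    HasDerivAt (logKernel n ε) (powKernel n 1 ε s) s := by
  have hm : (s : ℂ) + ε * Complex.I ∈ Complex.slitPlane := by
    rw [Complex.mem_slitPlane_iff]
    right
    rw [im_add_mul_I]
    exact hε.ne'
  have h1 : HasDerivAt (fun s : ℝ => (s : ℂ) + ε * Complex.I) 1 s :=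
    ((hasDerivAt_id s).ofReal_comp).add_const _
  have h2 := Complex.reCLM.hasFDerivAt.comp_hasDerivAt s
    (((Complex.hasDerivAt_log hm).comp s h1).const_mul (Complex.I ^ n))
  refine h2.congr_deriv ?_
  simp [powKernel]

theorem hasDerivAt_powKernel (n k : ℕ) {ε : ℝ} (hε : 0 < ε) (s : ℝ) :
    HasDerivAt (powKernel n k ε) (-k * powKernel n (k + 1) ε s) s := by
  have h1 : HasDerivAt (fun s : ℝ => (s : ℂ) + ε * Complex.I) 1 s :=
    ((hasDerivAt_id s).ofReal_comp).add_const _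
  have h3 := hasDerivAt_inv_pow 0 k (z := (s : ℂ) + ε * Complex.I) (by rwa [im_add_mul_I])
  have h2 := Complex.reCLM.hasFDerivAt.comp_hasDerivAt s
    ((h3.comp s h1).const_mul (Complex.I ^ n))
  simp only [Complex.ofReal_zero, zero_add, Function.comp_def] at h2
  refine h2.congr_deriv ?_
  rw [powKernel, Complex.reCLM_apply, mul_one, mul_left_comm, ← Complex.ofReal_natCast,
    ← Complex.ofReal_neg, Complex.re_ofReal_mul]

theorem continuous_powKernel (n k : ℕ) {ε : ℝ} (hε : 0 < ε) : Continuous (powKernel n k ε) :=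
  continuous_iff_continuousAt.2 fun s => (hasDerivAt_powKernel n k hε s).continuousAt

theorem measurable_logKernel (n : ℕ) (ε : ℝ) : Measurable (logKernel n ε) := by
  unfold logKernel
  fun_prop

variable {F : Type*} [NormedAddCommGroup F] [NormedSpace ℝ F]

theorem integral_smul_deriv_of_hasCompactSupport {a a' : ℝ → ℝ} (ha : ∀ t, HasDerivAt a (a' t) t)
    (ha' : Continuous a') {φ : ℝ → F} (hφ : ContDiff ℝ ∞ φ) (hc : HasCompactSupport φ) :
    ∫ t, a t • deriv φ t = -∫ t, a' t • φ t := by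
  have hac : Continuous a := continuous_iff_continuousAt.2 fun t => (ha t).continuousAt
  refine integral_bilinear_hasDerivAt_right_eq_neg_left_of_integrable
    (L := ContinuousLinearMap.lsmul ℝ ℝ) (fun t _ => ha t)
    (fun t _ => (hφ.differentiable (by simp) t).hasDerivAt) ?_ ?_ ?_
  · exact (hac.smul (hφ.continuous_deriv (by simp))).integrable_of_hasCompactSupport
      hc.deriv.smul_left
  · exact (ha'.smul hφ.continuous).integrable_of_hasCompactSupport hc.smul_left
  · exact (hac.smul hφ.continuous).integrable_of_hasCompactSupport hc.smul_left

/-- Each integration by parts raises the exponent by one; its minus sign cancels that of the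
derivative of the power, and the exponents accumulate to m!. -/
theorem integral_powKernel_smul_iteratedDeriv (n : ℕ) {ε : ℝ} (hε : 0 < ε) (τ : ℝ) (m : ℕ)
    {φ : ℝ → F} (hφ : ContDiff ℝ ∞ φ) (hc : HasCompactSupport φ) :
    ∫ t, powKernel n 1 ε (t - τ) • iteratedDeriv m φ t =
      (m.factorial : ℝ) • ∫ t, powKernel n (m + 1) ε (t - τ) • φ t := by
  induction m generalizing φ with
  | zero => simp
  | succ m ih =>
    have hφ' : ContDiff ℝ ∞ (deriv φ) := (contDiff_infty_iff_deriv.1 hφ).2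
    simp only [iteratedDeriv_succ']
    rw [ih hφ' hc.deriv, integral_smul_deriv_of_hasCompactSupport
      (fun t => (hasDerivAt_powKernel n (m + 1) hε (t - τ)).comp_sub_const t τ)
      (continuous_const.mul ((continuous_powKernel n _ hε).comp (by fun_prop))) hφ hc,
      ← integral_neg, ← integral_smul, ← integral_smul]
    refine integral_congr_ae (.of_forall fun t => ?_)
    simp only [smul_smul, ← neg_smul]
    congr 1
    rw [Nat.factorial_succ]
    push_cast
    ring

theorem integral_logKernel_smul_iteratedDeriv (n : ℕ) {ε : ℝ} (hε : 0 < ε) (τ : ℝ) (m : ℕ)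
    {φ : ℝ → F} (hφ : ContDiff ℝ ∞ φ) (hc : HasCompactSupport φ) :
    ∫ t, logKernel n ε (t - τ) • iteratedDeriv (m + 1) φ t =
      -(m.factorial : ℝ) • ∫ t, powKernel n (m + 1) ε (t - τ) • φ t := by
  have h1 : ContDiff ℝ ∞ (iteratedDeriv m φ) := by
    rw [iteratedDeriv_eq_iterate]
    exact hφ.iterate_deriv m
  have h2 : HasCompactSupport (iteratedDeriv m φ) := by
    induction m with
    | zero => simpa using hc
    | succ m ih =>
      rw [iteratedDeriv_succ]
      refine (ih ?_).deriv
      rw [iteratedDeriv_eq_iterate]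
      exact hφ.iterate_deriv m
  simp only [iteratedDeriv_succ]
  rw [neg_smul, ← integral_powKernel_smul_iteratedDeriv n hε τ m hφ hc,
    integral_smul_deriv_of_hasCompactSupport
      (fun t => (hasDerivAt_logKernel n hε (t - τ)).comp_sub_const t τ)
      ((continuous_powKernel n _ hε).comp (by fun_prop)) h1 h2]

end LogKernel

/-! ### Limit and majorant of the logarithmic kernel. -/

section LogKernelLimit

/-- The modulus of s+iε lies between |s| and |s|+1, so log x ≤ x-1 controls the logarithm from above
and log|s| from below; the argument is at most π. -/
theorem abs_logKernel_le (n : ℕ) {ε s : ℝ} (hs : s ≠ 0) (hε0 : 0 ≤ ε) (hε1 : ε ≤ 1) :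
    |logKernel n ε s| ≤ |s| + |Real.log s| + Real.pi := by
  set z : ℂ := s + ε * Complex.I with hz
  have h1 : |s| ≤ ‖z‖ := by
    have := Complex.abs_re_le_norm z
    simpa [hz] using this
  have h2 : ‖z‖ ≤ |s| + 1 := by
    refine (norm_add_le _ _).trans ?_
    rw [norm_mul, Complex.norm_I, mul_one, Complex.norm_real, Complex.norm_real, Real.norm_eq_abs,
      Real.norm_of_nonneg hε0]
    linarith
  have hs0 : 0 < |s| := abs_pos.2 hs
  have h3 : |Real.log ‖z‖| ≤ |s| + |Real.log s| := by
    rw [abs_le]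
    constructor
    · have h4 := Real.log_le_log hs0 h1
      rw [Real.log_abs] at h4
      linarith [neg_abs_le (Real.log s)]
    · have h4 := Real.log_le_sub_one_of_pos (hs0.trans_le h1)
      linarith [abs_nonneg (Real.log s)]
  have h4 : |logKernel n ε s| ≤ ‖Complex.log z‖ := by
    refine (Complex.abs_re_le_norm _).trans ?_
    rw [norm_mul, norm_pow, Complex.norm_I, one_pow, one_mul]
  refine h4.trans ((Complex.norm_le_abs_re_add_abs_im _).trans ?_)
  rw [Complex.log_re, Complex.log_im]
  exact add_le_add h3 (Complex.abs_arg_le_pi z)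

/-- The approach is from the closed upper half-plane, on which the principal logarithm is continuous
up to the negative axis, with argument π there. -/
theorem tendsto_logKernel (n : ℕ) {s : ℝ} (hs : s ≠ 0) :
    Tendsto (fun ε => logKernel n ε s) (𝓝[>] 0) (𝓝 (logKernel n 0 s)) := by
  have hlog : ContinuousWithinAt Complex.log {z : ℂ | 0 ≤ z.im} (s : ℂ) := by
    rcases lt_or_gt_of_ne hs with h | h
    · exact Complex.continuousWithinAt_log_of_re_neg_of_im_zero (by simpa using h) (by simp)
    · exact (continuousAt_clog (by simpa using h)).continuousWithinAt
  have hlin : Tendsto (fun ε : ℝ => (s : ℂ) + ε * Complex.I) (𝓝[>] 0)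
      (𝓝[{z : ℂ | 0 ≤ z.im}] (s : ℂ)) := by
    refine tendsto_nhdsWithin_iff.2 ⟨Tendsto.mono_left ?_ nhdsWithin_le_nhds, ?_⟩
    · have : Continuous fun ε : ℝ => (s : ℂ) + ε * Complex.I := by fun_prop
      simpa using this.tendsto 0
    · filter_upwards [self_mem_nhdsWithin] with ε hε
      simpa using (le_of_lt hε : (0 : ℝ) ≤ ε)
  have := (Complex.continuous_re.tendsto _).comp
    ((hlog.tendsto.comp hlin).const_mul (Complex.I ^ n))
  simpa [logKernel, Function.comp_def] using this

/-- An integrable majorant of the kernels `logKernel n ε` on `[-T, T]`. -/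
def logBound (T s : ℝ) : ℝ :=
  (Icc (-T) T).indicator (fun s => |s| + |Real.log s| + Real.pi) s

theorem logBound_nonneg (T s : ℝ) : 0 ≤ logBound T s :=
  indicator_nonneg (fun s _ => by have := Real.pi_pos; positivity) s

theorem integrable_logBound (T : ℝ) : Integrable (logBound T) := by
  unfold logBound
  rw [integrable_indicator_iff measurableSet_Icc]
  have h1 : IntegrableOn (fun s : ℝ => |s|) (Icc (-T) T) :=
    continuous_abs.continuousOn.integrableOn_Icc
  have h2 : IntegrableOn (fun s : ℝ => |Real.log s|) (Icc (-T) T) := by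
    rcases le_or_gt (-T) T with h | h
    · rw [← uIcc_of_le h, ← intervalIntegrable_iff']
      exact intervalIntegral.intervalIntegrable_log'.abs
    · simp [Icc_eq_empty_of_lt h]
  exact (h1.add h2).add (integrableOn_const (by simp))

theorem integrable_logBound_sub (T τ : ℝ) : Integrable fun t => logBound T (t - τ) :=
  (integrable_logBound T).comp_sub_right τ

theorem integral_logBound_sub (T τ : ℝ) : ∫ t, logBound T (t - τ) = ∫ t, logBound T t :=
  integral_sub_right_eq_self (logBound T) τ

end LogKernelLimit

/-! ### The backprojection with regularized kernel. -/

section Smoothed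

variable {n : ℕ} {F : Type*} [NormedAddCommGroup F] [NormedSpace ℝ F]

local notation "E" => EuclideanSpace ℝ (Fin n)

/-- The inner integral of the backprojection with kernel `logKernel n ε`. -/
def innerBackprojection (g : EuclideanSpace ℝ (Fin n) → F) (R ε : ℝ)
    (x θ : EuclideanSpace ℝ (Fin n)) : F :=
  ∫ t, logKernel n ε (t - levelFun R θ x) • iteratedDeriv (n - 2) (sphereData g R θ) t

/-- Both `levelFun R θ x` and every t in the support of the data lie between 1 and cosh 2R, so their
difference stays in the window of the majorant. -/
theorem norm_logKernel_smul_le {R R' : ℝ} (hR : 0 < R) (hRR : R' < R) (hR' : 0 ≤ R')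
    {g : E → F} (hg : ∀ y, g y ≠ 0 → ‖y‖ ≤ Real.sinh R') {x : E} (hx : ‖x‖ < Real.sinh R)
    {M : ℝ} {k : ℕ} (hM : ∀ (θ : Metric.sphere (0 : E) 1) (t : ℝ),
      ‖iteratedDeriv k (sphereData g R (θ : E)) t‖ ≤ M) {ε : ℝ} (hε0 : 0 ≤ ε) (hε1 : ε ≤ 1)
    (θ : Metric.sphere (0 : E) 1) {t : ℝ} (ht : t ≠ levelFun R θ x) :
    ‖logKernel n ε (t - levelFun R θ x) • iteratedDeriv k (sphereData g R (θ : E)) t‖ ≤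
      M * logBound (Real.cosh (2 * R)) (t - levelFun R θ x) := by
  have hM0 : 0 ≤ M := (norm_nonneg _).trans (hM θ 0)
  have hθ : ‖(θ : E)‖ = 1 := norm_eq_of_mem_sphere θ
  by_cases h : t ∈ Icc (Real.cosh (R - R')) (Real.cosh (R + R'))
  · have h1 := levelFun_mem_Ioo hR hθ hx
    have h2 : Real.cosh (R + R') ≤ Real.cosh (2 * R) := by
      rw [Real.cosh_le_cosh, abs_of_nonneg (by linarith), abs_of_nonneg (by linarith)]
      linarith
    have h3 := (one_lt_cosh_sub hRR).trans_le h.1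
    have hmem : t - levelFun R θ x ∈ Icc (-Real.cosh (2 * R)) (Real.cosh (2 * R)) :=
      ⟨by linarith [h1.2], by linarith [h1.1, h.2]⟩
    rw [logBound, indicator_of_mem hmem, norm_smul, mul_comm]
    gcongr
    · exact hM θ t
    · exact abs_logKernel_le n (sub_ne_zero.2 ht) hε0 hε1
  · rw [iteratedDeriv_sphereData_eq_zero hR hRR hg hθ h, smul_zero, norm_zero]
    exact mul_nonneg hM0 (logBound_nonneg _ _)

theorem stronglyMeasurable_logKernel_smul {R R' : ℝ} (hR : 0 < R) (hRR : R' < R)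
    {g : E → F} (hgs : ContDiff ℝ ∞ g) (hg : ∀ y, g y ≠ 0 → ‖y‖ ≤ Real.sinh R') (x : E) (ε : ℝ)
    (k : ℕ) :
    StronglyMeasurable fun p : Metric.sphere (0 : E) 1 × ℝ =>
      logKernel n ε (p.2 - levelFun R p.1 x) • iteratedDeriv k (sphereData g R (p.1 : E)) p.2 := by
  have h1 : Measurable fun p : Metric.sphere (0 : E) 1 × ℝ => p.2 - levelFun R (p.1 : E) x := by
    unfold levelFun
    fun_prop
  exact ((measurable_logKernel n ε).comp h1).stronglyMeasurable.smul
    (continuous_iteratedDeriv_sphereData hR hRR hgs hg k).stronglyMeasurable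

theorem ae_ne_real (τ : ℝ) : ∀ᵐ t : ℝ, t ≠ τ := by simp [ae_iff]

theorem integrable_logKernel_smul {R R' : ℝ} (hR : 0 < R) (hRR : R' < R) (hR' : 0 ≤ R')
    {g : E → F} (hgs : ContDiff ℝ ∞ g) (hg : ∀ y, g y ≠ 0 → ‖y‖ ≤ Real.sinh R') {x : E}
    (hx : ‖x‖ < Real.sinh R) {ε : ℝ} (hε0 : 0 ≤ ε) (hε1 : ε ≤ 1) (θ : Metric.sphere (0 : E) 1)
    (k : ℕ) :
    Integrable fun t => logKernel n ε (t - levelFun R θ x) •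
      iteratedDeriv k (sphereData g R (θ : E)) t := by
  obtain ⟨M, hM0, hM⟩ := exists_bound_iteratedDeriv_sphereData hR hRR hgs hg k
  have hm : StronglyMeasurable fun t => logKernel n ε (t - levelFun R θ x) •
      iteratedDeriv k (sphereData g R (θ : E)) t :=
    ((measurable_logKernel n ε).comp (measurable_id.sub_const _)).stronglyMeasurable.smul
      ((continuous_iteratedDeriv_sphereData hR hRR hgs hg k).comp
        (Continuous.prodMk_right θ)).stronglyMeasurable
  have hb : Integrable fun t => M * logBound (Real.cosh (2 * R)) (t - levelFun R θ x) :=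
    (integrable_logBound_sub _ _).const_mul M
  have hle : ∀ᵐ t, ‖logKernel n ε (t - levelFun R θ x) •
      iteratedDeriv k (sphereData g R (θ : E)) t‖ ≤
        M * logBound (Real.cosh (2 * R)) (t - levelFun R θ x) := by
    filter_upwards [ae_ne_real (levelFun R θ x)] with t ht
    exact norm_logKernel_smul_le hR hRR hR' hg hx hM hε0 hε1 θ ht
  exact hb.mono' hm.aestronglyMeasurable hle

theorem norm_innerBackprojection_le {R R' : ℝ} (hR : 0 < R) (hRR : R' < R) (hR' : 0 ≤ R')
    {g : E → F} (hg : ∀ y, g y ≠ 0 → ‖y‖ ≤ Real.sinh R') {x : E} (hx : ‖x‖ < Real.sinh R)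
    {M : ℝ} (hM : ∀ (θ : Metric.sphere (0 : E) 1) (t : ℝ),
      ‖iteratedDeriv (n - 2) (sphereData g R (θ : E)) t‖ ≤ M) {ε : ℝ} (hε0 : 0 ≤ ε) (hε1 : ε ≤ 1)
    (θ : Metric.sphere (0 : E) 1) :
    ‖innerBackprojection g R ε x θ‖ ≤ M * ∫ s, logBound (Real.cosh (2 * R)) s := by
  rw [← integral_logBound_sub _ (levelFun R θ x), ← integral_const_mul]
  refine norm_integral_le_of_norm_le ((integrable_logBound_sub _ _).const_mul M) ?_
  filter_upwards [ae_ne_real (levelFun R θ x)] with t ht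
  exact norm_logKernel_smul_le hR hRR hR' hg hx hM hε0 hε1 θ ht

theorem aestronglyMeasurable_innerBackprojection {R R' : ℝ} (hR : 0 < R) (hRR : R' < R)
    {g : E → F} (hgs : ContDiff ℝ ∞ g) (hg : ∀ y, g y ≠ 0 → ‖y‖ ≤ Real.sinh R') (x : E) (ε : ℝ) :
    AEStronglyMeasurable (fun θ : Metric.sphere (0 : E) 1 => innerBackprojection g R ε x θ)
      (volume : Measure E).toSphere :=
  (stronglyMeasurable_logKernel_smul hR hRR hgs hg x ε
    (n - 2)).integral_prod_right.aestronglyMeasurable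

theorem integrable_innerBackprojection {R R' : ℝ} (hR : 0 < R) (hRR : R' < R) (hR' : 0 ≤ R')
    {g : E → F} (hgs : ContDiff ℝ ∞ g) (hg : ∀ y, g y ≠ 0 → ‖y‖ ≤ Real.sinh R') {x : E}
    (hx : ‖x‖ < Real.sinh R) {ε : ℝ} (hε0 : 0 ≤ ε) (hε1 : ε ≤ 1) :
    Integrable (fun θ : Metric.sphere (0 : E) 1 => innerBackprojection g R ε x θ)
      (volume : Measure E).toSphere := by
  obtain ⟨M, hM0, hM⟩ := exists_bound_iteratedDeriv_sphereData hR hRR hgs hg (n - 2)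
  exact .of_bound (aestronglyMeasurable_innerBackprojection hR hRR hgs hg x ε) _
    (.of_forall fun θ => norm_innerBackprojection_le hR hRR hR' hg hx hM hε0 hε1 θ)

theorem eventually_nhdsGT_zero_mem : ∀ᶠ ε : ℝ in 𝓝[>] 0, 0 < ε ∧ ε ≤ 1 := by
  filter_upwards [Ioc_mem_nhdsGT one_pos] with ε hε using hε

/-- Dominated convergence twice, in t and then over the sphere; translation invariance makes the
bound on the t-integral uniform in θ. -/
theorem tendsto_integral_innerBackprojection {R R' : ℝ} (hR : 0 < R) (hRR : R' < R)
    (hR' : 0 ≤ R') {g : E → F} (hgs : ContDiff ℝ ∞ g)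
    (hg : ∀ y, g y ≠ 0 → ‖y‖ ≤ Real.sinh R') {x : E} (hx : ‖x‖ < Real.sinh R) :
    Tendsto (fun ε => ∫ θ : Metric.sphere (0 : E) 1, innerBackprojection g R ε x θ
      ∂(volume : Measure E).toSphere) (𝓝[>] 0)
      (𝓝 (∫ θ : Metric.sphere (0 : E) 1, innerBackprojection g R 0 x θ
        ∂(volume : Measure E).toSphere)) := by
  obtain ⟨M, hM0, hM⟩ := exists_bound_iteratedDeriv_sphereData hR hRR hgs hg (n - 2)
  have hmem := eventually_nhdsGT_zero_mem
  have hpt (θ : Metric.sphere (0 : E) 1) : Tendsto (fun ε => innerBackprojection g R ε x θ)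
      (𝓝[>] 0) (𝓝 (innerBackprojection g R 0 x θ)) := by
    have hb : Integrable fun t => M * logBound (Real.cosh (2 * R)) (t - levelFun R θ x) :=
      (integrable_logBound_sub _ _).const_mul M
    refine tendsto_integral_filter_of_dominated_convergence _ ?_ ?_ hb ?_
    · exact hmem.mono fun ε hε => (integrable_logKernel_smul hR hRR hR' hgs hg hx hε.1.le hε.2 θ
        (n - 2)).aestronglyMeasurable
    · refine hmem.mono fun ε hε => (ae_ne_real (levelFun R θ x)).mono fun t ht => ?_
      exact norm_logKernel_smul_le hR hRR hR' hg hx hM hε.1.le hε.2 θ ht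
    · refine (ae_ne_real (levelFun R θ x)).mono fun t ht => ?_
      exact (tendsto_logKernel n (sub_ne_zero.2 ht)).smul_const _
  refine tendsto_integral_filter_of_dominated_convergence
    (fun _ => M * ∫ s, logBound (Real.cosh (2 * R)) s) ?_ ?_ (integrable_const _)
    (.of_forall hpt)
  · exact .of_forall fun ε => aestronglyMeasurable_innerBackprojection hR hRR hgs hg x ε
  · exact hmem.mono fun ε hε => .of_forall fun θ =>
      norm_innerBackprojection_le hR hRR hR' hg hx hM hε.1.le hε.2 θ

/-- The smoothed backprojection kernel on the sphere. -/
def sphereKernel (R ε : ℝ) (x y : EuclideanSpace ℝ (Fin n)) : ℝ :=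
  ∫ θ : Metric.sphere (0 : EuclideanSpace ℝ (Fin n)) 1,
    powKernel n (n - 2) ε (levelFun R θ y - levelFun R θ x)
    ∂(volume : Measure (EuclideanSpace ℝ (Fin n))).toSphere

/-- Integration by parts n-2 times turns the logarithm into the power of order n-2; the pushforward
formula then trades t for the level of y. -/
theorem innerBackprojection_eq (hn : 2 < n) {R R' : ℝ} (hR : 0 < R) (hRR : R' < R)
    {g : E → F} (hgs : ContDiff ℝ ∞ g) (hgc : HasCompactSupport g)
    (hg : ∀ y, g y ≠ 0 → ‖y‖ ≤ Real.sinh R') (x : E) {ε : ℝ}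
    (hε : 0 < ε) (θ : Metric.sphere (0 : E) 1) :
    innerBackprojection g R ε x θ = (-((n - 3).factorial : ℝ) * (Hyp.unitSphereArea n)⁻¹) •
      ∫ y, powKernel n (n - 2) ε (levelFun R θ y - levelFun R θ x) •
        ((√(1 + ‖y‖ ^ 2))⁻¹ • g y) := by
  have hθ : ‖(θ : E)‖ = 1 := norm_eq_of_mem_sphere θ
  have h0 := hasCompactSupport_iteratedDeriv_sphereData hR hRR hg hθ 0
  rw [iteratedDeriv_zero] at h0
  have h1 := integral_logKernel_smul_iteratedDeriv n hε (levelFun R θ x) (n - 3)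
    (contDiff_sphereData hR hRR hgs hg hθ) h0
  rw [show n - 3 + 1 = n - 2 by omega] at h1
  rw [innerBackprojection, h1, mul_smul]
  congr 1
  have h2 := integral_smul_weightedMean hn hgs.continuous hgc (Real.sinh R • (θ : E))
    (φ := fun t => powKernel n (n - 2) ε (t - levelFun R θ x))
    ((continuous_powKernel n _ hε).comp (by fun_prop))
  have h3 : ∀ y : E, (powKernel n (n - 2) ε (levelFun R θ y - levelFun R θ x) / √(1 + ‖y‖ ^ 2)) •
      g y = powKernel n (n - 2) ε (levelFun R θ y - levelFun R θ x) •
        ((√(1 + ‖y‖ ^ 2))⁻¹ • g y) := fun y => by rw [smul_smul, div_eq_mul_inv]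
  simp only [form_lift_smul R hθ, h3] at h2
  rw [← h2, ← integral_indicator measurableSet_Ioi]
  refine integral_congr_ae (.of_forall fun t => ?_)
  by_cases ht : t ∈ Ioi (1 : ℝ)
  · simp [sphereData, ht]
  · simp [sphereData, ht]

theorem integral_innerBackprojection_eq [CompleteSpace F] (hn : 2 < n) {R R' : ℝ} (hR : 0 < R)
    (hRR : R' < R) {g : E → F} (hgs : ContDiff ℝ ∞ g) (hgc : HasCompactSupport g)
    (hg : ∀ y, g y ≠ 0 → ‖y‖ ≤ Real.sinh R') (x : E) {ε : ℝ} (hε : 0 < ε) :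
    ∫ θ : Metric.sphere (0 : E) 1, innerBackprojection g R ε x θ
      ∂(volume : Measure E).toSphere =
      (-((n - 3).factorial : ℝ) * (Hyp.unitSphereArea n)⁻¹) •
        ∫ y, sphereKernel R ε x y • ((√(1 + ‖y‖ ^ 2))⁻¹ • g y) := by
  simp only [innerBackprojection_eq hn hR hRR hgs hgc hg x hε]
  rw [integral_smul]
  congr 1
  have hcont : Continuous (Function.uncurry fun (θ : Metric.sphere (0 : E) 1) (y : E) =>
      powKernel n (n - 2) ε (levelFun R θ y - levelFun R θ x) •
        ((√(1 + ‖y‖ ^ 2))⁻¹ • g y)) := by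
    have hgc' := hgs.continuous
    have h1 : Continuous fun p : Metric.sphere (0 : E) 1 × E =>
        levelFun R p.1 p.2 - levelFun R p.1 x := by
      unfold levelFun
      fun_prop
    refine ((continuous_powKernel n _ hε).comp h1).smul (Continuous.smul ?_ (by fun_prop))
    refine Continuous.inv₀ (by fun_prop) fun p => ?_
    have : 0 < √(1 + ‖p.2‖ ^ 2) := Real.sqrt_pos.2 (by positivity)
    exact this.ne'
  rw [integral_integral_swap_of_hasCompactSupport hcont]
  · refine integral_congr_ae (.of_forall fun y => ?_)
    exact integral_smul_const (fun θ : Metric.sphere (0 : E) 1 =>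
      powKernel n (n - 2) ε (levelFun R θ y - levelFun R θ x)) _
  · refine .intro (isCompact_univ.prod hgc) fun p hp => ?_
    have : p.2 ∉ tsupport g := fun h => hp ⟨mem_univ _, h⟩
    simp [Function.uncurry, image_eq_zero_of_notMem_tsupport this]

end Smoothed

/-! ### Convergence of the smoothed kernel to the Newton kernel. -/

section SphereKernel

variable {n : ℕ}

local notation "E" => EuclideanSpace ℝ (Fin n)

/-- On the ball |z| ≤ sinh r one has |z| ≤ tanh r·√(1+|z|²); a difference of squares turns this into
a Lipschitz bound with constant tanh r. -/
theorem abs_sqrt_sub_sqrt_le {r : ℝ} (hr : 0 ≤ r) {x y : E} (hx : ‖x‖ ≤ Real.sinh r)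
    (hy : ‖y‖ ≤ Real.sinh r) :
    |√(1 + ‖y‖ ^ 2) - √(1 + ‖x‖ ^ 2)| ≤ Real.sinh r / Real.cosh r * ‖x - y‖ := by
  have hc := Real.cosh_pos r
  have key (z : E) (hz : ‖z‖ ≤ Real.sinh r) :
      ‖z‖ ≤ Real.sinh r / Real.cosh r * √(1 + ‖z‖ ^ 2) := by
    rw [div_mul_eq_mul_div, le_div_iff₀ hc]
    refine le_of_sq_le_sq ?_ (mul_nonneg (Real.sinh_nonneg_iff.2 hr) (Real.sqrt_nonneg _))
    rw [mul_pow, mul_pow, Real.sq_sqrt (by positivity), Real.cosh_sq]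
    nlinarith [pow_le_pow_left₀ (norm_nonneg z) hz 2]
  have hX : 0 < √(1 + ‖x‖ ^ 2) := Real.sqrt_pos.2 (by positivity)
  have hY : 0 < √(1 + ‖y‖ ^ 2) := Real.sqrt_pos.2 (by positivity)
  have h1 : |√(1 + ‖y‖ ^ 2) - √(1 + ‖x‖ ^ 2)| * (√(1 + ‖y‖ ^ 2) + √(1 + ‖x‖ ^ 2)) =
      |‖y‖ - ‖x‖| * (‖y‖ + ‖x‖) := by
    rw [← abs_of_pos (add_pos hY hX), ← abs_of_nonneg (add_nonneg (norm_nonneg y) (norm_nonneg x)),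
      ← abs_mul, ← abs_mul]
    congr 1
    have := Real.sq_sqrt (show 0 ≤ 1 + ‖x‖ ^ 2 by positivity)
    have := Real.sq_sqrt (show 0 ≤ 1 + ‖y‖ ^ 2 by positivity)
    linarith
  have h2 : |‖y‖ - ‖x‖| ≤ ‖x - y‖ := by
    rw [norm_sub_rev]
    exact abs_norm_sub_norm_le y x
  refine le_of_mul_le_mul_right ?_ (add_pos hY hX)
  rw [h1]
  calc |‖y‖ - ‖x‖| * (‖y‖ + ‖x‖)
      ≤ ‖x - y‖ * (Real.sinh r / Real.cosh r * √(1 + ‖y‖ ^ 2) +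
          Real.sinh r / Real.cosh r * √(1 + ‖x‖ ^ 2)) := by
        gcongr
        exacts [key y hy, key x hx]
    _ = _ := by ring

/-- The slope of the level `levelFun R θ` between `x` and `y`. -/
def levelSlope (R : ℝ) (x y : EuclideanSpace ℝ (Fin n)) : ℝ :=
  Real.cosh R * (√(1 + ‖y‖ ^ 2) - √(1 + ‖x‖ ^ 2)) / (Real.sinh R * ‖x - y‖)

theorem abs_levelSlope_le {R r : ℝ} (hR : 0 < R) (hr : 0 ≤ r) {x y : E} (hxy : y ≠ x)
    (hx : ‖x‖ ≤ Real.sinh r) (hy : ‖y‖ ≤ Real.sinh r) :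
    |levelSlope R x y| ≤ Real.cosh R * Real.sinh r / (Real.sinh R * Real.cosh r) := by
  have hs : 0 < Real.sinh R := Real.sinh_pos_iff.2 hR
  have hc := Real.cosh_pos R
  have hc' := Real.cosh_pos r
  have hn : 0 < ‖x - y‖ := norm_pos_iff.2 (sub_ne_zero.2 hxy.symm)
  rw [levelSlope, abs_div, abs_mul, abs_of_pos hc, abs_of_pos (mul_pos hs hn),
    div_le_iff₀ (by positivity)]
  calc _ ≤ Real.cosh R * (Real.sinh r / Real.cosh r * ‖x - y‖) := by
        gcongr
        exact abs_sqrt_sub_sqrt_le hr hx hy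
    _ = _ := by field_simp

/-- This is tanh r < tanh R, that is sinh(R-r) > 0. It keeps the slope β strictly inside (-1,1), the
segment where the zonal limit is known. -/
theorem cosh_mul_sinh_div_lt_one {R r : ℝ} (hR : 0 < R) (hr : r < R) :
    Real.cosh R * Real.sinh r / (Real.sinh R * Real.cosh r) < 1 := by
  have hs : 0 < Real.sinh R := Real.sinh_pos_iff.2 hR
  have hc := Real.cosh_pos r
  rw [div_lt_one (by positivity)]
  have : 0 < Real.sinh (R - r) := Real.sinh_pos_iff.2 (by linarith)
  rw [Real.sinh_sub] at this
  linarith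

/-- The level difference is sinh R·|x-y|·(⟨θ,e⟩+β); the power is homogeneous, so the scale comes out
and ε is divided by it. -/
theorem sphereKernel_eq {R ε : ℝ} (hR : 0 < R) (hε : 0 < ε) {x y : E} (hxy : y ≠ x) :
    sphereKernel R ε x y = ((Real.sinh R * ‖x - y‖) ^ (n - 2))⁻¹ *
      (zonalPotential (‖x - y‖⁻¹ • (x - y))
        (levelSlope R x y + (ε / (Real.sinh R * ‖x - y‖) : ℝ) * Complex.I)).re := by
  have hn : 0 < ‖x - y‖ := norm_pos_iff.2 (sub_ne_zero.2 hxy.symm)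
  have hs : 0 < Real.sinh R * ‖x - y‖ := mul_pos (Real.sinh_pos_iff.2 hR) hn
  have hδ : 0 < ((levelSlope R x y : ℂ) +
      (ε / (Real.sinh R * ‖x - y‖) : ℝ) * Complex.I).im := by
    rw [im_add_mul_I]
    positivity
  rw [zonalPotential, zonal, ← integral_const_mul]
  have hint := (integrable_of_continuous_sphere
    (continuous_inv_pow (‖x - y‖⁻¹ • (x - y)) (n - 2) hδ)).const_mul (Complex.I ^ n)
  have h1 := integral_re (𝕜 := ℂ) hint
  simp only [RCLike.re_to_complex] at h1
  rw [← h1, ← integral_const_mul, sphereKernel]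
  refine integral_congr_ae (.of_forall fun θ => ?_)
  have h2 : ((levelFun R θ y - levelFun R θ x : ℝ) : ℂ) + ε * Complex.I =
      (Real.sinh R * ‖x - y‖ : ℝ) * ((inner ℝ (θ : E) (‖x - y‖⁻¹ • (x - y)) : ℝ) +
        (levelSlope R x y + (ε / (Real.sinh R * ‖x - y‖) : ℝ) * Complex.I)) := by
    have h3 : levelFun R θ y - levelFun R θ x = (Real.sinh R * ‖x - y‖) *
        (inner ℝ (θ : E) (‖x - y‖⁻¹ • (x - y)) + levelSlope R x y) := by
      rw [levelFun, levelFun, levelSlope, real_inner_smul_right, inner_sub_right]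
      have := Real.sinh_pos_iff.2 hR
      field_simp
      ring
    have h4 : ε = (Real.sinh R * ‖x - y‖) * (ε / (Real.sinh R * ‖x - y‖)) := by
      field_simp
    rw [h3]
    nth_rewrite 1 [h4]
    push_cast
    ring
  beta_reduce
  rw [powKernel, h2, mul_pow, mul_inv, mul_left_comm, ← Complex.ofReal_pow, ← Complex.ofReal_inv,
    Complex.re_ofReal_mul]

theorem integrable_newtonKernel_smul (hn : 2 < n) {F : Type*} [NormedAddCommGroup F]
    [NormedSpace ℝ F] {h : E → F} (hh : Continuous h) (hc : HasCompactSupport h) (x : E) :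
    Integrable fun y => (‖x - y‖ ^ (n - 2))⁻¹ • h y := by
  have h1 := hc.convolutionExists_right (ContinuousLinearMap.lsmul ℝ ℝ)
    (locallyIntegrable_newtonKernel hn) hh x
  have h2 : Integrable fun y : E => (‖y‖ ^ (n - 2))⁻¹ • h (x - y) := h1
  simpa using h2.comp_sub_left x

theorem aestronglyMeasurable_sphereKernel (R : ℝ) {ε : ℝ} (hε : 0 < ε) (x : E) :
    AEStronglyMeasurable (fun y => sphereKernel R ε x y) := by
  have h1 : Continuous fun p : E × Metric.sphere (0 : E) 1 =>
      levelFun R p.2 p.1 - levelFun R p.2 x := by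
    unfold levelFun
    fun_prop
  exact ((continuous_powKernel n (n - 2) hε).comp
    h1).stronglyMeasurable.integral_prod_right'.aestronglyMeasurable

/-- Dominated convergence: uniformly for slopes |β| ≤ q < 1 the zonal potential is bounded, so a
multiple of |x-y|^{2-n}|h(y)| is a majorant. -/
theorem tendsto_integral_sphereKernel (hn : 2 < n) {F : Type*} [NormedAddCommGroup F]
    [NormedSpace ℝ F] {R r : ℝ} (hR : 0 < R) (hr : 0 ≤ r) (hrR : r < R) {h : E → F}
    (hh : Continuous h) (hc : HasCompactSupport h) (hg : ∀ y, h y ≠ 0 → ‖y‖ ≤ Real.sinh r)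
    {x : E} (hx : ‖x‖ ≤ Real.sinh r) :
    Tendsto (fun ε => ∫ y, sphereKernel R ε x y • h y) (𝓝[>] 0)
      (𝓝 (((Real.sinh R ^ (n - 2))⁻¹ *
        -((n - 2) * (volume : Measure E).toSphere.real univ * betaIntegral (n - 1))) •
          ∫ y, (‖x - y‖ ^ (n - 2))⁻¹ • h y)) := by
  have : Nontrivial E := by
    have : Nonempty (Fin n) := ⟨⟨0, by omega⟩⟩
    infer_instance
  set c := (n - 2) * (volume : Measure E).toSphere.real univ * betaIntegral (n - 1) with hcdef
  set q := Real.cosh R * Real.sinh r / (Real.sinh R * Real.cosh r)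
  have hq : q < 1 := cosh_mul_sinh_div_lt_one hR hrR
  set C := (n - 2) * (volume : Measure E).toSphere.real univ *
    (betaIntegral (n - 1) + ((1 - q) ^ 2) ^ (-((n : ℝ) - 1) / 2))
  have hsR : 0 < Real.sinh R := Real.sinh_pos_iff.2 hR
  have hae : ∀ᵐ y : E, y ≠ x := compl_mem_ae_iff.2 (measure_singleton x)
  have he {y : E} (hy : y ≠ x) : ‖‖x - y‖⁻¹ • (x - y)‖ = 1 := by
    rw [norm_smul, norm_inv, norm_norm, inv_mul_cancel₀]
    exact norm_ne_zero_iff.2 (sub_ne_zero.2 hy.symm)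
  have hpos {y : E} (hy : y ≠ x) : 0 < Real.sinh R * ‖x - y‖ :=
    mul_pos hsR (norm_pos_iff.2 (sub_ne_zero.2 hy.symm))
  rw [← integral_smul]
  refine tendsto_integral_filter_of_dominated_convergence
    (fun y => ((Real.sinh R ^ (n - 2))⁻¹ * C) * ‖(‖x - y‖ ^ (n - 2))⁻¹ • h y‖) ?_ ?_
    ((integrable_newtonKernel_smul hn hh hc x).norm.const_mul _) ?_
  · filter_upwards [self_mem_nhdsWithin] with ε hε
    exact (aestronglyMeasurable_sphereKernel R hε x).smul hh.aestronglyMeasurable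
  · filter_upwards [self_mem_nhdsWithin] with ε (hε : 0 < ε)
    filter_upwards [hae] with y hy
    by_cases h0 : h y = 0
    · simp [h0]
    · have hβ := abs_levelSlope_le hR hr hy hx (hg y h0)
      have h1 := abs_re_zonalPotential_le hn hq _ (he hy) hβ (div_pos hε (hpos hy))
      rw [norm_smul, norm_smul, sphereKernel_eq hR hε hy, norm_mul, Real.norm_eq_abs (Complex.re _),
        Real.norm_of_nonneg (by positivity), Real.norm_of_nonneg (by positivity), mul_pow, mul_inv]
      have h2 : (Real.sinh R ^ (n - 2))⁻¹ * C * ((‖x - y‖ ^ (n - 2))⁻¹ * ‖h y‖) =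
        (Real.sinh R ^ (n - 2))⁻¹ * (‖x - y‖ ^ (n - 2))⁻¹ * C * ‖h y‖ := by ring
      rw [h2]
      gcongr
  · filter_upwards [hae] with y hy
    by_cases h0 : h y = 0
    · simp [h0]
    · have hβ := (abs_levelSlope_le hR hr hy hx (hg y h0)).trans_lt hq
      have h1 : Tendsto (fun ε : ℝ => ε / (Real.sinh R * ‖x - y‖)) (𝓝[>] 0) (𝓝[>] 0) := by
        refine tendsto_nhdsWithin_iff.2 ⟨Tendsto.mono_left ?_ nhdsWithin_le_nhds, ?_⟩
        · simpa using (continuous_id.div_const (Real.sinh R * ‖x - y‖)).tendsto 0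
        · filter_upwards [self_mem_nhdsWithin] with ε hε using div_pos hε (hpos hy)
      have h2 := ((tendsto_re_zonalPotential hn _ (he hy) hβ).comp h1).const_mul
        ((Real.sinh R * ‖x - y‖) ^ (n - 2))⁻¹
      have h3 : Tendsto (fun ε => sphereKernel R ε x y) (𝓝[>] 0)
          (𝓝 (((Real.sinh R * ‖x - y‖) ^ (n - 2))⁻¹ * -c)) := by
        refine h2.congr' ?_
        filter_upwards [self_mem_nhdsWithin] with ε hε
        rw [sphereKernel_eq hR hε hy]
        rfl
      convert h3.smul_const (h y) using 2
      rw [smul_smul, mul_pow, mul_inv]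
      congr 1
      ring

theorem integral_innerBackprojection_zero (hn : 2 < n) {F : Type*} [NormedAddCommGroup F]
    [NormedSpace ℝ F] [CompleteSpace F] {R r : ℝ} (hr : 0 ≤ r) (hrR : r < R) {g : E → F}
    (hgs : ContDiff ℝ ∞ g) (hgc : HasCompactSupport g) (hg : ∀ y, g y ≠ 0 → ‖y‖ ≤ Real.sinh r)
    {x : E} (hx : ‖x‖ < Real.sinh R) :
    ∫ θ : Metric.sphere (0 : E) 1, innerBackprojection g R 0 x θ ∂(volume : Measure E).toSphere =
      ((n - 2).factorial * betaIntegral (n - 1) * (Real.sinh R ^ (n - 2))⁻¹) •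
        ∫ y, (‖x - y‖ ^ (n - 2))⁻¹ • ((√(1 + ‖y‖ ^ 2))⁻¹ • g y) := by
  have hR : 0 < R := hr.trans_lt hrR
  have hn2 : (2 : ℝ) < n := by exact_mod_cast hn
  set r' := max r (Real.arsinh ‖x‖)
  have hr' : r' < R := max_lt hrR (by rwa [← Real.sinh_lt_sinh, Real.sinh_arsinh])
  have hx' : ‖x‖ ≤ Real.sinh r' := by
    rw [← Real.sinh_arsinh ‖x‖, Real.sinh_le_sinh]
    exact le_max_right _ _
  have hinv : Continuous fun y : E => (√(1 + ‖y‖ ^ 2))⁻¹ :=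
    Continuous.inv₀ (by fun_prop) fun y => (Real.sqrt_pos.2 (by positivity)).ne'
  have h1 := (tendsto_integral_sphereKernel hn hR (hr.trans (le_max_left _ _)) hr'
    (h := fun y => (√(1 + ‖y‖ ^ 2))⁻¹ • g y) (hinv.smul hgs.continuous) hgc.smul_left
    (fun y hy => (hg y (right_ne_zero_of_smul hy)).trans
      (Real.sinh_le_sinh.2 (le_max_left _ _))) hx').const_smul
        (-((n - 3).factorial : ℝ) * (Hyp.unitSphereArea n)⁻¹)
  have h2 := tendsto_integral_innerBackprojection hR hrR hr hgs hg hx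
  have h3 := tendsto_nhds_unique (h1.congr' ?_) h2
  · rw [← h3, smul_smul]
    congr 1
    have hσ : 0 < Hyp.unitSphereArea n := by
      unfold Hyp.unitSphereArea
      have := Real.Gamma_pos_of_pos (show (0 : ℝ) < n / 2 by positivity)
      have := Real.pi_pos
      positivity
    -- The sphere areas and the two minus signs cancel, and (n-2)(n-3)! = (n-2)!.
    rw [← unitSphereArea_eq_toSphere (by omega), show n - 2 = n - 3 + 1 by omega,
      Nat.factorial_succ]
    have h4 : ((n - 3 : ℕ) : ℝ) = n - 3 := by rw [Nat.cast_sub (by omega)]; norm_num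
    push_cast
    rw [h4]
    field_simp
    ring
  · filter_upwards [self_mem_nhdsWithin] with ε hε
    exact (integral_innerBackprojection_eq hn hR hrR hgs hgc hg x hε).symm

end SphereKernel

/-! ### The kernel at ε = 0 for each parity, and measures on ∂B. -/

section BoundaryValues

theorem logKernel_zero_of_even {n : ℕ} (hn : Even n) (s : ℝ) :
    logKernel n 0 s = (-1) ^ (n / 2) * Real.log |s| := by
  have h : Complex.I ^ n = (((-1) ^ (n / 2) : ℝ) : ℂ) := by
    nth_rewrite 1 [← Nat.two_mul_div_two_of_even hn]
    rw [pow_mul, Complex.I_sq]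
    push_cast
    rfl
  rw [logKernel, h, Complex.re_ofReal_mul, Complex.ofReal_zero, zero_mul, add_zero,
    Complex.log_re, Complex.norm_real, Real.norm_eq_abs]

/-- For odd n the factor iⁿ is imaginary and selects the argument of s, which is π on the negative
half-line and 0 elsewhere. -/
theorem logKernel_zero_of_odd {n : ℕ} (hn : Odd n) (s : ℝ) :
    logKernel n 0 s = (Iio 0).indicator (fun _ => -((-1) ^ (n / 2) * Real.pi)) s := by
  have h : Complex.I ^ n = (((-1) ^ (n / 2) : ℝ) : ℂ) * Complex.I := by
    nth_rewrite 1 [← Nat.two_mul_div_two_add_one_of_odd hn]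
    rw [pow_succ, pow_mul, Complex.I_sq]
    push_cast
    rfl
  have h1 : logKernel n 0 s = -((-1) ^ (n / 2) * Complex.arg (s : ℂ)) := by
    rw [logKernel, h, mul_assoc, Complex.re_ofReal_mul, Complex.ofReal_zero, zero_mul, add_zero,
      Complex.I_mul_re, Complex.log_im]
    ring
  rw [h1]
  by_cases hs : s < 0
  · rw [indicator_of_mem (by exact hs), Complex.arg_ofReal_of_neg hs]
  · rw [indicator_of_notMem (by exact hs), Complex.arg_ofReal_of_nonneg (not_lt.1 hs), mul_zero,
      neg_zero]

variable {n : ℕ}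

local notation "E" => EuclideanSpace ℝ (Fin n)

/-- The kernel is a step function, so the fundamental theorem of calculus removes one derivative;
this is why the odd formula has order n-3 and no inner integral. -/
theorem innerBackprojection_zero_of_odd {F : Type*} [NormedAddCommGroup F] [NormedSpace ℝ F]
    [CompleteSpace F] (hn : Odd n) (hn2 : 2 < n) {R r : ℝ} (hR : 0 < R) (hr : r < R) {g : E → F}
    (hgs : ContDiff ℝ ∞ g) (hg : ∀ y, g y ≠ 0 → ‖y‖ ≤ Real.sinh r) (x : E) {θ : E}
    (hθ : ‖θ‖ = 1) :
    innerBackprojection g R 0 x θ = -((-1) ^ (n / 2) * Real.pi) •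
      iteratedDeriv (n - 3) (sphereData g R θ) (levelFun R θ x) := by
  have h1 : ContDiff ℝ 1 (iteratedDeriv (n - 3) (sphereData g R θ)) := by
    rw [iteratedDeriv_eq_iterate]
    exact ((contDiff_sphereData hR hr hgs hg hθ).iterate_deriv _).of_le (by simp)
  rw [← (hasCompactSupport_iteratedDeriv_sphereData hR hr hg hθ _).integral_Iic_deriv_eq h1,
    ← iteratedDeriv_succ, show n - 3 + 1 = n - 2 by omega, ← integral_smul,
    integral_Iic_eq_integral_Iio, ← integral_indicator measurableSet_Iio, innerBackprojection]
  refine integral_congr_ae (.of_forall fun t => ?_)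
  beta_reduce
  rw [logKernel_zero_of_odd hn]
  by_cases ht : t < levelFun R θ x
  · rw [indicator_of_mem (by simpa using ht), indicator_of_mem (by simpa using ht)]
  · rw [indicator_of_notMem (by simpa using ht), indicator_of_notMem (by simpa using ht), zero_smul]

theorem mem_gball_iff {R : ℝ} (hR : 0 < R) (x : Hyp n) :
    x ∈ Hyp.gball n R ↔ ‖x.1.1‖ < Real.sinh R := by
  have h1 : Hyp.form x (Hyp.origin n) = x.1.2 := by
    simp [Hyp.form, lorentzForm, Hyp.origin]
  have h2 := Hyp.norm_sq x
  have h3 := x.2.2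
  have hs : 0 < Real.sinh R := Real.sinh_pos_iff.2 hR
  change Real.arcosh (Hyp.form x (Hyp.origin n)) < R ↔ _
  rw [h1, ← Real.arcosh_cosh hR.le, Real.arcosh_lt_arcosh h3 (Real.cosh_pos R),
    Real.arcosh_cosh hR.le, ← abs_of_pos h3, ← abs_of_pos (Real.cosh_pos R), ← sq_lt_sq,
    ← abs_of_nonneg (norm_nonneg x.1.1), ← abs_of_pos hs, ← sq_lt_sq, h2, Real.cosh_sq,
    sub_lt_iff_lt_add]

theorem exists_eq_lift_of_mem_gsphere {R : ℝ} (hR : 0 < R) {ξ : Hyp n} (hξ : ξ ∈ Hyp.gsphere n R) :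
    ∃ θ : E, ‖θ‖ = 1 ∧ ξ = Hyp.lift (Real.sinh R • θ) := by
  have h1 : Hyp.form ξ (Hyp.origin n) = ξ.1.2 := by
    simp [Hyp.form, lorentzForm, Hyp.origin]
  have h2 := Hyp.norm_sq ξ
  have h3 := ξ.2.2
  have hs : 0 < Real.sinh R := Real.sinh_pos_iff.2 hR
  have h4 : 1 ≤ ξ.1.2 := by nlinarith [sq_nonneg ‖ξ.1.1‖]
  have hξ' : Real.arcosh (Hyp.form ξ (Hyp.origin n)) = R := hξ
  rw [h1] at hξ'
  have h5 : ‖ξ.1.1‖ = Real.sinh R := by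
    rw [← hξ', Real.sinh_arcosh h4, ← h2, Real.sqrt_sq (norm_nonneg _)]
  refine ⟨(Real.sinh R)⁻¹ • ξ.1.1, ?_, ?_⟩
  · rw [norm_smul, h5, norm_inv, Real.norm_of_nonneg hs.le, inv_mul_cancel₀ hs.ne']
  · rw [smul_inv_smul₀ hs.ne', Hyp.lift_fst]

theorem spherePoint_origin_cosh {R : ℝ} (hR : 0 < R) (θ : Metric.sphere (0 : E) 1) :
    Hyp.spherePoint (Hyp.origin n) (Real.cosh R) θ = Hyp.lift (Real.sinh R • (θ : E)) := by
  rw [Hyp.spherePoint, Hyp.origin_boost, ← Real.sinh_sq, Real.sqrt_sq (Real.sinh_pos_iff.2 hR).le]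

/-- An embedding allows the change of variables on ∂B for integrands not known to be measurable. -/
theorem measurableEmbedding_spherePoint_origin {R : ℝ} (hR : 0 < R) :
    MeasurableEmbedding (Hyp.spherePoint (Hyp.origin n) (Real.cosh R)) := by
  refine (Continuous.isClosedEmbedding (Hyp.continuous_spherePoint _ _) ?_).measurableEmbedding
  intro θ θ' h
  rw [spherePoint_origin_cosh hR, spherePoint_origin_cosh hR] at h
  have h1 : Real.sinh R • (θ : E) = Real.sinh R • (θ' : E) :=
    congrArg (fun z : Hyp n => z.1.1) h
  exact Subtype.ext (smul_right_injective _ (Real.sinh_pos_iff.2 hR).ne' h1)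

theorem surfaceDensity_cosh {R : ℝ} (hR : 0 < R) (hn : 0 < n) :
    (Real.cosh R ^ 2 - 1) ^ (((n : ℝ) - 1) / 2) = Real.sinh R ^ (n - 1) := by
  have hs := (Real.sinh_pos_iff.2 hR).le
  rw [← Real.sinh_sq, ← Real.rpow_natCast _ 2, ← Real.rpow_mul hs, ← Real.rpow_natCast,
    Nat.cast_sub (by omega)]
  congr 1
  push_cast
  ring

variable {F : Type*} [NormedAddCommGroup F]

theorem integral_surface_origin [NormedSpace ℝ F] {R : ℝ} (hR : 0 < R) (hn : 0 < n)
    (G : Hyp n → F) :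
    ∫ ξ, G ξ ∂(Hyp.surface (Hyp.origin n) (Real.cosh R)) = (Real.sinh R ^ (n - 1)) •
      ∫ θ : Metric.sphere (0 : E) 1, G (Hyp.lift (Real.sinh R • (θ : E)))
        ∂(volume : Measure E).toSphere := by
  have hs := (Real.sinh_pos_iff.2 hR).le
  rw [Hyp.surface, integral_smul_measure, surfaceDensity_cosh hR hn,
    ENNReal.toReal_ofReal (by positivity), (measurableEmbedding_spherePoint_origin hR).integral_map]
  simp only [spherePoint_origin_cosh hR]

theorem integrable_surface_origin {R : ℝ} (hR : 0 < R) {G : Hyp n → F}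
    (hG : Integrable (fun θ : Metric.sphere (0 : E) 1 => G (Hyp.lift (Real.sinh R • (θ : E))))
        (volume : Measure E).toSphere) :
    Integrable G (Hyp.surface (Hyp.origin n) (Real.cosh R)) := by
  refine Integrable.smul_measure ?_ ENNReal.ofReal_ne_top
  rw [(measurableEmbedding_spherePoint_origin hR).integrable_map_iff]
  simpa only [Function.comp_def, spherePoint_origin_cosh hR] using hG

theorem continuous_lift : Continuous fun v : E => Hyp.lift v := by
  unfold Hyp.lift
  apply Continuous.subtype_mk
  fun_prop

theorem mem_gball_lift_iff {R : ℝ} (hR : 0 < R) (v : E) :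
    Hyp.lift v ∈ Hyp.gball n R ↔ v ∈ Metric.ball 0 (Real.sinh R) := by
  have h : (Hyp.lift v).1.1 = v := rfl
  rw [mem_gball_iff hR, h, mem_ball_zero_iff]

/-- A closed set contained in an open ball of a proper space lies in a strictly smaller concentric
ball. The gap r < R supplies all uniform bounds. -/
theorem exists_radius_of_tsupport_subset {R : ℝ} (hR : 0 < R) {f : Hyp n → F}
    (hf : tsupport f ⊆ Hyp.gball n R) :
    ∃ r, 0 ≤ r ∧ r < R ∧ ∀ y, f (Hyp.lift y) ≠ 0 → ‖y‖ ≤ Real.sinh r := by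
  have h1 : IsClosed ((fun v : E => Hyp.lift v) ⁻¹' tsupport f) :=
    (isClosed_tsupport f).preimage continuous_lift
  have h2 : (fun v : E => Hyp.lift v) ⁻¹' tsupport f ⊆ Metric.ball 0 (Real.sinh R) := by
    intro v hv
    exact (mem_gball_lift_iff hR v).1 (hf hv)
  obtain ⟨ρ, hρ, hsub⟩ := exists_lt_subset_ball h1 h2
  refine ⟨max 0 (Real.arsinh ρ), le_max_left _ _, max_lt hR ?_, fun y hy => ?_⟩
  · rwa [← Real.sinh_lt_sinh, Real.sinh_arsinh]
  · have h3 : y ∈ Metric.ball 0 ρ := hsub (subset_tsupport f hy)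
    rw [mem_ball_zero_iff] at h3
    refine h3.le.trans ?_
    nth_rewrite 1 [← Real.sinh_arsinh ρ]
    exact Real.sinh_le_sinh.2 (le_max_right _ _)

end BoundaryValues

/-! ### Identification of f₀ with a Newton potential. -/

section Inversion

variable {n : ℕ} {𝕜 : Type*} [RCLike 𝕜]

local notation "E" => EuclideanSpace ℝ (Fin n)

theorem oddKernel_lift {R : ℝ} (hR : 0 < R) {f : Hyp n → 𝕜} (hf : Hyp.Smooth f) {v : E}
    (hv : ‖v‖ < Real.sinh R) {θ : E} (hθ : ‖θ‖ = 1) :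
    Hyp.oddKernel (Hyp.sphericalMean f) (Hyp.lift v) (Hyp.lift (Real.sinh R • θ)) =
      iteratedDeriv (n - 3) (sphereData (fun w => f (Hyp.lift w)) R θ) (levelFun R θ v) := by
  rw [Hyp.oddKernel, form_lift_smul R hθ,
    iteratedDeriv_weighted_sphericalMean hf R θ (levelFun_mem_Ioo hR hθ hv).1]

theorem evenIntegrand_lift (hn : Even n) {R : ℝ} {f : Hyp n → 𝕜} (hf : Hyp.Smooth f) (v : E)
    {θ : E} (hθ : ‖θ‖ = 1) {t : ℝ} (ht : 1 < t) :
    Hyp.evenIntegrand (Hyp.sphericalMean f) (Hyp.lift v) (Hyp.lift (Real.sinh R • θ)) t =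
      ((-1) ^ (n / 2) : ℝ) • (logKernel n 0 (t - levelFun R θ v) •
        iteratedDeriv (n - 2) (sphereData (fun w => f (Hyp.lift w)) R θ) t) := by
  rw [Hyp.evenIntegrand, form_lift_smul R hθ, iteratedDeriv_weighted_sphericalMean hf R θ ht,
    logKernel_zero_of_even hn, smul_smul, ← mul_assoc, ← mul_pow, neg_one_mul, neg_neg, one_pow,
    one_mul]

theorem intervalIntegrable_evenIntegrand (hn : Even n) {R r : ℝ} (hr : 0 ≤ r) (hrR : r < R)
    {f : Hyp n → 𝕜} (hf : Hyp.Smooth f) (hfr : ∀ y : E, f (Hyp.lift y) ≠ 0 → ‖y‖ ≤ Real.sinh r)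
    {v : E} (hv : ‖v‖ < Real.sinh R) {θ : E} (hθ : ‖θ‖ = 1) :
    IntervalIntegrable (Hyp.evenIntegrand (Hyp.sphericalMean f) (Hyp.lift v)
      (Hyp.lift (Real.sinh R • θ))) volume 1 (Real.cosh (2 * R)) := by
  rw [intervalIntegrable_iff_integrableOn_Ioc_of_le (Real.one_le_cosh _)]
  have h1 := (integrable_logKernel_smul (hr.trans_lt hrR) hrR hr hf hfr hv le_rfl zero_le_one
    ⟨θ, mem_sphere_zero_iff_norm.2 hθ⟩ (n - 2)).smul ((-1) ^ (n / 2) : ℝ)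
  refine h1.integrableOn.congr_fun (fun t ht => ?_) measurableSet_Ioc
  exact (evenIntegrand_lift hn hf v hθ ht.1).symm

/-- The data vanish outside [cosh(R-r), cosh(R+r)], which lies inside the range of integration, so
the integral extends to the whole line. -/
theorem evenKernel_lift (hn : Even n) {R r : ℝ} (hr : 0 ≤ r) (hrR : r < R) {f : Hyp n → 𝕜}
    (hf : Hyp.Smooth f) (hfr : ∀ y : E, f (Hyp.lift y) ≠ 0 → ‖y‖ ≤ Real.sinh r) (v : E)
    {θ : E} (hθ : ‖θ‖ = 1) :
    Hyp.evenKernel R (Hyp.sphericalMean f) (Hyp.lift v) (Hyp.lift (Real.sinh R • θ)) =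
      ((-1) ^ (n / 2) : ℝ) • innerBackprojection (fun w => f (Hyp.lift w)) R 0 v θ := by
  rw [Hyp.evenKernel, intervalIntegral.integral_of_le (Real.one_le_cosh _), innerBackprojection,
    ← integral_smul, setIntegral_congr_fun measurableSet_Ioc
      (fun t ht => evenIntegrand_lift hn hf v hθ ht.1)]
  refine setIntegral_eq_integral_of_forall_compl_eq_zero fun t ht => ?_
  rw [iteratedDeriv_sphereData_eq_zero (hr.trans_lt hrR) hrR hfr hθ, smul_zero, smul_zero]
  refine fun h => ht ⟨(one_lt_cosh_sub hrR).trans_le h.1, h.2.trans ?_⟩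
  rw [Real.cosh_le_cosh, abs_of_nonneg (by linarith), abs_of_nonneg (by linarith)]
  linarith

theorem integrable_oddKernel {R r : ℝ} (hr : 0 ≤ r) (hrR : r < R) {f : Hyp n → 𝕜}
    (hf : Hyp.Smooth f) (hfr : ∀ y : E, f (Hyp.lift y) ≠ 0 → ‖y‖ ≤ Real.sinh r) {v : E}
    (hv : ‖v‖ < Real.sinh R) :
    Integrable (Hyp.oddKernel (Hyp.sphericalMean f) (Hyp.lift v))
      (Hyp.surface (Hyp.origin n) (Real.cosh R)) := by
  have hR := hr.trans_lt hrR
  have hfs : ContDiff ℝ ∞ fun w : E => f (Hyp.lift w) := hf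
  have h1 : Continuous fun θ : Metric.sphere (0 : E) 1 => (θ, levelFun R θ v) := by
    unfold levelFun
    fun_prop
  have h2 := (continuous_iteratedDeriv_sphereData hR hrR hfs hfr (n - 3)).comp h1
  have h3 : Continuous fun θ : Metric.sphere (0 : E) 1 => Hyp.oddKernel (Hyp.sphericalMean f)
      (Hyp.lift v) (Hyp.lift (Real.sinh R • (θ : E))) := by
    refine h2.congr fun θ => ?_
    rw [oddKernel_lift hR hf hv (norm_eq_of_mem_sphere θ)]
    rfl
  have h4 := integrable_of_continuous_sphere h3
  exact integrable_surface_origin hR h4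

theorem integrable_evenKernel (hn : Even n) {R r : ℝ} (hr : 0 ≤ r) (hrR : r < R) {f : Hyp n → 𝕜}
    (hf : Hyp.Smooth f) (hfr : ∀ y : E, f (Hyp.lift y) ≠ 0 → ‖y‖ ≤ Real.sinh r) {v : E}
    (hv : ‖v‖ < Real.sinh R) :
    Integrable (Hyp.evenKernel R (Hyp.sphericalMean f) (Hyp.lift v))
      (Hyp.surface (Hyp.origin n) (Real.cosh R)) := by
  have hR := hr.trans_lt hrR
  refine integrable_surface_origin hR ?_
  simp only [evenKernel_lift hn hr hrR hf hfr v (norm_eq_of_mem_sphere _)]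
  exact (integrable_innerBackprojection hR hrR hr hf hfr hv le_rfl zero_le_one).smul
    ((-1) ^ (n / 2) : ℝ)

/-- Both parities give the prefactor (-1)^[n/2]/π. The surface density sinh^{n-1}R against the
kernel factor sinh^{2-n}R leaves one power of sinh R. -/
theorem backprojection_lift (hn : 2 < n) {R r : ℝ} (hr : 0 ≤ r) (hrR : r < R) {f : Hyp n → 𝕜}
    (hf : Hyp.Smooth f) (hfc : HasCompactSupport fun v : E => f (Hyp.lift v))
    (hfr : ∀ y : E, f (Hyp.lift y) ≠ 0 → ‖y‖ ≤ Real.sinh r) {v : E} (hv : ‖v‖ < Real.sinh R) :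
    Hyp.backprojection R (Hyp.sphericalMean f) (Hyp.lift v) =
      ((-1) ^ (n / 2) / Real.pi * ((n - 2).factorial * betaIntegral (n - 1)) * Real.sinh R) •
        ∫ y, (‖v - y‖ ^ (n - 2))⁻¹ • ((√(1 + ‖y‖ ^ 2))⁻¹ • f (Hyp.lift y)) := by
  have hR := hr.trans_lt hrR
  have hs : 0 < Real.sinh R := Real.sinh_pos_iff.2 hR
  have hsq : ((-1) ^ (n / 2) : ℝ) * (-1) ^ (n / 2) = 1 := by
    rw [← mul_pow, neg_one_mul, neg_neg, one_pow]
  have key : Hyp.backprojection R (Hyp.sphericalMean f) (Hyp.lift v) =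
      ((-1) ^ (n / 2) / Real.pi * Real.sinh R ^ (n - 1)) •
        ∫ θ : Metric.sphere (0 : E) 1, innerBackprojection (fun w => f (Hyp.lift w)) R 0 v θ
          ∂(volume : Measure E).toSphere := by
    rw [Hyp.backprojection]
    split_ifs with h
    · rw [integral_surface_origin hR (by omega)]
      simp only [oddKernel_lift hR hf hv (norm_eq_of_mem_sphere _),
        innerBackprojection_zero_of_odd h hn hR hrR hf hfr v (norm_eq_of_mem_sphere _)]
      rw [integral_smul, smul_smul, ← neg_smul]
      congr 1
      have := Real.pi_ne_zero
      field_simp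
      linear_combination hsq
    · rw [integral_surface_origin hR (by omega)]
      simp only [evenKernel_lift (Nat.not_odd_iff_even.1 h) hr hrR hf hfr v
        (norm_eq_of_mem_sphere _)]
      rw [integral_smul, smul_smul, smul_smul]
      congr 1
      ring
  rw [key, integral_innerBackprojection_zero hn hr hrR hf hfc hfr hv, smul_smul]
  congr 1
  rw [show n - 1 = n - 2 + 1 by omega, pow_succ]
  have := Real.pi_ne_zero
  field_simp

end Inversion

/-! ### The inversion theorem. -/

theorem theorem7p3 {𝕜 : Type*} [RCLike 𝕜] (n : ℕ) (hn : 2 < n) (R : ℝ) (hR : 0 < R)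
    (f : Hyp n → 𝕜) (hf : Hyp.Smooth f) (hsupp : tsupport f ⊆ Hyp.gball n R) :
    -- all derivatives and integrals in the formula exist
    (∀ ξ ∈ Hyp.gsphere n R,
      ContDiffOn ℝ ∞ (Hyp.weighted (Hyp.sphericalMean f) ξ) (Ioi 1)) ∧
    (Odd n → ∀ x ∈ Hyp.gball n R,
      Integrable (Hyp.oddKernel (Hyp.sphericalMean f) x)
        (Hyp.surface (Hyp.origin n) (Real.cosh R))) ∧
    (Even n → ∀ x ∈ Hyp.gball n R,
      (∀ ξ ∈ Hyp.gsphere n R,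
        IntervalIntegrable (Hyp.evenIntegrand (Hyp.sphericalMean f) x ξ) volume
          1 (Real.cosh (2 * R))) ∧
      Integrable (Hyp.evenKernel R (Hyp.sphericalMean f) x)
        (Hyp.surface (Hyp.origin n) (Real.cosh R))) ∧
    ContDiffOn ℝ 2
      (fun v : EuclideanSpace ℝ (Fin n) =>
        Hyp.backprojection R (Hyp.sphericalMean f) (Hyp.lift v))
      (Metric.ball 0 (Real.sinh R)) ∧
    -- the inversion formula
    (∀ x ∈ Hyp.gball n R,
      f x = (Hyp.dConst n * x.1.2 / Real.sinh R) •
        Laplacian.laplacian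
          (fun v : EuclideanSpace ℝ (Fin n) =>
            Hyp.backprojection R (Hyp.sphericalMean f) (Hyp.lift v)) x.1.1) := by
  obtain ⟨r, hr, hrR, hfr⟩ := exists_radius_of_tsupport_subset hR hsupp
  have hf0 (v : EuclideanSpace ℝ (Fin n)) (hv : v ∉ Metric.closedBall 0 (Real.sinh r)) :
      f (Hyp.lift v) = 0 := by
    by_contra h
    exact hv (mem_closedBall_zero_iff.2 (hfr v h))
  have hfc : HasCompactSupport fun v : EuclideanSpace ℝ (Fin n) => f (Hyp.lift v) :=
    .intro (isCompact_closedBall 0 (Real.sinh r)) hf0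
  -- The function inverted by the Laplacian is `f` times the hyperbolic density; the factor x_{n+1}
  -- of the formula undoes this weight.
  set h : EuclideanSpace ℝ (Fin n) → 𝕜 := fun y => (√(1 + ‖y‖ ^ 2))⁻¹ • f (Hyp.lift y) with hdef
  have hhs : ContDiff ℝ ∞ h :=
    (contDiff_sqrt_one_add_norm_sq.inv fun y => (Real.sqrt_pos.2 (by positivity)).ne').smul hf
  have hhc : HasCompactSupport h := by
    refine .intro (isCompact_closedBall 0 (Real.sinh r)) fun v hv => ?_
    rw [hdef]
    beta_reduce
    rw [hf0 v hv, smul_zero]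
  set c := (-1) ^ (n / 2) / Real.pi * ((n - 2).factorial * betaIntegral (n - 1)) * Real.sinh R
  set P := fun x : EuclideanSpace ℝ (Fin n) => ∫ y, (‖x - y‖ ^ (n - 2))⁻¹ • h y
  have hP : ContDiff ℝ ∞ P := contDiff_newtonPotential hn hhs hhc
  have hP2 : ContDiff ℝ 2 P := hP.of_le (by exact WithTop.coe_le_coe.2 le_top)
  have hbp (v : EuclideanSpace ℝ (Fin n)) (hv : ‖v‖ < Real.sinh R) :
      Hyp.backprojection R (Hyp.sphericalMean f) (Hyp.lift v) = (c • P) v := by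
    rw [backprojection_lift hn hr hrR hf hfc hfr hv]
    rfl
  refine ⟨fun ξ hξ => ?_, fun hodd x hx => ?_, fun heven x hx => ⟨fun ξ hξ => ?_, ?_⟩, ?_,
    fun x hx => ?_⟩
  · obtain ⟨θ, hθ, rfl⟩ := exists_eq_lift_of_mem_gsphere hR hξ
    have h1 : ContDiffOn ℝ ∞ (fun t : ℝ => weightedMean (fun w => f (Hyp.lift w))
        (Real.sinh R • θ) t) (Ioi 1) :=
      (contDiffOn_weightedMean hf).comp (contDiff_prodMk_right (Real.sinh R • θ)).contDiffOn
        fun t ht => ⟨mem_univ _, ht⟩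
    exact h1.congr fun t ht => weighted_sphericalMean hf _ ht
  · rw [← Hyp.lift_fst x]
    exact integrable_oddKernel hr hrR hf hfr ((mem_gball_iff hR x).1 hx)
  · obtain ⟨θ, hθ, rfl⟩ := exists_eq_lift_of_mem_gsphere hR hξ
    rw [← Hyp.lift_fst x]
    exact intervalIntegrable_evenIntegrand heven hr hrR hf hfr ((mem_gball_iff hR x).1 hx) hθ
  · rw [← Hyp.lift_fst x]
    exact integrable_evenKernel heven hr hrR hf hfr ((mem_gball_iff hR x).1 hx)
  · exact (hP2.const_smul c).contDiffOn.congr fun v hv =>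
      hbp v (mem_ball_zero_iff.1 hv)
  · have hx' := (mem_gball_iff hR x).1 hx
    -- The identity with the potential is available only inside the ball; equality near the point is
    -- enough for the Laplacian.
    have h1 : (fun v : EuclideanSpace ℝ (Fin n) =>
        Hyp.backprojection R (Hyp.sphericalMean f) (Hyp.lift v)) =ᶠ[𝓝 x.1.1] c • P := by
      filter_upwards [Metric.isOpen_ball.mem_nhds (mem_ball_zero_iff.2 hx')] with v hv
      exact hbp v (mem_ball_zero_iff.1 hv)
    have hx2 : √(1 + ‖x.1.1‖ ^ 2) = x.1.2 := by
      rw [Hyp.norm_sq, add_sub_cancel, Real.sqrt_sq x.2.2.le]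
    have hσ : Hyp.unitSphereArea n =
        n * volume.real (Metric.ball (0 : EuclideanSpace ℝ (Fin n)) 1) := by
      rw [unitSphereArea_eq_toSphere (by omega), Measure.toSphere_real_apply_univ,
        finrank_euclideanSpace_fin]
    have hΔP := laplacian_newtonPotential hn hhs hhc x.1.1
    rw [(InnerProductSpace.laplacian_congr_nhds h1).eq_of_nhds,
      InnerProductSpace.laplacian_smul _ hP2.contDiffAt, hΔP, hdef]
    beta_reduce
    rw [hx2, Hyp.lift_fst, smul_smul, smul_smul, smul_smul]
    have hd := dConst_mul hn
    rw [hσ] at hd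
    have hs : Real.sinh R ≠ 0 := (Real.sinh_pos_iff.2 hR).ne'
    have hx0 : x.1.2 ≠ 0 := x.2.2.ne'
    have hone : Hyp.dConst n * x.1.2 / Real.sinh R * c *
        -((n - 2) * n * volume.real (Metric.ball (0 : EuclideanSpace ℝ (Fin n)) 1)) *
        (x.1.2)⁻¹ = 1 := by
      refine Eq.trans ?_ hd
      simp only [c]
      field_simp
    rw [hone, one_smul]

end
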